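/- Let $\Sigma$ be a finite non-empty terminal alphabet and $\Xi$ an infinite variable alphabet (elements of both are represented by natural numbers). Regex are built from $\varepsilon$, terminals $a\in\Sigma$ and variable references $\&x$ ($x\in\Xi$) by concatenation, disjunction, Kleene plus and variable bindings $\langle x:\beta\rangle$, where $x$ must not occur in $\beta$; in addition, $\emptyset$ alone is a regex. The ref-language $\mathcal R(\alpha)$ is the language of the proper regular expression $\alpha_{\mathcal R}$ obtained from $\alpha$ by reading $\&x$ as a letter $x$ and $\langle x:\beta\rangle$ as $[_x\,\beta\,]_x$ with bracket letters $[_x,\,]_x$. The language $\mathcal L(\alpha)$ consists of the words obtained from the words of $\mathcal R(\alpha)$ by replacing each $x$ by the (dereferenced) content $v$ of the nearest factor $[_x\,v\,]_x$ to its left, or by $\varepsilon$ if there is none, and deleting all brackets. Let $\tilde\alpha$ be $\alpha_{\mathcal R}$ with its letter occurrences numbered $1,2,3,\dots$ from left to right. Then $\alpha$ is *deterministic* if there are no $\rho_1,\rho_2\in\mathcal L(\tilde\alpha)$, marked words $r,s_1,s_2$ and words $\gamma_1,\gamma_2$ of marked brackets such that 1. $\rho_1=r\gamma_1a_{(i)}s_1$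 and $\rho_2=r\gamma_2a_{(j)}s_2$ with $a\in\Sigma$, $i\ne j$; or 2. $\rho_1=r\gamma_1x_{(i)}s_1$ and $\rho_2=r\gamma_2\chi_{(j)}s_2$ with $x\in\Xi$, $\chi\in\Sigma\cup\Xi$, $i\ne j$; or 3. $\rho_1=r\gamma_1\chi_{(i)}s_1$ and $\rho_2=r\gamma_2\chi_{(i)}s_2$ with $\chi\in\Sigma\cup\Xi$, $\gamma_1\neq\gamma_2$; or 4. $\rho_1=r\gamma_1$ and $\rho_2=r\gamma_2$ with $\gamma_1\ne\gamma_2$. **Theorem.** There is a single algorithm (a program for a random access machine with registers and memory cells holding natural numbers, whose unit-cost instructions are loading constants, copying, addition, truncated subtraction, indirect loads and stores, and jumps on comparisons) with the following property. Given an alphabet $\Sigma$, a deterministic regex $\alpha$ over $\Sigma$ with $n$ occurrences of terminals or variable references and with $k$ variables, written as its syntax tree in prefix order, and a word $w\in\Sigma^*$, it decides whether $w\in\mathcal L(\alpha)$ in time $$O\bigl(|\Sigma|\,|\alpha|\,\max(n,1)+\max(k,1)\,|w|\bigr),$$ where $|\alpha|$ is the number of nodes of the syntax tree and the constant in $O$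 does not depend on $\Sigma$, $\alpha$ or $w$. In particular, the time is $O(|\Sigma||\alpha|n+k|w|)$ whenever $n,k\ge 1$. -/

import Mathlib

/-! Regular expressions with back-references over a terminal alphabet `A` and a variable
alphabet `X`, their determinism, and random access machines with a step count. -/

namespace DetRegex

universe u v

/-! ### Syntax -/

/-- Raw expressions; the regex are those satisfying `Expr.IsRegex` below. -/
inductive Expr (A : Type u) (X : Type v) : Type (max u v)
  | empty : Expr A X
  | eps : Expr A X
  | term (a : A) : Expr A X
  | ref (x : X) : Expr A X
  | cat (β γ : Expr A X) : Expr A X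
  | alt (β γ : Expr A X) : Expr A X
  | plus (β : Expr A X) : Expr A X
  | bind (x : X) (β : Expr A X) : Expr A X

namespace Expr

variable {A : Type u} {X : Type v}

/-- The set of variables that are referenced or bound in an expression. -/
def vars [DecidableEq X] : Expr A X → Finset X
  | empty => ∅
  | eps => ∅
  | term _ => ∅
  | ref x => {x}
  | cat β γ => β.vars ∪ γ.vars
  | alt β γ => β.vars ∪ γ.vars
  | plus β => β.vars
  | bind x β => insert x β.vars

/-- No subexpression is `empty`, and `x` does not occur inside a binding of `x`. -/
def WellFormed [DecidableEq X] : Expr A X → Prop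
  | empty => False
  | eps => True
  | term _ => True
  | ref _ => True
  | cat β γ => β.WellFormed ∧ γ.WellFormed
  | alt β γ => β.WellFormed ∧ γ.WellFormed
  | plus β => β.WellFormed
  | bind x β => β.WellFormed ∧ x ∉ β.vars

/-- `empty` is a regex, but it does not occur in any other regex. -/
def IsRegex [DecidableEq X] (α : Expr A X) : Prop :=
  α = empty ∨ α.WellFormed

/-- The size of an expression: the number of nodes of its syntax tree. -/
def size : Expr A X → ℕ
  | empty => 1
  | eps => 1
  | term _ => 1
  | ref _ => 1
  | cat β γ => β.size + γ.size + 1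
  | alt β γ => β.size + γ.size + 1
  | plus β => β.size + 1
  | bind _ β => β.size + 1

/-- The number of occurrences of terminals and variable references. -/
def occurrences : Expr A X → ℕ
  | empty => 0
  | eps => 0
  | term _ => 1
  | ref _ => 1
  | cat β γ => β.occurrences + γ.occurrences
  | alt β γ => β.occurrences + γ.occurrences
  | plus β => β.occurrences
  | bind _ β => β.occurrences

end Expr

/-! ### Ref-words and the language of a regex -/

/-- The letters of ref-words: terminals, variables, and the brackets `[ₓ` and `]ₓ`. -/
inductive RefSym (A : Type u) (X : Type v) : Type (max u v)
  | term (a : A) : RefSym A X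
  | var (x : X) : RefSym A X
  | opening (x : X) : RefSym A X
  | closing (x : X) : RefSym A X

namespace RefSym

variable {A : Type u} {X : Type v}

/-- The symbol is one of the brackets `[ₓ` and `]ₓ`. -/
def IsBracket : RefSym A X → Prop
  | term _ => False
  | var _ => False
  | opening _ => True
  | closing _ => True

end RefSym

/-- The ref-language of an expression. -/
def Expr.refLanguage {A : Type u} {X : Type v} : Expr A X → Language (RefSym A X)
  | .empty => 0
  | .eps => 1
  | .term a => {[RefSym.term a]}
  | .ref x => {[RefSym.var x]}
  | .cat β γ => β.refLanguage * γ.refLanguage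
  | .alt β γ => β.refLanguage + γ.refLanguage
  | .plus β => β.refLanguage * KStar.kstar β.refLanguage
  | .bind x β => {[RefSym.opening x]} * β.refLanguage * {[RefSym.closing x]}

/-- State of the left-to-right evaluation of a ref-word: the terminal word produced so far, for
each variable the length of that word at the most recent `[ₓ`, and for each variable the
terminal word produced by the most recently completed factor `[ₓ v ]ₓ` (`ε` if none). -/
structure DerefState (A : Type u) (X : Type v) where
  out : List A
  start : X → ℕ
  value : X → List A

/-- Evaluation of one symbol of a ref-word. -/
def DerefState.step {A : Type u} {X : Type v} [DecidableEq X]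
    (d : DerefState A X) : RefSym A X → DerefState A X
  | .term a => { d with out := d.out ++ [a] }
  | .var x => { d with out := d.out ++ d.value x }
  | .opening x => { d with start := Function.update d.start x d.out.length }
  | .closing x => { d with value := Function.update d.value x (d.out.drop (d.start x)) }

/-- The dereference of a ref-word: every variable `x` is replaced by (the dereference of) the
contents of the nearest factor `[ₓ v ]ₓ` to its left, or by `ε` if there is none, and all
brackets are removed. -/
def deref {A : Type u} {X : Type v} [DecidableEq X] (r : List (RefSym A X)) : List A :=
  (r.foldl DerefState.step ⟨[], fun _ => 0, fun _ => []⟩).out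

/-- The language of a regex: the dereferences of the words of its ref-language. -/
def Expr.language {A : Type u} {X : Type v} [DecidableEq X] (α : Expr A X) : Language A :=
  {w | ∃ r ∈ α.refLanguage, deref r = w}

/-! ### Marked expressions and determinism -/

/-- Proper regular expressions over an alphabet `B`. -/
inductive ProperExpr (B : Type u) : Type u
  | empty : ProperExpr B
  | eps : ProperExpr B
  | letter (b : B) : ProperExpr B
  | cat (β γ : ProperExpr B) : ProperExpr B
  | alt (β γ : ProperExpr B) : ProperExpr B
  | plus (β : ProperExpr B) : ProperExpr B

namespace ProperExpr

variable {B : Type u}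

/-- The language of a proper regular expression. -/
def language : ProperExpr B → Language B
  | empty => 0
  | eps => 1
  | letter b => {[b]}
  | cat β γ => β.language * γ.language
  | alt β γ => β.language + γ.language
  | plus β => β.language * KStar.kstar β.language

/-- The number of occurrences of letters. -/
def letters : ProperExpr B → ℕ
  | empty => 0
  | eps => 0
  | letter _ => 1
  | cat β γ => β.letters + γ.letters
  | alt β γ => β.letters + γ.letters
  | plus β => β.letters

/-- Mark the occurrences of letters, from left to right, with `i`, `i + 1`, `i + 2`, … -/
def mark (i : ℕ) : ProperExpr B → ProperExpr (B × ℕ)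
  | empty => empty
  | eps => eps
  | letter b => letter (b, i)
  | cat β γ => cat (β.mark i) (γ.mark (i + β.letters))
  | alt β γ => alt (β.mark i) (γ.mark (i + β.letters))
  | plus β => plus (β.mark i)

end ProperExpr

namespace Expr

variable {A : Type u} {X : Type v}

/-- The proper regular expression over terminals, variables and brackets that generates the
ref-language. -/
def toProper : Expr A X → ProperExpr (RefSym A X)
  | empty => .empty
  | eps => .eps
  | term a => .letter (.term a)
  | ref x => .letter (.var x)
  | cat β γ => .cat β.toProper γ.toProper
  | alt β γ => .alt β.toProper γ.toProper
  | plus β => .plus β.toProper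
  | bind x β => .cat (.cat (.letter (.opening x)) β.toProper) (.letter (.closing x))

theorem language_toProper (α : Expr A X) : α.toProper.language = α.refLanguage := by
  induction α <;> simp_all [toProper, ProperExpr.language, refLanguage]

/-- The ref-language of the marked expression: every letter carries the number of its
occurrence. -/
def markedRefLanguage (α : Expr A X) : Language (RefSym A X × ℕ) :=
  (α.toProper.mark 1).language

/-- A word over marked brackets. -/
def IsBracketWord (γ : List (RefSym A X × ℕ)) : Prop :=
  ∀ g ∈ γ, g.1.IsBracket

/-- The four kinds of nondeterminism, witnessed by two marked ref-words. -/
def IsNondeterministic (α : Expr A X) : Prop :=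
  ∃ ρ₁ ∈ α.markedRefLanguage, ∃ ρ₂ ∈ α.markedRefLanguage,
    ∃ r γ₁ γ₂ : List (RefSym A X × ℕ), IsBracketWord γ₁ ∧ IsBracketWord γ₂ ∧
      ((∃ (a : A) (i j : ℕ) (s₁ s₂ : List (RefSym A X × ℕ)), i ≠ j ∧
          ρ₁ = r ++ γ₁ ++ (RefSym.term a, i) :: s₁ ∧
          ρ₂ = r ++ γ₂ ++ (RefSym.term a, j) :: s₂) ∨
       (∃ (x : X) (χ : RefSym A X) (i j : ℕ) (s₁ s₂ : List (RefSym A X × ℕ)),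
          ¬ χ.IsBracket ∧ i ≠ j ∧
          ρ₁ = r ++ γ₁ ++ (RefSym.var x, i) :: s₁ ∧
          ρ₂ = r ++ γ₂ ++ (χ, j) :: s₂) ∨
       (∃ (χ : RefSym A X) (i : ℕ) (s₁ s₂ : List (RefSym A X × ℕ)),
          ¬ χ.IsBracket ∧ γ₁ ≠ γ₂ ∧
          ρ₁ = r ++ γ₁ ++ (χ, i) :: s₁ ∧
          ρ₂ = r ++ γ₂ ++ (χ, i) :: s₂) ∨
       (γ₁ ≠ γ₂ ∧ ρ₁ = r ++ γ₁ ∧ ρ₂ = r ++ γ₂))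

/-- Deterministic regex. -/
def IsDeterministic (α : Expr A X) : Prop :=
  ¬ α.IsNondeterministic

end Expr

/-! ### Random access machines -/

namespace RAM

/-- Instructions. Registers and memory cells hold natural numbers; `d`, `a`, `b` are names of
registers, `l` is the number of an instruction. -/
inductive Instr : Type
  /-- `reg[d] := c` -/
  | const (d c : ℕ) : Instr
  /-- `reg[d] := reg[a]` -/
  | move (d a : ℕ) : Instr
  /-- `reg[d] := reg[a] + reg[b]` -/
  | add (d a b : ℕ) : Instr
  /-- `reg[d] := max (reg[a] - reg[b]) 0` -/
  | sub (d a b : ℕ) : Instr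
  /-- `reg[d] := mem[reg[a]]` -/
  | load (d a : ℕ) : Instr
  /-- `mem[reg[a]] := reg[b]` -/
  | store (a b : ℕ) : Instr
  /-- continue with instruction `l` -/
  | jump (l : ℕ) : Instr
  /-- continue with instruction `l` if `reg[a] < reg[b]` -/
  | jumpLt (a b l : ℕ) : Instr
  /-- continue with instruction `l` if `reg[a] = reg[b]` -/
  | jumpEq (a b l : ℕ) : Instr

/-- A program is a finite list of instructions. -/
abbrev Program : Type := List Instr

/-- A configuration: program counter, registers, memory. -/
structure Config : Type where
  pc : ℕ
  reg : ℕ → ℕ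
  mem : ℕ → ℕ

/-- The effect of one instruction. -/
def Instr.exec (c : Config) : Instr → Config
  | const d n => { c with pc := c.pc + 1, reg := Function.update c.reg d n }
  | move d a => { c with pc := c.pc + 1, reg := Function.update c.reg d (c.reg a) }
  | add d a b => { c with pc := c.pc + 1, reg := Function.update c.reg d (c.reg a + c.reg b) }
  | sub d a b => { c with pc := c.pc + 1, reg := Function.update c.reg d (c.reg a - c.reg b) }
  | load d a => { c with pc := c.pc + 1, reg := Function.update c.reg d (c.mem (c.reg a)) }
  | store a b => { c with pc := c.pc + 1, mem := Function.update c.mem (c.reg a) (c.reg b) }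
  | jump l => { c with pc := l }
  | jumpLt a b l => { c with pc := if c.reg a < c.reg b then l else c.pc + 1 }
  | jumpEq a b l => { c with pc := if c.reg a = c.reg b then l else c.pc + 1 }

/-- A configuration is halted if the program counter points outside the program. -/
def Halted (P : Program) (c : Config) : Prop :=
  P.length ≤ c.pc

/-- One step of computation; halted configurations do not change. -/
def step (P : Program) (c : Config) : Config :=
  match P[c.pc]? with
  | some ins => ins.exec c
  | none => c

/-- The initial configuration: the input occupies the memory cells `0, 1, 2, …`; all other cells
and all registers are `0`. -/
def init (input : List ℕ) : Config where
  pc := 0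
  reg := fun _ => 0
  mem := fun i => input.getD i 0

/-- On the given input, `P` halts after at most `t` steps, with `1` in register `0` if `p` holds
and with `0` in register `0` otherwise. -/
def DecidesWithin (P : Program) (input : List ℕ) (p : Prop) (t : ℕ) : Prop :=
  Halted P ((step P)^[t] (init input)) ∧
    (p → ((step P)^[t] (init input)).reg 0 = 1) ∧
    (¬ p → ((step P)^[t] (init input)).reg 0 = 0)

end RAM

/-! ### Input representation -/

/-- The syntax tree of an expression, in prefix order; every node takes two cells, one for its
kind and one for its terminal or variable (or `0`). -/
def Expr.encode {s : ℕ} : Expr (Fin s) ℕ → List ℕ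
  | .empty => [0, 0]
  | .eps => [1, 0]
  | .term a => [2, a.val]
  | .ref x => [3, x]
  | .cat β γ => [4, 0] ++ β.encode ++ γ.encode
  | .alt β γ => [5, 0] ++ β.encode ++ γ.encode
  | .plus β => [6, 0] ++ β.encode
  | .bind x β => [7, x] ++ β.encode

/-- The input for the membership problem: the size of the alphabet, the size of the expression,
the length of the word, the expression, and the word. -/
def encodeInput {s : ℕ} (α : Expr (Fin s) ℕ) (w : List (Fin s)) : List ℕ :=
  [s, α.size, w.length] ++ α.encode ++ w.map Fin.val

end DetRegex

/-! Number the nodes of the syntax tree in prefix order and place one state in front of node `j`,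
namely `2 * j`, and one behind it, `2 * j + 1`. To each state belongs the language of words that can
still be read from it (`Residual`). For a class of letters, either a single terminal or all
variables, a table assigns to each state an edge towards some letter of the class that can be
reached through brackets alone, and `0` if there is none. State `0` is never the target of an edge,
so the value is free for this purpose.

Suppose that the evaluation is in state `v` and the next letter of the input is `a`. Follow the
table of `a` if it is defined at `v`, else the table of the variables (`nextState`). Determinism
says that after a common prefix an occurrence of `a` excludes every other occurrence of `a` and
every variable, that a variable excludes every other letter, and that the brackets before the letter
are forced. Hence the edge of the table is the only one worth trying, and acceptance from `v` is
equivalent to acceptance from the next state (`IsSystem.accepts_iff`). An end marker, the terminal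
`s` outside the alphabet `{0, …, s - 1}`, is appended to expression and word; then acceptance means
reading the marker. Brackets in front of the marker produce no output, so any route to it serves.

Two obstacles remain. First, variables with empty value produce no output, so the walk may run in a
cycle. A word that is repeated without output has no effect from its third repetition on
(`runWord_three`), so a shortest accepted word cannot contain three rounds of the cycle; a walk of
six times as many steps as there are nodes without output is therefore rejected
(`IsSystem.not_accepts_of_loop`). Second, walking the tree at every input letter would cost a factor
of the size instead of the number `k` of variables. For each terminal and each state in which an
evaluation can resume (the initial state and the states behind letters) the walk is computed in
advance and compressed: a bracket or a variable that is known to have no effect is left out. A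
potential argument leaves at most `5 * k + 2` entries (`length_walkList_le_card`), and the lists
decide acceptance (`IsSystem.entriesAccept_iff`).

The preparation makes, for each of the `s + 1` terminals including the marker, a table in linear
time and one walk of linear length from each of `n + 2` states, where `n` is the number of
occurrences. The evaluation spends a multiple of `k + 1` on each list. A list that is used up
consumes at least one input letter, and comparing the value of a variable with the input costs a
constant per consumed letter (`Decider.runs_evaluate`). The algorithm is written in a small
structured language with arrays, whose compilation to the machine multiplies the cost by a constant
(`Cmd.run`). -/

namespace DetRegex
-- A structured language and its compilation to the random access machine.
namespace RAM

/-! ### A structured language with arrays -/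

/-- Arithmetic expressions over registers and arrays. -/
inductive Exp : Type
  | lit (n : ℕ) : Exp
  | var (r : ℕ) : Exp
  | add (a b : Exp) : Exp
  | sub (a b : Exp) : Exp
  /-- the entry `i` of array `k` -/
  | rd (k : Fin 32) (i : Exp) : Exp
  /-- `t` if `a = b`, else `f` -/
  | ite (a b t f : Exp) : Exp

/-- The store of a structured program: registers and unbounded arrays. -/
structure Store : Type where
  reg : ℕ → ℕ
  arr : Fin 32 → ℕ → ℕ

/-- The value of an expression. -/
def Exp.eval (σ : Store) : Exp → ℕ
  | lit n => n
  | var r => σ.reg r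
  | add a b => a.eval σ + b.eval σ
  | sub a b => a.eval σ - b.eval σ
  | rd k i => σ.arr k (i.eval σ)
  | ite a b t f => if a.eval σ = b.eval σ then t.eval σ else f.eval σ

/-- Assignment to a register. -/
def Store.setReg (σ : Store) (r n : ℕ) : Store :=
  { σ with reg := Function.update σ.reg r n }

/-- Assignment to an array entry. -/
def Store.setArr (σ : Store) (k : Fin 32) (i n : ℕ) : Store :=
  { σ with arr := Function.update σ.arr k (Function.update (σ.arr k) i n) }

/-- Structured programs. -/
inductive Cmd : Type
  | skip : Cmd
  | asg (r : ℕ) (e : Exp) : Cmd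
  | st (k : Fin 32) (i e : Exp) : Cmd
  /-- read a cell of the input -/
  | inp (r : ℕ) (e : Exp) : Cmd
  | seq (c d : Cmd) : Cmd
  /-- `c` if `e` is nonzero, else `d` -/
  | ite (e : Exp) (c d : Cmd) : Cmd
  /-- repeat `c` as long as `e` is nonzero -/
  | loop (e : Exp) (c : Cmd) : Cmd

/-- Big-step semantics with the number of elementary commands, on an input of length `m`. -/
inductive Exec (inp : ℕ → ℕ) (m : ℕ) : Cmd → Store → Store → ℕ → Prop
  | skip (σ) : Exec inp m .skip σ σ 0
  | asg (σ r e) : Exec inp m (.asg r e) σ (σ.setReg r (e.eval σ)) 1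
  | st (σ k i e) : Exec inp m (.st k i e) σ (σ.setArr k (i.eval σ) (e.eval σ)) 1
  | inp (σ r e) (h : e.eval σ < m) : Exec inp m (.inp r e) σ (σ.setReg r (inp (e.eval σ))) 1
  | seq {c d σ₁ σ₂ σ₃ t₁ t₂} : Exec inp m c σ₁ σ₂ t₁ → Exec inp m d σ₂ σ₃ t₂ →
      Exec inp m (.seq c d) σ₁ σ₃ (t₁ + t₂)
  | iteTrue {e c d σ₁ σ₂ t} : e.eval σ₁ ≠ 0 → Exec inp m c σ₁ σ₂ t →
      Exec inp m (.ite e c d) σ₁ σ₂ (t + 1)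
  | iteFalse {e c d σ₁ σ₂ t} : e.eval σ₁ = 0 → Exec inp m d σ₁ σ₂ t →
      Exec inp m (.ite e c d) σ₁ σ₂ (t + 1)
  | loopTrue {e c σ₁ σ₂ σ₃ t₁ t₂} : e.eval σ₁ ≠ 0 → Exec inp m c σ₁ σ₂ t₁ →
      Exec inp m (.loop e c) σ₂ σ₃ t₂ → Exec inp m (.loop e c) σ₁ σ₃ (t₁ + t₂ + 1)
  | loopFalse {e c σ} : e.eval σ = 0 → Exec inp m (.loop e c) σ σ 1

/-! ### Compilation -/

/-- The number of instructions of a compiled expression. -/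
def Exp.len : Exp → ℕ
  | lit _ => 1
  | var _ => 1
  | add a b => a.len + b.len + 1
  | sub a b => a.len + b.len + 1
  | rd _ i => i.len + 9
  | ite a b t f => a.len + b.len + f.len + t.len + 2

/-- Code that turns the index in register `2 * d + 3` into an array address. -/
def addrCode (d : ℕ) : List Instr :=
  [.add (2 * d + 3) (2 * d + 3) (2 * d + 3), .add (2 * d + 3) (2 * d + 3) (2 * d + 3),
   .add (2 * d + 3) (2 * d + 3) (2 * d + 3), .add (2 * d + 3) (2 * d + 3) (2 * d + 3),
   .add (2 * d + 3) (2 * d + 3) (2 * d + 3),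
   .add (2 * d + 3) (2 * d + 3) 1]

/-- Code at address `p` that evaluates an expression into register `2 * d + 3`. The register `r`
of the store is register `2 * r` of the machine; register `1` holds the offset of the arrays. -/
def Exp.code (p d : ℕ) : Exp → List Instr
  | lit n => [.const (2 * d + 3) n]
  | var r => [.move (2 * d + 3) (2 * r)]
  | add a b => a.code p d ++ b.code (p + a.len) (d + 1) ++
      [.add (2 * d + 3) (2 * d + 3) (2 * (d + 1) + 3)]
  | sub a b => a.code p d ++ b.code (p + a.len) (d + 1) ++
      [.sub (2 * d + 3) (2 * d + 3) (2 * (d + 1) + 3)]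
  | rd k i => i.code p d ++ addrCode d ++ [.const (2 * (d + 1) + 3) k.val,
      .add (2 * d + 3) (2 * d + 3) (2 * (d + 1) + 3), .load (2 * d + 3) (2 * d + 3)]
  | ite a b t f => a.code p d ++ b.code (p + a.len) (d + 1) ++
      [.jumpEq (2 * d + 3) (2 * (d + 1) + 3) (p + a.len + b.len + 1 + f.len + 1)] ++
      f.code (p + a.len + b.len + 1) d ++
      [.jump (p + a.len + b.len + 1 + f.len + 1 + t.len)] ++
      t.code (p + a.len + b.len + 1 + f.len + 1) d

theorem Exp.length_code (e : Exp) (p d : ℕ) : (e.code p d).length = e.len := by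
  induction e generalizing p d <;> simp_all [Exp.code, Exp.len, addrCode] <;> omega

/-- The number of instructions of a compiled program. -/
def Cmd.len : Cmd → ℕ
  | skip => 0
  | asg _ e => e.len + 1
  | st _ i e => i.len + e.len + 9
  | inp _ e => e.len + 2
  | seq c d => c.len + d.len
  | ite e c d => e.len + 2 + c.len + 1 + d.len
  | loop e c => e.len + 2 + c.len + 1

/-- The compiled program at address `p`. -/
def Cmd.code (p : ℕ) : Cmd → List Instr
  | skip => []
  | asg r e => e.code p 0 ++ [.move (2 * r) 3]
  | st k i e => i.code p 0 ++ e.code (p + i.len) 1 ++ addrCode 0 ++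
      [.const 7 k.val, .add 3 3 7, .store 3 5]
  | inp r e => e.code p 0 ++ [.load 3 3, .move (2 * r) 3]
  | seq c d => c.code p ++ d.code (p + c.len)
  | ite e c d => e.code p 0 ++ [.const 5 0, .jumpEq 3 5 (p + e.len + 2 + c.len + 1)] ++
      c.code (p + e.len + 2) ++ [.jump (p + e.len + 2 + c.len + 1 + d.len)] ++
      d.code (p + e.len + 2 + c.len + 1)
  | loop e c => e.code p 0 ++ [.const 5 0, .jumpEq 3 5 (p + e.len + 2 + c.len + 1)] ++
      c.code (p + e.len + 2) ++ [.jump p]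

theorem Cmd.length_code (c : Cmd) (p : ℕ) : (c.code p).length = c.len := by
  induction c generalizing p <;> simp_all [Cmd.code, Cmd.len, addrCode, Exp.length_code] <;> omega

/-- The program `P` contains the code `l` at address `p`. -/
def CodeAt (P : Program) (p : ℕ) (l : List Instr) : Prop :=
  ∀ i ins, l[i]? = some ins → P[p + i]? = some ins

theorem codeAt_append {P : Program} {p : ℕ} {l₁ l₂ : List Instr} :
    CodeAt P p (l₁ ++ l₂) ↔ CodeAt P p l₁ ∧ CodeAt P (p + l₁.length) l₂ := by
  constructor
  · intro h
    refine ⟨fun i ins hi => h i ins ?_, fun i ins hi => ?_⟩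
    · rw [List.getElem?_append_left]
      · exact hi
      · exact (List.getElem?_eq_some_iff.1 hi).1
    · rw [add_assoc]
      apply h
      rw [List.getElem?_append_right (by omega)]
      simpa using hi
  · rintro ⟨h₁, h₂⟩ i ins hi
    rcases lt_or_ge i l₁.length with hl | hl
    · rw [List.getElem?_append_left hl] at hi
      exact h₁ i ins hi
    · rw [List.getElem?_append_right hl] at hi
      have := h₂ _ _ hi
      rwa [show p + l₁.length + (i - l₁.length) = p + i by omega] at this

theorem codeAt_cons {P : Program} {p : ℕ} {x : Instr} {l : List Instr} :
    CodeAt P p (x :: l) ↔ P[p]? = some x ∧ CodeAt P (p + 1) l := by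
  rw [show x :: l = [x] ++ l from rfl, codeAt_append]
  refine and_congr_left fun _ => ⟨fun h => h 0 x rfl, fun h i ins hi => ?_⟩
  rcases i with _ | i
  · simp at hi; simpa [hi] using h
  · simp at hi

/-- The machine gets from one configuration to another in `n` steps. -/
def Steps (P : Program) (n : ℕ) (c c' : Config) : Prop :=
  (step P)^[n] c = c'

theorem Steps.trans {P : Program} {n₁ n₂ : ℕ} {c₁ c₂ c₃ : Config} (h₁ : Steps P n₁ c₁ c₂)
    (h₂ : Steps P n₂ c₂ c₃) : Steps P (n₁ + n₂) c₁ c₃ := by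
  unfold Steps at *
  rw [add_comm, Function.iterate_add_apply, h₁, h₂]

theorem Steps.one {P : Program} {c : Config} {ins : Instr} (h : P[c.pc]? = some ins) :
    Steps P 1 c (ins.exec c) := by
  simp [Steps, step, h]

theorem Steps.cons {P : Program} {n : ℕ} {c c' : Config} {ins : Instr} (h : P[c.pc]? = some ins)
    (h' : Steps P n (ins.exec c) c') : Steps P (n + 1) c c' := by
  rw [add_comm]; exact (Steps.one h).trans h'

/-- The machine configuration represents the store. -/
structure Represents (inp : ℕ → ℕ) (m : ℕ) (σ : Store) (c : Config) : Prop where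
  reg : ∀ r, c.reg (2 * r) = σ.reg r
  offset : c.reg 1 = m
  input : ∀ a < m, c.mem a = inp a
  arr : ∀ k i, c.mem (m + 32 * i + k.val) = σ.arr k i

/-- Code for expressions writes only to odd registers from `3` on and never to memory. The even
registers hold the store and register `1` holds the offset of the arrays, so nothing that is
represented gets lost. -/
theorem Represents.congr {inp : ℕ → ℕ} {m : ℕ} {σ : Store} {c c' : Config}
    (h : Represents inp m σ c) (hm : c'.mem = c.mem)
    (hr : ∀ r, r % 2 = 0 ∨ r < 3 → c'.reg r = c.reg r) : Represents inp m σ c' := by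
  refine ⟨fun r => ?_, ?_, ?_, ?_⟩
  · rw [hr _ (by omega), h.reg]
  · rw [hr _ (by omega), h.offset]
  · rw [hm]; exact h.input
  · rw [hm]; exact h.arr

/-- Straight-line effect of `addrCode`. -/
theorem addrCode_run {P : Program} {d m : ℕ} {c : Config}
    (hP : CodeAt P c.pc (addrCode d)) (hm : c.reg 1 = m) :
    ∃ c', Steps P 6 c c' ∧ c'.pc = c.pc + 6 ∧ c'.mem = c.mem ∧
      c'.reg (2 * d + 3) = m + 32 * c.reg (2 * d + 3) ∧
      ∀ r, r ≠ 2 * d + 3 → c'.reg r = c.reg r := by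
  simp only [addrCode, codeAt_cons, add_assoc] at hP
  obtain ⟨h0, h1, h2, h3, h4, h5, -⟩ := hP
  refine ⟨_, Steps.cons h0 (Steps.cons h1 (Steps.cons h2 (Steps.cons h3 (Steps.cons h4
    (Steps.one h5))))), ?_, ?_, ?_, ?_⟩
  · simp [Instr.exec]
  · simp [Instr.exec]
  · simp [Instr.exec, hm]
    omega
  · intro r hr
    simp [Instr.exec, hr]

/-- The odd registers serve as a stack: at depth `d` the result goes to register `2 * d + 3`, and
everything below survives, so that the first operand is still there after the second one has been
evaluated at depth `d + 1`. -/
theorem Exp.run {P : Program} {inp : ℕ → ℕ} {m : ℕ} {σ : Store} (e : Exp) :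
    ∀ (d : ℕ) (c : Config), CodeAt P c.pc (e.code c.pc d) → Represents inp m σ c →
      ∃ n ≤ e.len, ∃ c', Steps P n c c' ∧ c'.pc = c.pc + e.len ∧ c'.mem = c.mem ∧
        c'.reg (2 * d + 3) = e.eval σ ∧
        ∀ r, r % 2 = 0 ∨ r < 2 * d + 3 → c'.reg r = c.reg r := by
  induction e with
  | lit n =>
    intro d c hP hc
    simp only [Exp.code, codeAt_cons] at hP
    refine ⟨1, le_rfl, _, Steps.one hP.1, rfl, rfl, by simp [Instr.exec, Exp.eval], ?_⟩
    intro r hr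
    have : r ≠ 2 * d + 3 := by omega
    simp [Instr.exec, this]
  | var r =>
    intro d c hP hc
    simp only [Exp.code, codeAt_cons] at hP
    refine ⟨1, le_rfl, _, Steps.one hP.1, rfl, rfl, by simp [Instr.exec, Exp.eval, hc.reg], ?_⟩
    intro r hr
    have : r ≠ 2 * d + 3 := by omega
    simp [Instr.exec, this]
  | add a b iha ihb | sub a b iha ihb =>
    intro d c hP hc
    simp only [Exp.code, codeAt_append, codeAt_cons, List.length_append, Exp.length_code] at hP
    obtain ⟨⟨h1, h2⟩, h3, -⟩ := hP
    obtain ⟨n1, hn1, c1, s1, p1, m1, v1, f1⟩ := iha d c h1 hc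
    rw [← p1] at h2
    have hc1 := hc.congr m1 (fun r hr => f1 r (by omega))
    obtain ⟨n2, hn2, c2, s2, p2, m2, v2, f2⟩ := ihb (d + 1) c1 h2 hc1
    rw [← add_assoc, ← p1, ← p2] at h3
    refine ⟨n1 + n2 + 1, by simp [Exp.len]; omega, _, (s1.trans s2).trans (Steps.one h3), ?_, ?_,
      ?_, ?_⟩
    · simp [Instr.exec, p1, p2, Exp.len]; omega
    · simp [Instr.exec, m1, m2]
    · simp [Instr.exec, Exp.eval, v2, f2 (2 * d + 3) (by omega), v1]
    · intro r hr
      have : r ≠ 2 * d + 3 := by omega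
      simp only [Instr.exec, Function.update_of_ne this]
      rw [f2 r (by omega), f1 r hr]
  | rd k i ih =>
    intro d c hP hc
    simp only [Exp.code, codeAt_append, codeAt_cons, List.length_append, Exp.length_code] at hP
    obtain ⟨⟨h1, h2⟩, h3, h4, h5, -⟩ := hP
    obtain ⟨n1, hn1, c1, s1, p1, m1, v1, f1⟩ := ih d c h1 hc
    have hc1 := hc.congr m1 (fun r hr => f1 r (by omega))
    rw [← p1] at h2
    obtain ⟨c2, s2, p2, m2, v2, f2⟩ := addrCode_run h2 hc1.offset
    have e3 : c.pc + (i.len + (addrCode d).length) = c2.pc := by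
      simp [p2, p1, addrCode]; omega
    rw [e3] at h3 h4 h5
    refine ⟨n1 + 6 + 3, by simp [Exp.len]; omega, _,
      (s1.trans s2).trans (Steps.cons h3 (Steps.cons h4 (Steps.one h5))), ?_, ?_, ?_, ?_⟩
    · simp [Instr.exec, p1, p2, Exp.len]; omega
    · simp [Instr.exec, m1, m2]
    · have : 2 * d + 3 ≠ 2 * (d + 1) + 3 := by omega
      simp only [Instr.exec, Function.update_self, Function.update_of_ne this, v2, m2, v1,
        Exp.eval]
      exact hc1.arr _ _
    · intro r hr
      have h1 : r ≠ 2 * d + 3 := by omega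
      have h2 : r ≠ 2 * (d + 1) + 3 := by omega
      simp only [Instr.exec, Function.update_of_ne h1, Function.update_of_ne h2]
      rw [f2 r (by omega), f1 r hr]
  | ite a b t f iha ihb iht ihf =>
    intro d c hP hc
    simp only [Exp.code, codeAt_append, codeAt_cons, List.length_append, Exp.length_code,
      List.length_singleton] at hP
    obtain ⟨⟨⟨⟨⟨h1, h2⟩, h3, -⟩, h4⟩, h5, -⟩, h6⟩ := hP
    obtain ⟨n1, hn1, c1, s1, p1, m1, v1, f1⟩ := iha d c h1 hc
    rw [← p1] at h2
    have hc1 := hc.congr m1 (fun r hr => f1 r (by omega))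
    obtain ⟨n2, hn2, c2, s2, p2, m2, v2, f2⟩ := ihb (d + 1) c1 h2 hc1
    have hc2 := hc1.congr m2 (fun r hr => f2 r (by omega))
    have e2 : c.pc + (a.len + b.len) = c2.pc := by omega
    rw [e2] at h3
    have s3 := (s1.trans s2).trans (Steps.one h3)
    have v1' : c2.reg (2 * d + 3) = a.eval σ := by rw [f2 _ (by omega), v1]
    simp only [Instr.exec, v1', v2] at s3
    by_cases hab : a.eval σ = b.eval σ
    · rw [if_pos hab] at s3
      have hc3 := hc2.congr (c' := { c2 with
        pc := c.pc + a.len + b.len + 1 + f.len + 1 }) rfl (fun _ _ => rfl)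
      obtain ⟨n4, hn4, c4, s4, p4, m4, v4, f4⟩ := iht d _ (by
        convert h6 using 1; simp; omega) hc3
      refine ⟨n1 + n2 + 1 + n4, by simp [Exp.len]; omega, c4, s3.trans s4, ?_, ?_, ?_, ?_⟩
      · simp [p4, Exp.len]; omega
      · simp [m4, m2, m1]
      · simp [v4, Exp.eval, hab]
      · intro r hr
        rw [f4 r hr]; simp only; rw [f2 r (by omega), f1 r hr]
    · rw [if_neg hab] at s3
      have hc3 := hc2.congr (c' := { c2 with pc := c2.pc + 1 }) rfl (fun _ _ => rfl)
      have e3 : c2.pc + 1 = c.pc + a.len + b.len + 1 := by omega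
      obtain ⟨n4, hn4, c4, s4, p4, m4, v4, f4⟩ := ihf d _ (by
        change CodeAt P (c2.pc + 1) (f.code (c2.pc + 1) d)
        rw [e3]; convert h4 using 1; omega) hc3
      have h5' : P[c4.pc]? = some (Instr.jump (c.pc + a.len + b.len + 1 + f.len + 1 + t.len)) := by
        rw [p4]; convert h5 using 2; simp; omega
      refine ⟨n1 + n2 + 1 + n4 + 1, by simp [Exp.len]; omega, _,
        (s3.trans s4).trans (Steps.one h5'), ?_, ?_, ?_, ?_⟩
      · simp [Instr.exec, Exp.len]; omega
      · simp [Instr.exec, m4, m2, m1]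
      · simp [Instr.exec, v4, Exp.eval, hab]
      · intro r hr
        simp only [Instr.exec]
        rw [f4 r hr]; simp only; rw [f2 r (by omega), f1 r hr]

theorem Represents.setReg {inp : ℕ → ℕ} {m : ℕ} {σ : Store} {c c' : Config} {r n : ℕ}
    (h : Represents inp m σ c) (hm : c'.mem = c.mem)
    (hr : c'.reg = Function.update c.reg (2 * r) n) : Represents inp m (σ.setReg r n) c' := by
  refine ⟨fun q => ?_, ?_, ?_, ?_⟩
  · rw [hr, Store.setReg]
    by_cases hq : q = r
    · simp [hq]
    · rw [Function.update_of_ne (by omega), h.reg]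
      simp [hq]
  · rw [hr, Function.update_of_ne (by omega), h.offset]
  · rw [hm]; exact h.input
  · rw [hm]; exact h.arr

/-- Each unit of structured cost pays for `cmd.len` machine steps. This covers the elementary
command or test that is counted, together with the jumps around it, because expression code is free
of loops. -/
theorem Cmd.run {P : Program} {inp : ℕ → ℕ} {m : ℕ} {cmd : Cmd} {σ σ' : Store} {t : ℕ}
    (h : Exec inp m cmd σ σ' t) :
    ∀ c : Config, CodeAt P c.pc (cmd.code c.pc) → Represents inp m σ c →
      ∃ n ≤ cmd.len * t, ∃ c', Steps P n c c' ∧ c'.pc = c.pc + cmd.len ∧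
        Represents inp m σ' c' := by
  induction h with
  | skip σ => exact fun c _ hc => ⟨0, by simp, c, rfl, by simp [Cmd.len], hc⟩
  | asg σ r e =>
    intro c hP hc
    simp only [Cmd.code, codeAt_append, codeAt_cons, Exp.length_code] at hP
    obtain ⟨n, hn, c1, s1, p1, m1, v1, f1⟩ := e.run 0 c hP.1 hc
    have h2 := hP.2.1
    rw [← p1] at h2
    refine ⟨n + 1, by simp [Cmd.len]; omega, _, s1.trans (Steps.one h2), ?_, ?_⟩
    · simp [Instr.exec, Cmd.len]; omega
    · refine (hc.congr m1 (fun r hr => f1 r (by omega))).setReg ?_ ?_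
      · simp [Instr.exec]
      · simp [Instr.exec]
        simpa using congrArg _ v1
  | inp σ r e he =>
    intro c hP hc
    simp only [Cmd.code, codeAt_append, codeAt_cons, Exp.length_code] at hP
    obtain ⟨n, hn, c1, s1, p1, m1, v1, f1⟩ := e.run 0 c hP.1 hc
    obtain ⟨-, h2, h3, -⟩ := hP
    rw [← p1] at h2 h3
    refine ⟨n + 2, by simp [Cmd.len]; omega, _, s1.trans (Steps.cons h2 (Steps.one h3)), ?_, ?_⟩
    · simp [Instr.exec, Cmd.len]; omega
    · have hc1 := hc.congr m1 (fun r hr => f1 r (by omega))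
      have hc2 := hc1.congr (c' := (Instr.load 3 3).exec c1) rfl (by
        intro r hr
        simp only [Instr.exec]
        rw [Function.update_of_ne (by omega)])
      refine hc2.setReg ?_ ?_
      · simp [Instr.exec]
      · simp only [Nat.mul_zero, Nat.zero_add] at v1
        simp only [Instr.exec, Function.update_self, v1, hc1.input _ he]
  | st σ k i e =>
    intro c hP hc
    simp only [Cmd.code, codeAt_append, codeAt_cons, List.length_append, Exp.length_code] at hP
    obtain ⟨⟨⟨h1, h2⟩, h3⟩, h4, h5, h6, -⟩ := hP
    obtain ⟨n1, hn1, c1, s1, p1, m1, v1, f1⟩ := i.run 0 c h1 hc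
    have hc1 := hc.congr m1 (fun r hr => f1 r (by omega))
    rw [← p1] at h2
    obtain ⟨n2, hn2, c2, s2, p2, m2, v2, f2⟩ := e.run 1 c1 h2 hc1
    have hc2 := hc1.congr m2 (fun r hr => f2 r (by omega))
    have e3 : c.pc + (i.len + e.len) = c2.pc := by omega
    rw [e3] at h3
    obtain ⟨c3, s3, p3, m3, v3, f3⟩ := addrCode_run h3 hc2.offset
    have e4 : c.pc + (i.len + e.len + (addrCode 0).length) = c3.pc := by
      simp [p3, p2, p1, addrCode]; omega
    rw [e4] at h4 h5 h6
    have hv2 : c3.reg 5 = e.eval σ := by rw [f3 5 (by omega)]; exact v2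
    have hv1 : c3.reg 3 = m + 32 * i.eval σ := by
      rw [show (3 : ℕ) = 2 * 0 + 3 from rfl, v3, f2 _ (by omega), v1]
    refine ⟨n1 + n2 + 6 + 3, by simp [Cmd.len]; omega, _,
      ((s1.trans s2).trans s3).trans (Steps.cons h4 (Steps.cons h5 (Steps.one h6))), ?_, ?_⟩
    · simp [Instr.exec, Cmd.len, p3, p2, p1]; omega
    · have hc3 := hc2.congr m3 (fun r hr => f3 r (by omega))
      simp only [Instr.exec]
      refine ⟨fun r => ?_, ?_, fun a ha => ?_, fun k' i' => ?_⟩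
      · simp only [Store.setArr]
        rw [Function.update_of_ne (by omega), Function.update_of_ne (by omega), hc3.reg]
      · simpa using hc3.offset
      · simp only [Function.update_self]
        rw [Function.update_of_ne]
        · exact hc3.input a ha
        · simp [hv1]; omega
      · simp only [Function.update_self, ne_eq, Nat.reduceEqDiff, not_false_eq_true,
          Function.update_of_ne, hv1, hv2, Store.setArr]
        -- The addresses `m + 32 * i + k` with `k < 32` determine both `k` and `i`, and they lie
        -- beyond the input.
        have hk := k.2
        have hk' := k'.2
        by_cases hkk : k' = k
        · subst hkk
          by_cases hi : i' = i.eval σ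
          · subst hi; simp
          · rw [Function.update_of_ne (by omega)]
            simp [hi, hc3.arr]
        · have : k'.val ≠ k.val := fun h => hkk (Fin.ext h)
          rw [Function.update_of_ne (by omega), Function.update_of_ne hkk, hc3.arr]
  | @seq c₁ c₂ σ₁ σ₂ σ₃ t₁ t₂ _ _ ih₁ ih₂ =>
    intro c hP hc
    simp only [Cmd.code, codeAt_append, Cmd.length_code] at hP
    obtain ⟨n1, hn1, c1, s1, p1, r1⟩ := ih₁ c hP.1 hc
    obtain ⟨n2, hn2, c2, s2, p2, r2⟩ := ih₂ c1 (by rw [p1]; exact hP.2) r1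
    refine ⟨n1 + n2, ?_, c2, s1.trans s2, by simp [Cmd.len]; omega, r2⟩
    simp only [Cmd.len]
    nlinarith [Nat.zero_le (c₁.len * t₂), Nat.zero_le (c₂.len * t₁)]
  | @iteTrue e c₁ c₂ σ₁ σ₂ t he _ ih =>
    intro c hP hc
    simp only [Cmd.code, codeAt_append, codeAt_cons, List.length_append, Exp.length_code,
      Cmd.length_code, List.length_cons, List.length_nil] at hP
    obtain ⟨⟨⟨⟨h1, h2, h3, -⟩, h4⟩, h5, -⟩, h6⟩ := hP
    obtain ⟨n1, hn1, c1, s1, p1, m1, v1, f1⟩ := e.run 0 c h1 hc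
    have hc1 := hc.congr m1 (fun r hr => f1 r (by omega))
    rw [← p1] at h2 h3
    have s2 := s1.trans (Steps.cons h2 (Steps.one h3))
    simp only [Nat.mul_zero, Nat.zero_add] at v1
    simp only [Instr.exec, Function.update_self, ne_eq, Nat.reduceEqDiff, not_false_eq_true,
      Function.update_of_ne, v1, he, if_false] at s2
    have hc2 := hc1.congr (c' := { c1 with
      pc := c1.pc + 1 + 1, reg := Function.update c1.reg 5 0 }) rfl (by
        intro r hr
        simp only
        rw [Function.update_of_ne (by omega)])
    obtain ⟨n3, hn3, c3, s3, p3, r3⟩ := ih _ (by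
      convert h4 using 1 <;> simp [p1] <;> omega) hc2
    have h5' : P[c3.pc]? = some (Instr.jump (c.pc + e.len + 2 + c₁.len + 1 + c₂.len)) := by
      rw [p3]; convert h5 using 2; simp; omega
    refine ⟨n1 + (1 + 1) + n3 + 1, ?_, _, (s2.trans s3).trans (Steps.one h5'), ?_, ?_⟩
    · simp only [Cmd.len]
      nlinarith [Nat.zero_le ((e.len + c₂.len) * t)]
    · simp [Instr.exec, Cmd.len]; omega
    · exact r3.congr rfl (fun _ _ => rfl)
  | @iteFalse e c₁ c₂ σ₁ σ₂ t he _ ih =>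
    intro c hP hc
    simp only [Cmd.code, codeAt_append, codeAt_cons, List.length_append, Exp.length_code,
      Cmd.length_code, List.length_cons, List.length_nil] at hP
    obtain ⟨⟨⟨⟨h1, h2, h3, -⟩, h4⟩, h5, -⟩, h6⟩ := hP
    obtain ⟨n1, hn1, c1, s1, p1, m1, v1, f1⟩ := e.run 0 c h1 hc
    have hc1 := hc.congr m1 (fun r hr => f1 r (by omega))
    rw [← p1] at h2 h3
    have s2 := s1.trans (Steps.cons h2 (Steps.one h3))
    simp only [Nat.mul_zero, Nat.zero_add] at v1
    simp only [Instr.exec, Function.update_self, ne_eq, Nat.reduceEqDiff, not_false_eq_true,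
      Function.update_of_ne, v1, he, if_true, p1] at s2
    have hc2 := hc1.congr (c' := { c1 with
      pc := c.pc + e.len + 2 + c₁.len + 1, reg := Function.update c1.reg 5 0 }) rfl (by
        intro r hr
        simp only
        rw [Function.update_of_ne (by omega)])
    obtain ⟨n3, hn3, c3, s3, p3, r3⟩ := ih _ (by
      convert h6 using 1; simp; omega) hc2
    refine ⟨n1 + (1 + 1) + n3, ?_, _, s2.trans s3, ?_, r3⟩
    · simp only [Cmd.len]
      nlinarith [Nat.zero_le ((e.len + c₁.len) * t)]
    · simp [p3, Cmd.len]; omega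
  | @loopTrue e c₁ σ₁ σ₂ σ₃ t₁ t₂ he _ _ ih₁ ih₂ =>
    intro c hP hc
    have hP' := hP
    simp only [Cmd.code, codeAt_append, codeAt_cons, List.length_append, Exp.length_code,
      Cmd.length_code, List.length_cons, List.length_nil] at hP
    obtain ⟨⟨⟨h1, h2, h3, -⟩, h4⟩, h5, -⟩ := hP
    obtain ⟨n1, hn1, c1, s1, p1, m1, v1, f1⟩ := e.run 0 c h1 hc
    have hc1 := hc.congr m1 (fun r hr => f1 r (by omega))
    rw [← p1] at h2 h3
    have s2 := s1.trans (Steps.cons h2 (Steps.one h3))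
    simp only [Nat.mul_zero, Nat.zero_add] at v1
    simp only [Instr.exec, Function.update_self, ne_eq, Nat.reduceEqDiff, not_false_eq_true,
      Function.update_of_ne, v1, he, if_false] at s2
    have hc2 := hc1.congr (c' := { c1 with
      pc := c1.pc + 1 + 1, reg := Function.update c1.reg 5 0 }) rfl (by
        intro r hr
        simp only
        rw [Function.update_of_ne (by omega)])
    obtain ⟨n3, hn3, c3, s3, p3, r3⟩ := ih₁ _ (by
      convert h4 using 1 <;> simp [p1] <;> omega) hc2
    have h5' : P[c3.pc]? = some (Instr.jump c.pc) := by
      rw [p3]; convert h5 using 2; simp; omega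
    have r4 : Represents inp m σ₂ ((Instr.jump c.pc).exec c3) := r3.congr rfl (fun _ _ => rfl)
    obtain ⟨n5, hn5, c5, s5, p5, r5⟩ := ih₂ ((Instr.jump c.pc).exec c3) hP' r4
    refine ⟨n1 + (1 + 1) + n3 + 1 + n5, ?_, c5,
      ((s2.trans s3).trans (Steps.one h5')).trans s5, p5, r5⟩
    simp only [Cmd.len] at hn5 ⊢
    nlinarith [Nat.zero_le ((e.len + 3) * t₁)]
  | @loopFalse e c₁ σ he =>
    intro c hP hc
    simp only [Cmd.code, codeAt_append, codeAt_cons, List.length_append, Exp.length_code,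
      Cmd.length_code, List.length_cons, List.length_nil] at hP
    obtain ⟨⟨⟨h1, h2, h3, -⟩, h4⟩, h5, -⟩ := hP
    obtain ⟨n1, hn1, c1, s1, p1, m1, v1, f1⟩ := e.run 0 c h1 hc
    have hc1 := hc.congr m1 (fun r hr => f1 r (by omega))
    rw [← p1] at h2 h3
    have s2 := s1.trans (Steps.cons h2 (Steps.one h3))
    simp only [Nat.mul_zero, Nat.zero_add] at v1
    simp only [Instr.exec, Function.update_self, ne_eq, Nat.reduceEqDiff, not_false_eq_true,
      Function.update_of_ne, v1, he, if_true] at s2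
    refine ⟨n1 + (1 + 1), by simp [Cmd.len]; omega, _, s2, by simp [Cmd.len]; omega, ?_⟩
    refine hc1.congr rfl (fun r hr => ?_)
    simp only
    rw [Function.update_of_ne (by omega)]

end RAM
end DetRegex

/-! ### Determinism in terms of node positions, and renaming of terminals. -/

namespace DetRegex

universe u v w

/-! ### Positions of an expression as marks -/

section Positions

variable {A : Type u} {X : Type v}

/-- The ref-language in which every letter carries its position: the node with number `i` in
prefix order has the position `2 * i` and, if it is a binding, `2 * i + 1` for its closing
bracket. The root gets the number `i`. -/
def Expr.posLanguage : Expr A X → ℕ → Language (RefSym A X × ℕ)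
  | .empty, _ => 0
  | .eps, _ => 1
  | .term a, i => {[(RefSym.term a, 2 * i)]}
  | .ref x, i => {[(RefSym.var x, 2 * i)]}
  | .cat β γ, i => β.posLanguage (i + 1) * γ.posLanguage (i + 1 + β.size)
  | .alt β γ, i => β.posLanguage (i + 1) + γ.posLanguage (i + 1 + β.size)
  | .plus β, i => β.posLanguage (i + 1) * KStar.kstar (β.posLanguage (i + 1))
  | .bind x β, i => {[(RefSym.opening x, 2 * i)]} * β.posLanguage (i + 1) *
      {[(RefSym.closing x, 2 * i + 1)]}

/-- The ref-language in which every letter carries both its position and its mark. -/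
def Expr.jointLanguage : Expr A X → ℕ → ℕ → Language (RefSym A X × ℕ × ℕ)
  | .empty, _, _ => 0
  | .eps, _, _ => 1
  | .term a, i, j => {[(RefSym.term a, 2 * i, j)]}
  | .ref x, i, j => {[(RefSym.var x, 2 * i, j)]}
  | .cat β γ, i, j => β.jointLanguage (i + 1) j *
      γ.jointLanguage (i + 1 + β.size) (j + β.toProper.letters)
  | .alt β γ, i, j => β.jointLanguage (i + 1) j +
      γ.jointLanguage (i + 1 + β.size) (j + β.toProper.letters)
  | .plus β, i, j => β.jointLanguage (i + 1) j * KStar.kstar (β.jointLanguage (i + 1) j)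
  | .bind x β, i, j => {[(RefSym.opening x, 2 * i, j)]} * β.jointLanguage (i + 1) (j + 1) *
      {[(RefSym.closing x, 2 * i + 1, j + (1 + β.toProper.letters))]}

/-- The letters of words of the joint language. -/
def Expr.jointSupport : Expr A X → ℕ → ℕ → Set (RefSym A X × ℕ × ℕ)
  | .empty, _, _ => ∅
  | .eps, _, _ => ∅
  | .term a, i, j => {(RefSym.term a, 2 * i, j)}
  | .ref x, i, j => {(RefSym.var x, 2 * i, j)}
  | .cat β γ, i, j => β.jointSupport (i + 1) j ∪
      γ.jointSupport (i + 1 + β.size) (j + β.toProper.letters)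
  | .alt β γ, i, j => β.jointSupport (i + 1) j ∪
      γ.jointSupport (i + 1 + β.size) (j + β.toProper.letters)
  | .plus β, i, j => β.jointSupport (i + 1) j
  | .bind x β, i, j => insert (RefSym.opening x, 2 * i, j)
      (insert (RefSym.closing x, 2 * i + 1, j + (1 + β.toProper.letters))
        (β.jointSupport (i + 1) (j + 1)))

theorem Language.map_singleton_word {B C : Type*} (f : B → C) (l : List B) :
    Language.map f ({l} : Language B) = {l.map f} :=
  Set.image_singleton

theorem Language.mem_singleton_word {B : Type*} {l l' : List B} :
    l ∈ ({l'} : Language B) ↔ l = l' := Iff.rfl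

/-- Determinism is stated with the marks of letter occurrences, the algorithm works with node
numbers. The joint language carries both numbers, and each of the two languages is a projection of
it. -/
theorem Expr.map_jointLanguage_pos (α : Expr A X) (i j : ℕ) :
    Language.map (fun p => (p.1, p.2.1)) (α.jointLanguage i j) = α.posLanguage i := by
  induction α generalizing i j <;>
    simp_all [jointLanguage, posLanguage, Language.map_singleton_word, Language.map_kstar]

theorem Expr.map_jointLanguage_mark (α : Expr A X) (i j : ℕ) :
    Language.map (fun p => (p.1, p.2.2)) (α.jointLanguage i j) =
      (α.toProper.mark j).language := by
  induction α generalizing i j <;>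
    simp_all [jointLanguage, toProper, ProperExpr.mark, ProperExpr.language,
      Language.map_singleton_word, Language.map_kstar, ProperExpr.letters]

theorem Expr.map_posLanguage_fst (α : Expr A X) (i : ℕ) :
    Language.map Prod.fst (α.posLanguage i) = α.refLanguage := by
  induction α generalizing i <;>
    simp_all [posLanguage, refLanguage, Language.map_singleton_word, Language.map_kstar]

theorem Expr.mem_jointSupport (α : Expr A X) (i j : ℕ) {ρ} (hρ : ρ ∈ α.jointLanguage i j) :
    ∀ p ∈ ρ, p ∈ α.jointSupport i j := by
  induction α generalizing i j ρ with
  | empty => exact absurd hρ (Language.notMem_zero ρ)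
  | eps => rw [jointLanguage, Language.mem_one] at hρ; simp [hρ]
  | term a => rw [jointLanguage, Language.mem_singleton_word] at hρ; simp [hρ, jointSupport]
  | ref x => rw [jointLanguage, Language.mem_singleton_word] at hρ; simp [hρ, jointSupport]
  | cat β γ ihβ ihγ =>
    obtain ⟨a, ha, b, hb, rfl⟩ := Language.mem_mul.1 hρ
    intro p hp
    rcases List.mem_append.1 hp with h | h
    · exact Or.inl (ihβ _ _ ha p h)
    · exact Or.inr (ihγ _ _ hb p h)
  | alt β γ ihβ ihγ =>
    intro p hp
    rcases (Language.mem_add _ _ _).1 hρ with h | h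
    · exact Or.inl (ihβ _ _ h p hp)
    · exact Or.inr (ihγ _ _ h p hp)
  | plus β ih =>
    obtain ⟨a, ha, b, hb, rfl⟩ := Language.mem_mul.1 hρ
    obtain ⟨L, rfl, hL⟩ := Language.mem_kstar.1 hb
    intro p hp
    rcases List.mem_append.1 hp with h | h
    · exact ih _ _ ha p h
    · obtain ⟨y, hy, h⟩ := List.mem_flatten.1 h
      exact ih _ _ (hL y hy) p h
  | bind x β ih =>
    obtain ⟨a, ha, b, hb, rfl⟩ := Language.mem_mul.1 hρ
    obtain ⟨c, hc, d, hd, rfl⟩ := Language.mem_mul.1 ha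
    rw [Language.mem_singleton_word] at hc hb
    subst hc hb
    intro p hp
    simp only [List.mem_append, List.mem_singleton] at hp
    rcases hp with (rfl | h) | rfl
    · exact Or.inl rfl
    · exact Or.inr (Or.inr (ih _ _ hd p h))
    · exact Or.inr (Or.inl rfl)

theorem Expr.jointSupport_bounds (α : Expr A X) (i j : ℕ) {p} (hp : p ∈ α.jointSupport i j) :
    2 * i ≤ p.2.1 ∧ p.2.1 < 2 * (i + α.size) ∧ j ≤ p.2.2 ∧
      p.2.2 < j + α.toProper.letters := by
  induction α generalizing i j with
  | empty => exact hp.elim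
  | eps => exact hp.elim
  | term a => cases hp; simp [size, toProper, ProperExpr.letters]
  | ref x => cases hp; simp [size, toProper, ProperExpr.letters]
  | cat β γ ihβ ihγ | alt β γ ihβ ihγ =>
    simp only [size, toProper, ProperExpr.letters]
    rcases hp with h | h
    · have := ihβ _ _ h; omega
    · have := ihγ _ _ h; omega
  | plus β ih => have := ih _ _ hp; simp only [size, toProper, ProperExpr.letters]; omega
  | bind x β ih =>
    simp only [size, toProper, ProperExpr.letters]
    rcases hp with rfl | rfl | h
    · dsimp only; omega
    · dsimp only; omega
    · have := ih _ _ h; omega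

/-- Siblings occupy disjoint intervals of positions as well as of marks, so each of the two numbers
determines the occurrence, and with it the other number and the symbol. -/
theorem Expr.jointSupport_inj (α : Expr A X) (i j : ℕ) {p q} (hp : p ∈ α.jointSupport i j)
    (hq : q ∈ α.jointSupport i j) : (p.2.1 = q.2.1 → p = q) ∧ (p.2.2 = q.2.2 → p = q) := by
  induction α generalizing i j with
  | empty => exact hp.elim
  | eps => exact hp.elim
  | term a => cases hp; cases hq; simp
  | ref x => cases hp; cases hq; simp
  | cat β γ ihβ ihγ | alt β γ ihβ ihγ =>
    rcases hp with h | h <;> rcases hq with h' | h'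
    · exact ihβ _ _ h h'
    · have h1 := β.jointSupport_bounds _ _ h
      have h2 := γ.jointSupport_bounds _ _ h'
      exact ⟨fun _ => by omega, fun _ => by omega⟩
    · have h1 := γ.jointSupport_bounds _ _ h
      have h2 := β.jointSupport_bounds _ _ h'
      exact ⟨fun _ => by omega, fun _ => by omega⟩
    · exact ihγ _ _ h h'
  | plus β ih => exact ih _ _ hp hq
  | bind x β ih =>
    rcases hp with rfl | rfl | h <;> rcases hq with rfl | rfl | h'
    · simp
    · exact ⟨fun h => by dsimp only at h; omega, fun h => by dsimp only at h; omega⟩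
    · have := β.jointSupport_bounds _ _ h'
      exact ⟨fun h => by dsimp only at h; omega, fun h => by dsimp only at h; omega⟩
    · exact ⟨fun h => by dsimp only at h; omega, fun h => by dsimp only at h; omega⟩
    · simp
    · have := β.jointSupport_bounds _ _ h'
      exact ⟨fun h => by dsimp only at h; omega, fun h => by dsimp only at h; omega⟩
    · have := β.jointSupport_bounds _ _ h
      exact ⟨fun h => by dsimp only at h; omega, fun h => by dsimp only at h; omega⟩
    · have := β.jointSupport_bounds _ _ h
      exact ⟨fun h => by dsimp only at h; omega, fun h => by dsimp only at h; omega⟩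
    · exact ih _ _ h h'

/-- Positions can be renamed to marks, injectively. -/
theorem Expr.exists_mark (α : Expr A X) (i : ℕ) : ∃ μ : ℕ → ℕ,
    (∀ ρ ∈ α.posLanguage i, ρ.map (Prod.map id μ) ∈ α.markedRefLanguage) ∧
    ∀ ρ₁ ∈ α.posLanguage i, ∀ ρ₂ ∈ α.posLanguage i, ∀ p ∈ ρ₁, ∀ q ∈ ρ₂,
      (p.2 = q.2 → p = q) ∧ (μ p.2 = μ q.2 → p = q) := by
  classical
  have hlift : ∀ ρ ∈ α.posLanguage i, ∃ τ ∈ α.jointLanguage i 1,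
      τ.map (fun p => (p.1, p.2.1)) = ρ := by
    intro ρ hρ
    rw [← α.map_jointLanguage_pos i 1] at hρ
    exact hρ
  -- The value `0` at numbers that are not positions of letters is never used.
  let μ : ℕ → ℕ := fun v =>
    if h : ∃ p ∈ α.jointSupport i 1, p.2.1 = v then h.choose.2.2 else 0
  have hμ : ∀ p ∈ α.jointSupport i 1, μ p.2.1 = p.2.2 := by
    intro p hp
    have h : ∃ q ∈ α.jointSupport i 1, q.2.1 = p.2.1 := ⟨p, hp, rfl⟩
    simp only [μ, dif_pos h]
    rw [(α.jointSupport_inj i 1 h.choose_spec.1 hp).1 h.choose_spec.2]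
  refine ⟨μ, fun ρ hρ => ?_, fun ρ₁ h₁ ρ₂ h₂ p hp q hq => ?_⟩
  · obtain ⟨τ, hτ, rfl⟩ := hlift ρ hρ
    rw [markedRefLanguage, ← α.map_jointLanguage_mark i 1]
    refine ⟨τ, hτ, ?_⟩
    rw [List.map_map]
    refine List.map_congr_left fun p hp => ?_
    simp [hμ p (α.mem_jointSupport i 1 hτ p hp)]
  · obtain ⟨τ₁, hτ₁, rfl⟩ := hlift ρ₁ h₁
    obtain ⟨τ₂, hτ₂, rfl⟩ := hlift ρ₂ h₂
    obtain ⟨p, hpτ, rfl⟩ := List.mem_map.1 hp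
    obtain ⟨q, hqτ, rfl⟩ := List.mem_map.1 hq
    have hp' := α.mem_jointSupport i 1 hτ₁ p hpτ
    have hq' := α.mem_jointSupport i 1 hτ₂ q hqτ
    have := α.jointSupport_inj i 1 hp' hq'
    dsimp only
    rw [hμ p hp', hμ q hq']
    exact ⟨fun h => by rw [this.1 h], fun h => by rw [this.2 h]⟩

/-- A language of words with positions in which the next letter after a common prefix is
determined by the terminal to be read. -/
structure IsDetLanguage (L : Language (RefSym A X × ℕ)) : Prop where
  term : ∀ {r γ₁ γ₂ s₁ s₂ a i j}, r ++ γ₁ ++ (RefSym.term a, i) :: s₁ ∈ L →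
    r ++ γ₂ ++ (RefSym.term a, j) :: s₂ ∈ L → Expr.IsBracketWord γ₁ → Expr.IsBracketWord γ₂ →
    i = j
  var : ∀ {r γ₁ γ₂ s₁ s₂ x χ i j}, r ++ γ₁ ++ (RefSym.var x, i) :: s₁ ∈ L →
    r ++ γ₂ ++ (χ, j) :: s₂ ∈ L → Expr.IsBracketWord γ₁ → Expr.IsBracketWord γ₂ →
    ¬ χ.IsBracket → i = j
  symbol : ∀ {r γ₁ γ₂ s₁ s₂ χ₁ χ₂ i}, r ++ γ₁ ++ (χ₁, i) :: s₁ ∈ L →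
    r ++ γ₂ ++ (χ₂, i) :: s₂ ∈ L → χ₁ = χ₂
  brackets : ∀ {r γ₁ γ₂ s₁ s₂ χ i}, r ++ γ₁ ++ (χ, i) :: s₁ ∈ L →
    r ++ γ₂ ++ (χ, i) :: s₂ ∈ L → Expr.IsBracketWord γ₁ → Expr.IsBracketWord γ₂ →
    ¬ χ.IsBracket → γ₁ = γ₂

theorem Expr.IsBracketWord.map_snd {γ : List (RefSym A X × ℕ)} (h : IsBracketWord γ)
    (μ : ℕ → ℕ) : IsBracketWord (γ.map (Prod.map id μ)) := by
  intro g hg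
  obtain ⟨p, hp, rfl⟩ := List.mem_map.1 hg
  exact h p hp

/-- A conflict between positions is carried to a conflict between marks by the renaming of
`Expr.exists_mark`. As it is injective on occurring letters, different positions or bracket words
stay different. The field `symbol` needs no determinism: a position carries one symbol. -/
theorem Expr.IsDeterministic.isDetLanguage {α : Expr A X} (h : α.IsDeterministic) (i : ℕ) :
    IsDetLanguage (α.posLanguage i) := by
  obtain ⟨μ, hμ, hinj⟩ := α.exists_mark i
  refine ⟨?_, ?_, ?_, ?_⟩
  · intro r γ₁ γ₂ s₁ s₂ a i j h₁ h₂ hγ₁ hγ₂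
    by_contra hij
    refine h ⟨_, hμ _ h₁, _, hμ _ h₂, r.map (Prod.map id μ), γ₁.map (Prod.map id μ),
      γ₂.map (Prod.map id μ), hγ₁.map_snd μ, hγ₂.map_snd μ,
      Or.inl ⟨a, μ i, μ j, s₁.map (Prod.map id μ), s₂.map (Prod.map id μ), ?_, ?_, ?_⟩⟩
    · intro hμij
      have := (hinj _ h₁ _ h₂ (RefSym.term a, i) (by simp) (RefSym.term a, j) (by simp)).2 hμij
      simp_all
    · simp
    · simp
  · intro r γ₁ γ₂ s₁ s₂ x χ i j h₁ h₂ hγ₁ hγ₂ hχ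
    by_contra hij
    refine h ⟨_, hμ _ h₁, _, hμ _ h₂, r.map (Prod.map id μ), γ₁.map (Prod.map id μ),
      γ₂.map (Prod.map id μ), hγ₁.map_snd μ, hγ₂.map_snd μ,
      Or.inr (Or.inl ⟨x, χ, μ i, μ j, s₁.map (Prod.map id μ), s₂.map (Prod.map id μ), hχ, ?_, ?_,
        ?_⟩)⟩
    · intro hμij
      have := (hinj _ h₁ _ h₂ (RefSym.var x, i) (by simp) (χ, j) (by simp)).2 hμij
      simp_all
    · simp
    · simp
  · intro r γ₁ γ₂ s₁ s₂ χ₁ χ₂ i h₁ h₂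
    exact congrArg Prod.fst
      ((hinj _ h₁ _ h₂ (χ₁, i) (by simp) (χ₂, i) (by simp)).1 rfl)
  · intro r γ₁ γ₂ s₁ s₂ χ i h₁ h₂ hγ₁ hγ₂ hχ
    by_contra hγ
    refine h ⟨_, hμ _ h₁, _, hμ _ h₂, r.map (Prod.map id μ), γ₁.map (Prod.map id μ),
      γ₂.map (Prod.map id μ), hγ₁.map_snd μ, hγ₂.map_snd μ,
      Or.inr (Or.inr (Or.inl ⟨χ, μ i, s₁.map (Prod.map id μ), s₂.map (Prod.map id μ), hχ, ?_, ?_,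
        ?_⟩))⟩
    · intro hm
      apply hγ
      have hlen : γ₁.length = γ₂.length := by simpa using congrArg List.length hm
      refine List.ext_getElem hlen fun n hn₁ hn₂ => ?_
      have hn : μ γ₁[n].2 = μ γ₂[n].2 := by
        have := List.getElem_of_eq hm (i := n) (by simpa using hn₁)
        simpa using congrArg Prod.snd this
      exact (hinj _ h₁ _ h₂ γ₁[n] (by simp [List.getElem_mem]) γ₂[n]
        (by simp [List.getElem_mem])).2 hn
    · simp
    · simp

/-! ### Renaming of terminals -/

variable {B : Type w}

/-- Renaming of the terminals of a ref-word symbol. -/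
def RefSym.mapTerm (f : A → B) : RefSym A X → RefSym B X
  | term a => term (f a)
  | var x => var x
  | opening x => opening x
  | closing x => closing x

/-- Renaming of the terminals of an expression. -/
def Expr.mapTerm (f : A → B) : Expr A X → Expr B X
  | empty => empty
  | eps => eps
  | term a => term (f a)
  | ref x => ref x
  | cat β γ => cat (β.mapTerm f) (γ.mapTerm f)
  | alt β γ => alt (β.mapTerm f) (γ.mapTerm f)
  | plus β => plus (β.mapTerm f)
  | bind x β => bind x (β.mapTerm f)

theorem Expr.size_mapTerm (f : A → B) (α : Expr A X) : (α.mapTerm f).size = α.size := by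
  induction α <;> simp_all [mapTerm, size]

theorem Expr.occurrences_mapTerm (f : A → B) (α : Expr A X) :
    (α.mapTerm f).occurrences = α.occurrences := by
  induction α <;> simp_all [mapTerm, occurrences]

theorem Expr.vars_mapTerm [DecidableEq X] (f : A → B) (α : Expr A X) :
    (α.mapTerm f).vars = α.vars := by
  induction α <;> simp_all [mapTerm, vars]

theorem Expr.WellFormed.mapTerm [DecidableEq X] (f : A → B) {α : Expr A X} (h : α.WellFormed) :
    (α.mapTerm f).WellFormed := by
  induction α <;> simp_all [Expr.mapTerm, WellFormed, vars_mapTerm]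

theorem Expr.posLanguage_mapTerm (f : A → B) (α : Expr A X) (i : ℕ) :
    (α.mapTerm f).posLanguage i =
      Language.map (Prod.map (RefSym.mapTerm f) id) (α.posLanguage i) := by
  induction α generalizing i <;>
    simp_all [mapTerm, posLanguage, Language.map_singleton_word, Language.map_kstar,
      RefSym.mapTerm, size_mapTerm]

theorem Expr.refLanguage_mapTerm (f : A → B) (α : Expr A X) :
    (α.mapTerm f).refLanguage = Language.map (RefSym.mapTerm f) α.refLanguage := by
  rw [← map_posLanguage_fst _ 0, ← map_posLanguage_fst _ 0, posLanguage_mapTerm,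
    Language.map_map, Language.map_map]
  rfl

theorem RefSym.mapTerm_injective {f : A → B} (hf : Function.Injective f) :
    Function.Injective (RefSym.mapTerm f : RefSym A X → RefSym B X) := by
  rintro (a | x | x | x) (b | y | y | y) h <;> simp_all [mapTerm]
  exact hf h

theorem RefSym.isBracket_mapTerm {f : A → B} {b : RefSym A X} :
    (b.mapTerm f).IsBracket ↔ b.IsBracket := by
  cases b <;> rfl

theorem Expr.IsBracketWord.of_mapTerm {f : A → B} {γ : List (RefSym A X × ℕ)}
    (h : IsBracketWord (γ.map (Prod.map (RefSym.mapTerm f) id))) : IsBracketWord γ :=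
  fun _ hg => RefSym.isBracket_mapTerm.1 (h _ (List.mem_map_of_mem hg))

/-- Injectivity is what lets two renamed words with a common prefix come from words with a common
prefix. The renaming embeds `Fin s` into `ℕ`, where the terminal `s` is free to act as end marker.
-/
theorem IsDetLanguage.mapTerm {f : A → B} (hf : Function.Injective f)
    {L : Language (RefSym A X × ℕ)} (hL : IsDetLanguage L) :
    IsDetLanguage (Language.map (Prod.map (RefSym.mapTerm f) id) L) := by
  have hinj : Function.Injective
      (Prod.map (RefSym.mapTerm f) id : RefSym A X × ℕ → RefSym B X × ℕ) :=
    (RefSym.mapTerm_injective hf).prodMap Function.injective_id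
  have key : ∀ {r γ₁ γ₂ s₁ s₂ p₁ p₂},
      r ++ γ₁ ++ p₁ :: s₁ ∈ Language.map (Prod.map (RefSym.mapTerm f) id) L →
      r ++ γ₂ ++ p₂ :: s₂ ∈ Language.map (Prod.map (RefSym.mapTerm f) id) L →
      ∃ r' γ₁' γ₂' s₁' s₂' p₁' p₂', r' ++ γ₁' ++ p₁' :: s₁' ∈ L ∧ r' ++ γ₂' ++ p₂' :: s₂' ∈ L ∧
        γ₁ = γ₁'.map (Prod.map (RefSym.mapTerm f) id) ∧
        γ₂ = γ₂'.map (Prod.map (RefSym.mapTerm f) id) ∧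
        p₁ = Prod.map (RefSym.mapTerm f) id p₁' ∧ p₂ = Prod.map (RefSym.mapTerm f) id p₂' := by
    rintro r γ₁ γ₂ s₁ s₂ p₁ p₂ ⟨τ₁, hτ₁, h₁⟩ ⟨τ₂, hτ₂, h₂⟩
    obtain ⟨x₁, y₁, rfl, hx₁, hy₁⟩ := List.map_eq_append_iff.1 h₁
    obtain ⟨x₂, y₂, rfl, hx₂, hy₂⟩ := List.map_eq_append_iff.1 h₂
    obtain ⟨r₁, g₁, rfl, hr₁, hg₁⟩ := List.map_eq_append_iff.1 hx₁
    obtain ⟨r₂, g₂, rfl, hr₂, hg₂⟩ := List.map_eq_append_iff.1 hx₂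
    obtain ⟨q₁, t₁, rfl, hq₁, ht₁⟩ := List.map_eq_cons_iff.1 hy₁
    obtain ⟨q₂, t₂, rfl, hq₂, ht₂⟩ := List.map_eq_cons_iff.1 hy₂
    obtain rfl : r₁ = r₂ := hinj.list_map (hr₁.trans hr₂.symm)
    exact ⟨r₁, g₁, g₂, t₁, t₂, q₁, q₂, hτ₁, hτ₂, hg₁.symm, hg₂.symm, hq₁.symm, hq₂.symm⟩
  refine ⟨?_, ?_, ?_, ?_⟩
  · intro r γ₁ γ₂ s₁ s₂ a i j h₁ h₂ hγ₁ hγ₂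
    obtain ⟨r', g₁, g₂, t₁, t₂, ⟨b₁, i'⟩, ⟨b₂, j'⟩, hm₁, hm₂, rfl, rfl, hp₁, hp₂⟩ := key h₁ h₂
    simp only [Prod.map_apply, id_eq, Prod.mk.injEq] at hp₁ hp₂
    obtain ⟨hb₁, rfl⟩ := hp₁
    obtain ⟨hb₂, rfl⟩ := hp₂
    obtain rfl := RefSym.mapTerm_injective hf (hb₁.symm.trans hb₂)
    rcases b₁ with a' | _ | _ | _ <;> simp only [RefSym.mapTerm, reduceCtorEq] at hb₁
    exact hL.term hm₁ hm₂ hγ₁.of_mapTerm hγ₂.of_mapTerm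
  · intro r γ₁ γ₂ s₁ s₂ x χ i j h₁ h₂ hγ₁ hγ₂ hχ
    obtain ⟨r', g₁, g₂, t₁, t₂, ⟨b₁, i'⟩, ⟨b₂, j'⟩, hm₁, hm₂, rfl, rfl, hp₁, hp₂⟩ := key h₁ h₂
    simp only [Prod.map_apply, id_eq, Prod.mk.injEq] at hp₁ hp₂
    obtain ⟨hb₁, rfl⟩ := hp₁
    obtain ⟨rfl, rfl⟩ := hp₂
    rcases b₁ with _ | x' | _ | _ <;> simp only [RefSym.mapTerm, reduceCtorEq] at hb₁
    exact hL.var hm₁ hm₂ hγ₁.of_mapTerm hγ₂.of_mapTerm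
      (fun h => hχ (RefSym.isBracket_mapTerm.2 h))
  · intro r γ₁ γ₂ s₁ s₂ χ₁ χ₂ i h₁ h₂
    obtain ⟨r', g₁, g₂, t₁, t₂, ⟨b₁, i'⟩, ⟨b₂, j'⟩, hm₁, hm₂, rfl, rfl, hp₁, hp₂⟩ := key h₁ h₂
    simp only [Prod.map_apply, id_eq, Prod.mk.injEq] at hp₁ hp₂
    obtain ⟨rfl, rfl⟩ := hp₁
    obtain ⟨rfl, rfl⟩ := hp₂
    rw [hL.symbol hm₁ hm₂]
  · intro r γ₁ γ₂ s₁ s₂ χ i h₁ h₂ hγ₁ hγ₂ hχ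
    obtain ⟨r', g₁, g₂, t₁, t₂, ⟨b₁, i'⟩, ⟨b₂, j'⟩, hm₁, hm₂, rfl, rfl, hp₁, hp₂⟩ := key h₁ h₂
    simp only [Prod.map_apply, id_eq, Prod.mk.injEq] at hp₁ hp₂
    obtain ⟨rfl, rfl⟩ := hp₁
    obtain ⟨hb, rfl⟩ := hp₂
    obtain rfl := RefSym.mapTerm_injective hf hb
    rw [hL.brackets hm₁ hm₂ hγ₁.of_mapTerm hγ₂.of_mapTerm
      (fun h => hχ (RefSym.isBracket_mapTerm.2 h))]

theorem foldl_step_mapTerm [DecidableEq X] (f : A → B) (r : List (RefSym A X))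
    (d : DerefState A X) :
    (r.map (RefSym.mapTerm f)).foldl DerefState.step
        ⟨d.out.map f, d.start, fun x => (d.value x).map f⟩ =
      ⟨(r.foldl DerefState.step d).out.map f, (r.foldl DerefState.step d).start,
        fun x => ((r.foldl DerefState.step d).value x).map f⟩ := by
  induction r generalizing d with
  | nil => rfl
  | cons b r ih =>
    rw [List.map_cons, List.foldl_cons, List.foldl_cons, ← ih]
    congr 1
    cases b with
    | term a => simp [RefSym.mapTerm, DerefState.step]
    | var x => simp [RefSym.mapTerm, DerefState.step]
    | opening x => simp [RefSym.mapTerm, DerefState.step]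
    | closing x =>
      simp only [RefSym.mapTerm, DerefState.step, DerefState.mk.injEq, true_and]
      funext y
      by_cases hy : y = x
      · subst hy; simp
      · simp [hy]

theorem deref_mapTerm [DecidableEq X] (f : A → B) (r : List (RefSym A X)) :
    deref (r.map (RefSym.mapTerm f)) = (deref r).map f := by
  have := foldl_step_mapTerm f r ⟨[], fun _ => 0, fun _ => []⟩
  simp only [List.map_nil] at this
  rw [deref, this, deref]

theorem Expr.mem_language_mapTerm [DecidableEq X] {f : A → B} (hf : Function.Injective f)
    (α : Expr A X) (w : List A) : w.map f ∈ (α.mapTerm f).language ↔ w ∈ α.language := by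
  constructor
  · rintro ⟨r, hr, hw⟩
    rw [refLanguage_mapTerm] at hr
    obtain ⟨r, hr, rfl⟩ := hr
    rw [deref_mapTerm] at hw
    exact ⟨r, hr, hf.list_map hw⟩
  · rintro ⟨r, hr, rfl⟩
    refine ⟨r.map (RefSym.mapTerm f), ?_, deref_mapTerm f r⟩
    rw [refLanguage_mapTerm]
    exact ⟨r, hr, rfl⟩

end Positions

end DetRegex

/-! ### Nodes of the syntax tree and the words that may follow them. -/

namespace DetRegex

universe u v

/-! ### Occurrences of subexpressions and their continuations -/

section Occurrences

variable {A : Type u} {X : Type v}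

/-- `Occ β i k j δ k'`: if `β` is at position `i` and is followed by words of `k`, then `δ` is the
subexpression of `β` at position `j`, and it is followed by words of `k'`. -/
inductive Occ : Expr A X → ℕ → Language (RefSym A X × ℕ) → ℕ → Expr A X →
    Language (RefSym A X × ℕ) → Prop
  | here (β i k) : Occ β i k i β k
  | catL {β γ i k j δ k'} : Occ β (i + 1) (γ.posLanguage (i + 1 + β.size) * k) j δ k' →
      Occ (.cat β γ) i k j δ k'
  | catR {β γ i k j δ k'} : Occ γ (i + 1 + β.size) k j δ k' → Occ (.cat β γ) i k j δ k'
  | altL {β γ i k j δ k'} : Occ β (i + 1) k j δ k' → Occ (.alt β γ) i k j δ k'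
  | altR {β γ i k j δ k'} : Occ γ (i + 1 + β.size) k j δ k' → Occ (.alt β γ) i k j δ k'
  | plus {β i k j δ k'} : Occ β (i + 1) (KStar.kstar (β.posLanguage (i + 1)) * k) j δ k' →
      Occ (.plus β) i k j δ k'
  | bind {x β i k j δ k'} : Occ β (i + 1) ({[(RefSym.closing x, 2 * i + 1)]} * k) j δ k' →
      Occ (.bind x β) i k j δ k'

variable {β δ : Expr A X} {i j : ℕ} {k k' : Language (RefSym A X × ℕ)}

theorem Occ.trans {j' δ' k''} (h : Occ β i k j δ k') (h' : Occ δ j k' j' δ' k'') :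
    Occ β i k j' δ' k'' := by
  induction h with
  | here => exact h'
  | catL _ ih => exact .catL (ih h')
  | catR _ ih => exact .catR (ih h')
  | altL _ ih => exact .altL (ih h')
  | altR _ ih => exact .altR (ih h')
  | plus _ ih => exact .plus (ih h')
  | bind _ ih => exact .bind (ih h')

theorem Expr.size_pos (β : Expr A X) : 0 < β.size := by
  cases β <;> simp [size]

theorem Occ.bounds (h : Occ β i k j δ k') : i ≤ j ∧ j + δ.size ≤ i + β.size := by
  induction h with
  | here => simp
  | catL _ ih | catR _ ih | altL _ ih | altR _ ih | plus _ ih | bind _ ih =>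
    simp only [Expr.size]; omega

/-- The subtrees of siblings occupy disjoint intervals of numbers, so a number leaves only one way
down the tree. -/
theorem Occ.unique {δ' k''} (h : Occ β i k j δ k') (h' : Occ β i k j δ' k'') :
    δ = δ' ∧ k' = k'' := by
  induction h generalizing δ' k'' with
  | here β i k =>
    cases h' with
    | here => simp
    | catL h | catR h | altL h | altR h | plus h | bind h => have := h.bounds; omega
  | @catL β γ i k j δ k' h ih =>
    have hδ := δ.size_pos
    cases h' with
    | here => have := h.bounds; omega
    | catL h' => exact ih h'
    | catR h' => have := h.bounds; have := h'.bounds; omega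
  | @catR β γ i k j δ k' h ih =>
    have hδ := δ'.size_pos
    cases h' with
    | here => have := h.bounds; omega
    | catL h' => have := h.bounds; have := h'.bounds; omega
    | catR h' => exact ih h'
  | @altL β γ i k j δ k' h ih =>
    have hδ := δ.size_pos
    cases h' with
    | here => have := h.bounds; omega
    | altL h' => exact ih h'
    | altR h' => have := h.bounds; have := h'.bounds; omega
  | @altR β γ i k j δ k' h ih =>
    have hδ := δ'.size_pos
    cases h' with
    | here => have := h.bounds; omega
    | altL h' => have := h.bounds; have := h'.bounds; omega
    | altR h' => exact ih h'
  | plus h ih =>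
    cases h' with
    | here => have := h.bounds; omega
    | plus h' => exact ih h'
  | bind h ih =>
    cases h' with
    | here => have := h.bounds; omega
    | bind h' => exact ih h'

theorem Expr.WellFormed.posLanguage_nonempty [DecidableEq X] (h : β.WellFormed) (i : ℕ) :
    ∃ ρ, ρ ∈ β.posLanguage i := by
  induction β generalizing i with
  | empty => exact h.elim
  | eps => exact ⟨[], rfl⟩
  | term a => exact ⟨_, rfl⟩
  | ref x => exact ⟨_, rfl⟩
  | cat β γ ihβ ihγ =>
    obtain ⟨a, ha⟩ := ihβ h.1 (i + 1)
    obtain ⟨b, hb⟩ := ihγ h.2 (i + 1 + β.size)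
    exact ⟨_, Language.append_mem_mul ha hb⟩
  | alt β γ ihβ _ =>
    obtain ⟨a, ha⟩ := ihβ h.1 (i + 1)
    exact ⟨a, Or.inl ha⟩
  | plus β ih =>
    obtain ⟨a, ha⟩ := ih h (i + 1)
    exact ⟨_, Language.append_mem_mul ha (Language.nil_mem_kstar _)⟩
  | bind x β ih =>
    obtain ⟨a, ha⟩ := ih h.1 (i + 1)
    exact ⟨_, Language.append_mem_mul (Language.append_mem_mul rfl ha) rfl⟩

/-- A well-formed expression does not contain `empty`, so from every node reading can be completed.
This turns a partial route into a full word, and determinism speaks about full words only. -/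
theorem Occ.nonempty [DecidableEq X] (h : Occ β i k j δ k') (hβ : β.WellFormed)
    (hk : ∃ ρ, ρ ∈ k) : δ.WellFormed ∧ ∃ ρ, ρ ∈ k' := by
  induction h with
  | here => exact ⟨hβ, hk⟩
  | catL _ ih =>
    obtain ⟨a, ha⟩ := hβ.2.posLanguage_nonempty _
    obtain ⟨b, hb⟩ := hk
    exact ih hβ.1 ⟨_, Language.append_mem_mul ha hb⟩
  | catR _ ih => exact ih hβ.2 hk
  | altL _ ih => exact ih hβ.1 hk
  | altR _ ih => exact ih hβ.2 hk
  | plus _ ih =>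
    obtain ⟨b, hb⟩ := hk
    exact ih hβ ⟨_, Language.append_mem_mul (Language.nil_mem_kstar _) hb⟩
  | bind _ ih =>
    obtain ⟨b, hb⟩ := hk
    exact ih hβ.1 ⟨_, Language.append_mem_mul rfl hb⟩

/-- The subexpression is a single letter with the symbol `b`. -/
def Expr.IsLetter (b : RefSym A X) : Expr A X → Prop
  | term a => b = RefSym.term a
  | ref x => b = RefSym.var x
  | _ => False

/-- After a letter in a word of `β`, the word goes on as the continuation of that letter. -/
theorem Expr.exists_occ_of_mem {b : RefSym A X} {p : ℕ} {r s s' : List (RefSym A X × ℕ)}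
    (hb : ¬ b.IsBracket) (h : r ++ (b, p) :: s ∈ β.posLanguage i) (hs : s' ∈ k) :
    ∃ j δ k', Occ β i k j δ k' ∧ δ.IsLetter b ∧ p = 2 * j ∧ s ++ s' ∈ k' := by
  induction β generalizing i k r s s' with
  | empty => exact absurd h (Language.notMem_zero _)
  | eps => rw [posLanguage, Language.mem_one] at h; simp at h
  | term a =>
    rw [posLanguage, Language.mem_singleton_word, List.append_eq_singleton_iff] at h
    obtain ⟨rfl, h⟩ | ⟨-, h⟩ := h
    · simp only [List.cons.injEq, Prod.mk.injEq] at h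
      obtain ⟨⟨rfl, rfl⟩, rfl⟩ := h
      exact ⟨i, _, k, .here _ _ _, rfl, rfl, hs⟩
    · simp at h
  | ref a =>
    rw [posLanguage, Language.mem_singleton_word, List.append_eq_singleton_iff] at h
    obtain ⟨rfl, h⟩ | ⟨-, h⟩ := h
    · simp only [List.cons.injEq, Prod.mk.injEq] at h
      obtain ⟨⟨rfl, rfl⟩, rfl⟩ := h
      exact ⟨i, _, k, .here _ _ _, rfl, rfl, hs⟩
    · simp at h
  | cat β γ ihβ ihγ =>
    obtain ⟨x, hx, y, hy, hxy⟩ := Language.mem_mul.1 h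
    rcases List.append_eq_append_iff.1 hxy with ⟨t, rfl, ht⟩ | ⟨t, ht, ht'⟩
    · rw [ht] at hy
      obtain ⟨j, δ, k', ho, hδ, hp, hmem⟩ := ihγ hy hs
      exact ⟨j, δ, k', .catR ho, hδ, hp, hmem⟩
    · rcases t with _ | ⟨q, t⟩
      · simp only [List.nil_append] at ht'
        subst ht'
        obtain ⟨j, δ, k', ho, hδ, hp, hmem⟩ := ihγ (r := []) (by simpa using hy) hs
        exact ⟨j, δ, k', .catR ho, hδ, hp, hmem⟩
      · simp only [List.cons_append, List.cons.injEq] at ht'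
        obtain ⟨rfl, rfl⟩ := ht'
        subst ht
        obtain ⟨j, δ, k', ho, hδ, hp, hmem⟩ := ihβ hx (Language.append_mem_mul hy hs)
        exact ⟨j, δ, k', .catL ho, hδ, hp, by simpa using hmem⟩
  | alt β γ ihβ ihγ =>
    rcases h with h | h
    · obtain ⟨j, δ, k', ho, hr⟩ := ihβ h hs
      exact ⟨j, δ, k', .altL ho, hr⟩
    · obtain ⟨j, δ, k', ho, hr⟩ := ihγ h hs
      exact ⟨j, δ, k', .altR ho, hr⟩
  | plus β ih =>
    -- Induction on the list of iterations. The iterations after the one that contains the letter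
    -- form a word of the star, which is the first factor of the continuation of the body.
    have key : ∀ L : List (List (RefSym A X × ℕ)), (∀ y ∈ L, y ∈ β.posLanguage (i + 1)) →
        ∀ r, r ++ (b, p) :: s = L.flatten →
        ∃ j δ k', Occ (.plus β) i k j δ k' ∧ δ.IsLetter b ∧ p = 2 * j ∧ s ++ s' ∈ k' := by
      intro L
      induction L with
      | nil => intro _ r hr; simp at hr
      | cons x L ihL =>
        intro hL r hr
        have hx := hL x (by simp)
        have hL' : ∀ y ∈ L, y ∈ β.posLanguage (i + 1) := fun y hy => hL y (by simp [hy])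
        rw [List.flatten_cons] at hr
        rcases List.append_eq_append_iff.1 hr.symm with ⟨t, rfl, ht⟩ | ⟨t, ht, ht'⟩
        · exact ihL hL' t ht.symm
        · rcases t with _ | ⟨q, t⟩
          · exact ihL hL' [] (by simpa using ht')
          · simp only [List.cons_append, List.cons.injEq] at ht'
            obtain ⟨rfl, rfl⟩ := ht'
            subst ht
            obtain ⟨j, δ, k', ho, hδ, hp, hmem⟩ := ih hx
              (Language.append_mem_mul (Language.join_mem_kstar hL') hs)
            exact ⟨j, δ, k', .plus ho, hδ, hp, by simpa using hmem⟩
    obtain ⟨x, hx, y, hy, hxy⟩ := Language.mem_mul.1 h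
    obtain ⟨L, rfl, hL⟩ := Language.mem_kstar.1 hy
    exact key (x :: L) (by simpa using ⟨hx, hL⟩) r (by simp [hxy])
  | bind x β ih =>
    obtain ⟨u, hu, y, hy, hxy⟩ := Language.mem_mul.1 h
    obtain ⟨o, ho, z, hz, rfl⟩ := Language.mem_mul.1 hu
    rw [Language.mem_singleton_word] at ho hy
    subst ho hy
    rcases r with _ | ⟨q, r⟩
    · simp at hxy
      exact absurd (by rw [← hxy.1.1]; trivial) hb
    · simp only [List.cons_append, List.nil_append, List.cons.injEq] at hxy
      obtain ⟨rfl, hxy⟩ := hxy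
      rcases List.append_eq_append_iff.1 hxy with ⟨t, rfl, ht⟩ | ⟨t, ht, ht'⟩
      · rcases t with _ | ⟨q, t⟩
        · simp at ht
          exact absurd (by rw [← ht.1.1]; trivial) hb
        · simp at ht
      · rcases t with _ | ⟨q, t⟩
        · simp at ht'
          exact absurd (by rw [ht'.1.1]; trivial) hb
        · simp only [List.cons_append, List.cons.injEq] at ht'
          obtain ⟨rfl, rfl⟩ := ht'
          subst ht
          obtain ⟨j, δ, k', ho, hδ, hp, hmem⟩ := ih hz
            (Language.append_mem_mul (l := {[(RefSym.closing x, 2 * i + 1)]}) rfl hs)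
          exact ⟨j, δ, k', .bind ho, hδ, hp, by simpa using hmem⟩

end Occurrences

end DetRegex

/-! ### Nullability, first letters and tables of a class of letters. -/

namespace DetRegex

universe u v

section Tables

variable {A : Type u} {X : Type v}

/-! ### First letters -/

/-- Nonzero iff the ref-language contains a word of brackets. -/
def Expr.nu : Expr A X → ℕ
  | empty => 0
  | eps => 1
  | term _ => 0
  | ref _ => 0
  | cat β γ => if β.nu = 0 then 0 else γ.nu
  | alt β γ => β.nu + γ.nu
  | plus β => β.nu
  | bind _ β => β.nu

/-- Nonzero iff the first letter of some word of the ref-language, disregarding brackets,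
satisfies `Q`. -/
def Expr.first (Q : RefSym A X → Bool) : Expr A X → ℕ
  | empty => 0
  | eps => 0
  | term a => if Q (.term a) then 1 else 0
  | ref x => if Q (.var x) then 1 else 0
  | cat β γ => if β.nu = 0 then β.first Q else β.first Q + γ.first Q
  | alt β γ => β.first Q + γ.first Q
  | plus β => β.first Q
  | bind _ β => β.first Q

/-- The language contains a word of brackets. -/
def HasNull (L : Language (RefSym A X × ℕ)) : Prop :=
  ∃ γ ∈ L, Expr.IsBracketWord γ

/-- The language contains a word whose first letter satisfies `Q`. -/
def HasFirst (Q : RefSym A X → Bool) (L : Language (RefSym A X × ℕ)) : Prop :=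
  ∃ γ b p s, Expr.IsBracketWord γ ∧ ¬ b.IsBracket ∧ Q b ∧ γ ++ (b, p) :: s ∈ L

variable {L M : Language (RefSym A X × ℕ)} {Q : RefSym A X → Bool}

theorem Expr.isBracketWord_append {γ γ' : List (RefSym A X × ℕ)} :
    IsBracketWord (γ ++ γ') ↔ IsBracketWord γ ∧ IsBracketWord γ' := by
  simp only [IsBracketWord, List.mem_append]
  exact ⟨fun h => ⟨fun g hg => h g (Or.inl hg), fun g hg => h g (Or.inr hg)⟩,
    fun h g hg => hg.elim (h.1 g) (h.2 g)⟩

theorem HasNull.of_mul (h : HasNull (L * M)) : HasNull L ∧ HasNull M := by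
  obtain ⟨γ, hγ, hb⟩ := h
  obtain ⟨a, ha, b, hb', rfl⟩ := Language.mem_mul.1 hγ
  rw [Expr.isBracketWord_append] at hb
  exact ⟨⟨a, ha, hb.1⟩, ⟨b, hb', hb.2⟩⟩

theorem HasFirst.of_append {x y : List (RefSym A X × ℕ)} {γ b p s}
    (hγ : Expr.IsBracketWord γ) (hb : ¬ b.IsBracket) (hQ : Q b)
    (h : x ++ y = γ ++ (b, p) :: s) (hx : x ∈ L) (hy : y ∈ M) :
    HasFirst Q L ∨ Expr.IsBracketWord x ∧ HasFirst Q M := by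
  rcases List.append_eq_append_iff.1 h with ⟨t, rfl, ht⟩ | ⟨t, ht, ht'⟩
  · rw [Expr.isBracketWord_append] at hγ
    exact Or.inr ⟨hγ.1, t, b, p, s, hγ.2, hb, hQ, ht ▸ hy⟩
  · rcases t with _ | ⟨q, t⟩
    · refine Or.inr ⟨by simpa [ht] using hγ, [], b, p, s, fun _ h => by simp at h, hb, hQ, ?_⟩
      simpa [ht'] using hy
    · simp only [List.cons_append, List.cons.injEq] at ht'
      obtain ⟨rfl, rfl⟩ := ht'
      exact Or.inl ⟨γ, b, p, t, hγ, hb, hQ, ht ▸ hx⟩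

theorem HasFirst.of_mul (h : HasFirst Q (L * M)) : HasFirst Q L ∨ HasNull L ∧ HasFirst Q M := by
  obtain ⟨γ, b, p, s, hγ, hb, hQ, hmem⟩ := h
  obtain ⟨x, hx, y, hy, hxy⟩ := Language.mem_mul.1 hmem
  exact (HasFirst.of_append hγ hb hQ hxy hx hy).imp_right fun h => ⟨⟨x, hx, h.1⟩, h.2⟩

theorem HasFirst.of_kstar (h : HasFirst Q (KStar.kstar L)) : HasFirst Q L := by
  obtain ⟨γ, b, p, s, hγ, hb, hQ, hmem⟩ := h
  obtain ⟨l, hl, hL⟩ := Language.mem_kstar.1 hmem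
  clear hmem
  induction l generalizing γ b p s with
  | nil => simp at hl
  | cons x l ih =>
    rcases HasFirst.of_append (M := {l.flatten}) hγ hb hQ (by simpa using hl.symm)
      (hL x (by simp)) rfl with h | ⟨-, γ', b', p', s', hγ', hb', hQ', h⟩
    · exact h
    · exact ih γ' b' p' s' hγ' hb' hQ' h fun y hy => hL y (by simp [hy])

/-- For `nu` and `first` only this direction is derived from the language. That nonzero values are
justified follows from `IsTable.reach`, where the table is actually followed to a letter. -/
theorem Expr.nu_ne_zero {β : Expr A X} {i : ℕ} (h : HasNull (β.posLanguage i)) : β.nu ≠ 0 := by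
  induction β generalizing i with
  | empty => obtain ⟨γ, hγ, -⟩ := h; exact absurd hγ (Language.notMem_zero _)
  | eps => simp [nu]
  | term a =>
    obtain ⟨γ, hγ, hb⟩ := h
    rw [posLanguage, Language.mem_singleton_word] at hγ
    exact (hb (.term a, 2 * i) (by simp [hγ])).elim
  | ref x =>
    obtain ⟨γ, hγ, hb⟩ := h
    rw [posLanguage, Language.mem_singleton_word] at hγ
    exact (hb (.var x, 2 * i) (by simp [hγ])).elim
  | cat β γ ihβ ihγ =>
    obtain ⟨h₁, h₂⟩ := HasNull.of_mul h
    simp [nu, ihβ h₁, ihγ h₂]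
  | alt β γ ihβ ihγ =>
    obtain ⟨ρ, h | h, hb⟩ := h
    · have := ihβ ⟨ρ, h, hb⟩; simp only [nu]; omega
    · have := ihγ ⟨ρ, h, hb⟩; simp only [nu]; omega
  | plus β ih => exact ih (HasNull.of_mul h).1
  | bind x β ih => exact ih (HasNull.of_mul (HasNull.of_mul h).1).2

theorem HasFirst.of_mul_singleton {b : RefSym A X} {p : ℕ} (hb : b.IsBracket)
    (h : HasFirst Q ({[(b, p)]} * M)) : HasFirst Q M := by
  rcases HasFirst.of_mul h with ⟨γ, c, q, s, -, hc, -, hm⟩ | h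
  · rw [Language.mem_singleton_word, List.append_eq_singleton_iff] at hm
    rcases hm with ⟨-, h⟩ | ⟨-, h⟩
    · simp only [List.cons.injEq, Prod.mk.injEq] at h
      exact absurd (h.1.1 ▸ hb) hc
    · simp at h
  · exact h.2

theorem Expr.first_ne_zero {β : Expr A X} {i : ℕ} (h : HasFirst Q (β.posLanguage i)) :
    β.first Q ≠ 0 := by
  induction β generalizing i with
  | empty => obtain ⟨γ, b, p, s, -, -, -, h⟩ := h; exact absurd h (Language.notMem_zero _)
  | eps =>
    obtain ⟨γ, b, p, s, -, -, -, h⟩ := h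
    rw [posLanguage, Language.mem_one] at h
    simp at h
  | term a =>
    obtain ⟨γ, b, p, s, -, -, hQ, h⟩ := h
    rw [posLanguage, Language.mem_singleton_word, List.append_eq_singleton_iff] at h
    rcases h with ⟨-, h⟩ | ⟨-, h⟩ <;> simp at h
    simp [first, ← h.1.1, hQ]
  | ref a =>
    obtain ⟨γ, b, p, s, -, -, hQ, h⟩ := h
    rw [posLanguage, Language.mem_singleton_word, List.append_eq_singleton_iff] at h
    rcases h with ⟨-, h⟩ | ⟨-, h⟩ <;> simp at h
    simp [first, ← h.1.1, hQ]
  | cat β γ ihβ ihγ =>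
    rcases HasFirst.of_mul h with h | ⟨hn, h⟩
    · have := ihβ h; simp only [first]; split <;> omega
    · have := ihγ h; simp only [first, nu_ne_zero hn, if_false]; omega
  | alt β γ ihβ ihγ =>
    obtain ⟨ρ, b, p, s, hρ, hb, hQ, h | h⟩ := h
    · have := ihβ ⟨ρ, b, p, s, hρ, hb, hQ, h⟩; simp only [first]; omega
    · have := ihγ ⟨ρ, b, p, s, hρ, hb, hQ, h⟩; simp only [first]; omega
  | plus β ih =>
    rcases HasFirst.of_mul h with h | ⟨-, h⟩
    · exact ih h
    · exact ih h.of_kstar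
  | bind x β ih =>
    rcases HasFirst.of_mul h with h | ⟨-, h⟩
    · exact ih (HasFirst.of_mul_singleton (b := .opening x) trivial h)
    · have : HasFirst Q (({[(RefSym.closing x, 2 * i + 1)]} * 1 : Language _)) := by
        rwa [mul_one]
      obtain ⟨γ, c, q, s, -, -, -, hm⟩ :=
        HasFirst.of_mul_singleton (b := .closing x) trivial this
      rw [Language.mem_one] at hm
      simp at hm

theorem Expr.first_or_nu {β : Expr A X} {i : ℕ} (h : HasFirst Q (β.posLanguage i * M)) :
    β.first Q ≠ 0 ∨ β.nu ≠ 0 ∧ HasFirst Q M :=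
  (HasFirst.of_mul h).imp Expr.first_ne_zero fun h => ⟨Expr.nu_ne_zero h.1, h.2⟩

/-! ### The table of a class of letters -/

/-- Nonzero iff the state `2 * i` in front of `δ` leads to a letter that satisfies `Q`. -/
def enterValue (Q : RefSym A X → Bool) (nx : ℕ → ℕ) (i : ℕ) (δ : Expr A X) : ℕ :=
  δ.first Q + if δ.nu = 0 then 0 else nx (2 * i + 1)

/-- The state behind node `j` if it leads to a suitable letter, else `0`. -/
def exitTarget (nx : ℕ → ℕ) (j : ℕ) : ℕ :=
  if nx (2 * j + 1) = 0 then 0 else 2 * j + 1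

/-- The entries of the table `nx` at a node. For a state that leads to a letter satisfying `Q`
through brackets only, `nx` gives the next state on the way to such a letter; it is `0` for
other states. State `2 * j` lies in front of node `j`, and state `2 * j + 1` behind it. -/
def LocalTable (Q : RefSym A X → Bool) (nx : ℕ → ℕ) (j : ℕ) : Expr A X → Prop
  | .empty => nx (2 * j) = 0
  | .eps => nx (2 * j) = exitTarget nx j
  | .term a => nx (2 * j) = if (Expr.term a : Expr A X).first Q = 0 then 0 else 2 * j + 1
  | .ref x => nx (2 * j) = if (Expr.ref x : Expr A X).first Q = 0 then 0 else 2 * j + 1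
  | .cat β γ =>
    nx (2 * (j + 1 + β.size) + 1) = exitTarget nx j ∧
    nx (2 * (j + 1) + 1) =
      (if enterValue Q nx (j + 1 + β.size) γ = 0 then 0 else 2 * (j + 1 + β.size)) ∧
    nx (2 * j) = if enterValue Q nx (j + 1) β = 0 then 0 else 2 * (j + 1)
  | .alt β γ =>
    nx (2 * (j + 1 + β.size) + 1) = exitTarget nx j ∧
    nx (2 * (j + 1) + 1) = exitTarget nx j ∧
    nx (2 * j) = if β.first Q ≠ 0 then 2 * (j + 1)
      else if γ.first Q ≠ 0 then 2 * (j + 1 + β.size)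
      else if enterValue Q nx (j + 1) β ≠ 0 then 2 * (j + 1)
      else if enterValue Q nx (j + 1 + β.size) γ ≠ 0 then 2 * (j + 1 + β.size) else 0
  | .plus β =>
    nx (2 * (j + 1) + 1) = (if β.first Q ≠ 0 then 2 * (j + 1) else exitTarget nx j) ∧
    nx (2 * j) = if enterValue Q nx (j + 1) β = 0 then 0 else 2 * (j + 1)
  | .bind _ β =>
    nx (2 * (j + 1) + 1) = exitTarget nx j ∧
    nx (2 * j) = if enterValue Q nx (j + 1) β = 0 then 0 else 2 * (j + 1)

/-- The entries of the table at all nodes of an expression. -/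
def IsTable (Q : RefSym A X → Bool) (nx : ℕ → ℕ) (β : Expr A X) (i : ℕ) : Prop :=
  ∀ k j δ k', Occ β i k j δ k' → LocalTable Q nx j δ

variable {β γ δ : Expr A X} {nx : ℕ → ℕ} {i j : ℕ} {k k' : Language (RefSym A X × ℕ)} {x : X}

theorem IsTable.here (h : IsTable Q nx β i) : LocalTable Q nx i β := h 1 _ _ _ (.here _ _ _)

/-- The path to a node does not depend on what follows the whole expression, so facts about tables
and labels may be stated with any continuation. -/
theorem Occ.change (h : Occ β i k j δ k') (k₂ : Language (RefSym A X × ℕ)) :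
    ∃ k₂', Occ β i k₂ j δ k₂' := by
  induction h generalizing k₂ with
  | here => exact ⟨_, .here _ _ _⟩
  | catL _ ih => exact ⟨_, .catL (ih _).choose_spec⟩
  | catR _ ih => exact ⟨_, .catR (ih _).choose_spec⟩
  | altL _ ih => exact ⟨_, .altL (ih _).choose_spec⟩
  | altR _ ih => exact ⟨_, .altR (ih _).choose_spec⟩
  | plus _ ih => exact ⟨_, .plus (ih _).choose_spec⟩
  | bind _ ih => exact ⟨_, .bind (ih _).choose_spec⟩

theorem IsTable.of_occ (h : IsTable Q nx β i) (ho : Occ β i k j δ k') : IsTable Q nx δ j := by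
  intro l j' δ' k'' ho'
  exact h k _ _ _ (ho.trans (ho'.change k').choose_spec)

theorem IsTable.catL (h : IsTable Q nx (.cat β γ) i) : IsTable Q nx β (i + 1) :=
  h.of_occ (k := 1) (.catL (.here _ _ _))

theorem IsTable.catR (h : IsTable Q nx (.cat β γ) i) : IsTable Q nx γ (i + 1 + β.size) :=
  h.of_occ (k := 1) (.catR (.here _ _ _))

theorem IsTable.altL (h : IsTable Q nx (.alt β γ) i) : IsTable Q nx β (i + 1) :=
  h.of_occ (k := 1) (.altL (.here _ _ _))

theorem IsTable.altR (h : IsTable Q nx (.alt β γ) i) : IsTable Q nx γ (i + 1 + β.size) :=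
  h.of_occ (k := 1) (.altR (.here _ _ _))

theorem IsTable.plus (h : IsTable Q nx (.plus β) i) : IsTable Q nx β (i + 1) :=
  h.of_occ (k := 1) (.plus (.here _ _ _))

theorem IsTable.bind (h : IsTable Q nx (.bind x β) i) : IsTable Q nx β (i + 1) :=
  h.of_occ (k := 1) (.bind (.here _ _ _))

theorem exitTarget_ne_zero : exitTarget nx j ≠ 0 ↔ nx (2 * j + 1) ≠ 0 := by
  unfold exitTarget; split <;> simp_all

theorem enterValue_ne_zero :
    enterValue Q nx j δ ≠ 0 ↔ δ.first Q ≠ 0 ∨ δ.nu ≠ 0 ∧ nx (2 * j + 1) ≠ 0 := by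
  unfold enterValue; split <;> simp_all; omega

/-- The order of preference in `LocalTable` decides where an edge leads but not whether there is
one. The entry in front of a node is thus nonzero exactly if the node has a suitable first letter,
or is nullable and the state behind it has an edge. -/
theorem LocalTable.enter_ne_zero (h : LocalTable Q nx j δ) :
    nx (2 * j) ≠ 0 ↔ δ.first Q ≠ 0 ∨ δ.nu ≠ 0 ∧ nx (2 * j + 1) ≠ 0 := by
  cases δ with
  | empty => simp_all [LocalTable, Expr.first, Expr.nu]
  | eps =>
    rw [LocalTable] at h
    rw [h, exitTarget_ne_zero]
    simp [Expr.first, Expr.nu]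
  | term a =>
    rw [LocalTable] at h
    rw [h]
    simp [Expr.nu]
  | ref a =>
    rw [LocalTable] at h
    rw [h]
    simp [Expr.nu]
  | cat β γ =>
    obtain ⟨h₁, h₂, h₃⟩ := h
    have e₁ : nx (2 * j) ≠ 0 ↔ enterValue Q nx (j + 1) β ≠ 0 := by rw [h₃]; simp
    have e₂ : nx (2 * (j + 1) + 1) ≠ 0 ↔ enterValue Q nx (j + 1 + β.size) γ ≠ 0 := by
      rw [h₂]; simp
    rw [e₁, enterValue_ne_zero, e₂, enterValue_ne_zero, h₁, exitTarget_ne_zero]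
    simp only [Expr.first, Expr.nu]
    split <;> simp_all
    tauto
  | alt β γ =>
    obtain ⟨h₁, h₂, h₃⟩ := h
    have e₁ : nx (2 * j) ≠ 0 ↔ enterValue Q nx (j + 1) β ≠ 0 ∨
        enterValue Q nx (j + 1 + β.size) γ ≠ 0 := by
      have c₁ : β.first Q ≠ 0 → enterValue Q nx (j + 1) β ≠ 0 :=
        fun h => enterValue_ne_zero.2 (Or.inl h)
      have c₂ : γ.first Q ≠ 0 → enterValue Q nx (j + 1 + β.size) γ ≠ 0 :=
        fun h => enterValue_ne_zero.2 (Or.inl h)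
      rw [h₃]; split_ifs <;> simp_all
    rw [e₁, enterValue_ne_zero, h₂, enterValue_ne_zero, h₁, exitTarget_ne_zero]
    simp only [Expr.first, Expr.nu, ne_eq, Nat.add_eq_zero_iff]
    tauto
  | plus β =>
    obtain ⟨h₁, h₂⟩ := h
    have e₁ : nx (2 * j) ≠ 0 ↔ enterValue Q nx (j + 1) β ≠ 0 := by rw [h₂]; simp
    have e₂ : nx (2 * (j + 1) + 1) ≠ 0 ↔ β.first Q ≠ 0 ∨ nx (2 * j + 1) ≠ 0 := by
      rw [h₁, ← exitTarget_ne_zero]; split_ifs <;> simp_all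
    rw [e₁, enterValue_ne_zero, e₂]
    simp only [Expr.first, Expr.nu]
    tauto
  | bind x β =>
    obtain ⟨h₁, h₂⟩ := h
    have e₁ : nx (2 * j) ≠ 0 ↔ enterValue Q nx (j + 1) β ≠ 0 := by rw [h₂]; simp
    rw [e₁, enterValue_ne_zero, h₁, exitTarget_ne_zero]
    simp only [Expr.first, Expr.nu]

/-- The table is defined behind every node whose continuation has a suitable first letter. -/
theorem Occ.exit_ne_zero (ho : Occ β i k j δ k') (hT : IsTable Q nx β i)
    (hk : HasFirst Q k → nx (2 * i + 1) ≠ 0) (h : HasFirst Q k') : nx (2 * j + 1) ≠ 0 := by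
  induction ho with
  | here => exact hk h
  | @catL β γ i k j δ k' ho ih =>
    obtain ⟨h₁, h₂, -⟩ := hT.here
    refine ih hT.catL (fun h' => ?_) h
    have : enterValue Q nx (i + 1 + β.size) γ ≠ 0 := by
      rw [enterValue_ne_zero, h₁, exitTarget_ne_zero]
      exact (Expr.first_or_nu h').imp_right fun h' => ⟨h'.1, hk h'.2⟩
    rw [h₂]; simp [this]
  | catR ho ih =>
    exact ih hT.catR (fun h' => by rw [hT.here.1, exitTarget_ne_zero]; exact hk h') h
  | altL ho ih =>
    exact ih hT.altL (fun h' => by rw [hT.here.2.1, exitTarget_ne_zero]; exact hk h') h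
  | altR ho ih =>
    exact ih hT.altR (fun h' => by rw [hT.here.1, exitTarget_ne_zero]; exact hk h') h
  | @plus β i k j δ k' ho ih =>
    refine ih hT.plus (fun h' => ?_) h
    rw [hT.here.1]
    rcases HasFirst.of_mul h' with h' | ⟨-, h'⟩
    · simp [Expr.first_ne_zero h'.of_kstar]
    · have := exitTarget_ne_zero.2 (hk h')
      split_ifs <;> simp_all
  | @bind x β i k j δ k' ho ih =>
    refine ih hT.bind (fun h' => ?_) h
    rw [hT.here.1, exitTarget_ne_zero]
    exact hk (HasFirst.of_mul_singleton (b := .closing x) trivial h')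

/-! ### Labels of states -/

/-- The labels of the two states of a node: the letters that are read when leaving them. -/
def LocalLabel (lab : ℕ → Option (RefSym A X)) (j : ℕ) : Expr A X → Prop
  | .term a => lab (2 * j) = some (.term a) ∧ lab (2 * j + 1) = none
  | .ref x => lab (2 * j) = some (.var x) ∧ lab (2 * j + 1) = none
  | .bind x _ => lab (2 * j) = some (.opening x) ∧ lab (2 * j + 1) = some (.closing x)
  | _ => lab (2 * j) = none ∧ lab (2 * j + 1) = none

/-- The labels of the states of all nodes of an expression. -/
def IsLabelling (lab : ℕ → Option (RefSym A X)) (β : Expr A X) (i : ℕ) : Prop :=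
  ∀ k j δ k', Occ β i k j δ k' → LocalLabel lab j δ

/-- The state is not labelled with a terminal or a variable. -/
def IsSilent (lab : ℕ → Option (RefSym A X)) (v : ℕ) : Prop :=
  ∀ b, lab v = some b → b.IsBracket

variable {lab : ℕ → Option (RefSym A X)}

theorem IsLabelling.here (h : IsLabelling lab β i) : LocalLabel lab i β :=
  h 1 _ _ _ (.here _ _ _)

theorem LocalLabel.silent_exit (h : LocalLabel lab j δ) : IsSilent lab (2 * j + 1) := by
  intro b hb
  cases δ <;> simp_all [LocalLabel, RefSym.IsBracket]

/-- Following the table from a state leads to a letter that satisfies `Q`. -/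
inductive Reach (Q : RefSym A X → Bool) (nx : ℕ → ℕ) (lab : ℕ → Option (RefSym A X)) :
    ℕ → Prop
  | letter {v b} : lab v = some b → ¬ b.IsBracket → Q b → nx v = v + 1 → Reach Q nx lab v
  | step {v} : IsSilent lab v → nx v ≠ 0 → Reach Q nx lab (nx v) → Reach Q nx lab v

theorem Reach.ne_zero {v : ℕ} (h : Reach Q nx lab v) : nx v ≠ 0 := by
  cases h with
  | letter _ _ _ h => omega
  | step _ h _ => exact h

end Tables
end DetRegex

/-! ### Routes of a table and residual languages of states. -/

namespace DetRegex

universe u v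

section Residuals

variable {A : Type u} {X : Type v} {Q : RefSym A X → Bool} {nx : ℕ → ℕ}
  {lab : ℕ → Option (RefSym A X)} {β γ δ : Expr A X} {i j : ℕ}
  {k k' L : Language (RefSym A X × ℕ)} {x : X}

theorem IsLabelling.of_occ (h : IsLabelling lab β i) (ho : ∃ k k', Occ β i k j δ k') :
    IsLabelling lab δ j := by
  intro l j' δ' k'' ho'
  obtain ⟨k, k', ho⟩ := ho
  exact h k _ _ _ (ho.trans (ho'.change k').choose_spec)

theorem LocalLabel.silent_enter (h : LocalLabel lab j δ) (h₁ : ∀ a, δ ≠ .term a)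
    (h₂ : ∀ x, δ ≠ .ref x) : IsSilent lab (2 * j) := by
  intro b hb
  cases δ <;> simp_all [LocalLabel, RefSym.IsBracket]

theorem Reach.step' {v u : ℕ} (hs : IsSilent lab v) (h : nx v = u) (hu : u ≠ 0)
    (hr : Reach Q nx lab u) : Reach Q nx lab v :=
  .step hs (h ▸ hu) (h ▸ hr)

/-- The first part never passes through the state behind the node itself; this is what makes loops
harmless. It relies on the preference in `LocalTable` for a branch that has a suitable first letter
over a nullable branch: in `(ε | a)⁺` the opposite choice would run through `ε` back to the start of
the loop for ever. -/
theorem IsTable.reach (hT : IsTable Q nx β i) (hl : IsLabelling lab β i) :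
    (β.first Q ≠ 0 → Reach Q nx lab (2 * i)) ∧
      (β.nu ≠ 0 → Reach Q nx lab (2 * i + 1) → Reach Q nx lab (2 * i)) := by
  induction β generalizing i with
  | empty => simp [Expr.first, Expr.nu]
  | eps =>
    have h : nx (2 * i) = exitTarget nx i := hT.here
    refine ⟨by simp [Expr.first], fun _ hr => .step' (hl.here.silent_enter (by simp) (by simp))
      (u := 2 * i + 1) ?_ (by omega) hr⟩
    simp [h, exitTarget, hr.ne_zero]
  | term a =>
    have h : nx (2 * i) = _ := hT.here
    refine ⟨fun hf => ?_, by simp [Expr.nu]⟩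
    rw [if_neg hf] at h
    refine .letter (b := .term a) hl.here.1 id ?_ h
    simp only [Expr.first] at hf
    by_contra hQ
    simp [hQ] at hf
  | ref a =>
    have h : nx (2 * i) = _ := hT.here
    refine ⟨fun hf => ?_, by simp [Expr.nu]⟩
    rw [if_neg hf] at h
    refine .letter (b := .var a) hl.here.1 id ?_ h
    simp only [Expr.first] at hf
    by_contra hQ
    simp [hQ] at hf
  | cat β γ ihβ ihγ =>
    have hlβ : IsLabelling lab β (i + 1) := hl.of_occ ⟨1, _, .catL (.here _ _ _)⟩
    have hlγ : IsLabelling lab γ (i + 1 + β.size) := hl.of_occ ⟨1, _, .catR (.here _ _ _)⟩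
    have hβ := ihβ hT.catL hlβ
    have hγ := ihγ hT.catR hlγ
    obtain ⟨h₁, h₂, h₃⟩ := hT.here
    have hs := hl.here.silent_enter (by simp) (by simp)
    have enter : Reach Q nx lab (2 * (i + 1)) → enterValue Q nx (i + 1) β ≠ 0 →
        Reach Q nx lab (2 * i) := fun hr hv =>
      .step' hs (by rw [h₃, if_neg hv]) (by omega) hr
    have middle : Reach Q nx lab (2 * (i + 1 + β.size)) → β.nu ≠ 0 →
        enterValue Q nx (i + 1 + β.size) γ ≠ 0 → Reach Q nx lab (2 * i) := by
      intro hr hn hv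
      have hm : Reach Q nx lab (2 * (i + 1) + 1) :=
        .step' hlβ.here.silent_exit (by rw [h₂, if_neg hv]) (by omega) hr
      exact enter (hβ.2 hn hm) (enterValue_ne_zero.2 (Or.inr ⟨hn, hm.ne_zero⟩))
    constructor
    · intro hf
      simp only [Expr.first] at hf
      by_cases hfβ : β.first Q = 0
      · split_ifs at hf with hn
        · exact absurd hfβ hf
        · have hfγ : γ.first Q ≠ 0 := by omega
          exact middle (hγ.1 hfγ) hn (enterValue_ne_zero.2 (Or.inl hfγ))
      · exact enter (hβ.1 hfβ) (enterValue_ne_zero.2 (Or.inl hfβ))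
    · intro hn hr
      simp only [Expr.nu] at hn
      split_ifs at hn with hnβ
      · exact absurd rfl hn
      have he : nx (2 * (i + 1 + β.size) + 1) = 2 * i + 1 := by
        rw [h₁, exitTarget, if_neg hr.ne_zero]
      have hr' : Reach Q nx lab (2 * (i + 1 + β.size) + 1) :=
        .step' hlγ.here.silent_exit he (by omega) hr
      exact middle (hγ.2 hn hr') hnβ (enterValue_ne_zero.2 (Or.inr ⟨hn, hr'.ne_zero⟩))
  | alt β γ ihβ ihγ =>
    have hlβ : IsLabelling lab β (i + 1) := hl.of_occ ⟨1, _, .altL (.here _ _ _)⟩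
    have hlγ : IsLabelling lab γ (i + 1 + β.size) := hl.of_occ ⟨1, _, .altR (.here _ _ _)⟩
    have hβ := ihβ hT.altL hlβ
    have hγ := ihγ hT.altR hlγ
    obtain ⟨h₁, h₂, h₃⟩ := hT.here
    have hs := hl.here.silent_enter (by simp) (by simp)
    have first : β.first Q ≠ 0 ∨ γ.first Q ≠ 0 → Reach Q nx lab (2 * i) := by
      intro h
      by_cases hfβ : β.first Q ≠ 0
      · exact .step' hs (by rw [h₃, if_pos hfβ]) (by omega) (hβ.1 hfβ)
      · have hfγ := h.resolve_left hfβ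
        exact .step' hs (by rw [h₃, if_neg hfβ, if_pos hfγ]) (by omega) (hγ.1 hfγ)
    constructor
    · intro hf
      simp only [Expr.first] at hf
      exact first (by omega)
    · intro hn hr
      by_cases hf : β.first Q ≠ 0 ∨ γ.first Q ≠ 0
      · exact first hf
      · rw [not_or] at hf
        have heβ : nx (2 * (i + 1) + 1) = 2 * i + 1 := by
          rw [h₂, exitTarget, if_neg hr.ne_zero]
        have heγ : nx (2 * (i + 1 + β.size) + 1) = 2 * i + 1 := by
          rw [h₁, exitTarget, if_neg hr.ne_zero]
        rw [if_neg hf.1, if_neg hf.2] at h₃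
        by_cases hv : enterValue Q nx (i + 1) β ≠ 0
        · rw [if_pos hv] at h₃
          have hnβ := (enterValue_ne_zero.1 hv).resolve_left hf.1
          exact .step' hs h₃ (by omega)
            (hβ.2 hnβ.1 (.step' hlβ.here.silent_exit heβ (by omega) hr))
        · rw [if_neg hv] at h₃
          have hnβ : β.nu = 0 := by
            by_contra hnβ
            exact hv (enterValue_ne_zero.2 (Or.inr ⟨hnβ, by omega⟩))
          have hnγ : γ.nu ≠ 0 := by
            simp only [Expr.nu] at hn
            omega
          have hvγ : enterValue Q nx (i + 1 + β.size) γ ≠ 0 :=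
            enterValue_ne_zero.2 (Or.inr ⟨hnγ, by omega⟩)
          rw [if_pos hvγ] at h₃
          exact .step' hs h₃ (by omega)
            (hγ.2 hnγ (.step' hlγ.here.silent_exit heγ (by omega) hr))
  | plus β ih =>
    have hlβ : IsLabelling lab β (i + 1) := hl.of_occ ⟨1, _, .plus (.here _ _ _)⟩
    have hβ := ih hT.plus hlβ
    obtain ⟨h₁, h₂⟩ := hT.here
    have hs := hl.here.silent_enter (by simp) (by simp)
    have first : β.first Q ≠ 0 → Reach Q nx lab (2 * i) := fun hf =>
      .step' hs (by rw [h₂, if_neg (enterValue_ne_zero.2 (Or.inl hf))]) (by omega) (hβ.1 hf)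
    refine ⟨first, fun hn hr => ?_⟩
    by_cases hf : β.first Q ≠ 0
    · exact first hf
    · rw [if_neg hf, exitTarget, if_neg hr.ne_zero] at h₁
      have hv : enterValue Q nx (i + 1) β ≠ 0 :=
        enterValue_ne_zero.2 (Or.inr ⟨hn, by omega⟩)
      exact .step' hs (by rw [h₂, if_neg hv]) (by omega)
        (hβ.2 hn (.step' hlβ.here.silent_exit h₁ (by omega) hr))
  | bind x β ih =>
    have hlβ : IsLabelling lab β (i + 1) := hl.of_occ ⟨1, _, .bind (.here _ _ _)⟩
    have hβ := ih hT.bind hlβ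
    obtain ⟨h₁, h₂⟩ := hT.here
    have hs := hl.here.silent_enter (by simp) (by simp)
    refine ⟨fun hf => .step' hs
      (by rw [h₂, if_neg (enterValue_ne_zero.2 (Or.inl (show β.first Q ≠ 0 from hf)))])
      (by omega) (hβ.1 hf), fun hn hr => ?_⟩
    rw [exitTarget, if_neg hr.ne_zero] at h₁
    have hv : enterValue Q nx (i + 1) β ≠ 0 :=
      enterValue_ne_zero.2 (Or.inr ⟨hn, by omega⟩)
    exact .step' hs (by rw [h₂, if_neg hv]) (by omega)
      (hβ.2 hn (.step' hlβ.here.silent_exit h₁ (by omega) hr))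

/-- Descend from the root, carrying along that the state behind the current node leads to a letter
if its entry is nonzero. In a loop the edge may go back to the front of the body, but only if the
body has a suitable first letter, and then the first part of `IsTable.reach` ends the route there.
-/
theorem Occ.reach_exit (ho : Occ β i k j δ k') (hT : IsTable Q nx β i)
    (hl : IsLabelling lab β i) (hi : nx (2 * i + 1) ≠ 0 → Reach Q nx lab (2 * i + 1))
    (h : nx (2 * j + 1) ≠ 0) : Reach Q nx lab (2 * j + 1) := by
  have key : ∀ {i j : ℕ}, (nx (2 * i + 1) ≠ 0 → Reach Q nx lab (2 * i + 1)) →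
      nx (2 * j + 1) = exitTarget nx i → IsSilent lab (2 * j + 1) → nx (2 * j + 1) ≠ 0 →
      Reach Q nx lab (2 * j + 1) := by
    intro i j hi h hs h'
    rw [h, exitTarget_ne_zero] at h'
    rw [exitTarget, if_neg h'] at h
    exact .step' hs h (by omega) (hi h')
  induction ho with
  | here => exact hi h
  | @catL β γ i k j δ k' ho ih =>
    have hlβ : IsLabelling lab β (i + 1) := hl.of_occ ⟨1, _, .catL (.here _ _ _)⟩
    have hlγ : IsLabelling lab γ (i + 1 + β.size) := hl.of_occ ⟨1, _, .catR (.here _ _ _)⟩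
    obtain ⟨h₁, h₂, -⟩ := hT.here
    refine ih hT.catL hlβ (fun h' => ?_) h
    have hv : enterValue Q nx (i + 1 + β.size) γ ≠ 0 := by
      intro hv; rw [h₂, if_pos hv] at h'; exact h' rfl
    rw [if_neg hv] at h₂
    refine .step' hlβ.here.silent_exit h₂ (by omega) ?_
    rcases enterValue_ne_zero.1 hv with hv | ⟨hn, hv⟩
    · exact (hT.catR.reach hlγ).1 hv
    · exact (hT.catR.reach hlγ).2 hn (key hi h₁ hlγ.here.silent_exit hv)
  | catR ho ih =>
    have hl' := hl.of_occ ⟨1, _, .catR (.here _ _ _)⟩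
    exact ih hT.catR hl' (key hi hT.here.1 hl'.here.silent_exit) h
  | altL ho ih =>
    have hl' := hl.of_occ ⟨1, _, .altL (.here _ _ _)⟩
    exact ih hT.altL hl' (key hi hT.here.2.1 hl'.here.silent_exit) h
  | altR ho ih =>
    have hl' := hl.of_occ ⟨1, _, .altR (.here _ _ _)⟩
    exact ih hT.altR hl' (key hi hT.here.1 hl'.here.silent_exit) h
  | @plus β i k j δ k' ho ih =>
    have hl' := hl.of_occ ⟨1, _, .plus (.here _ _ _)⟩
    refine ih hT.plus hl' ?_ h
    have h₁ := hT.here.1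
    by_cases hf : β.first Q ≠ 0
    · rw [if_pos hf] at h₁
      exact fun _ => .step' hl'.here.silent_exit h₁ (by omega) ((hT.plus.reach hl').1 hf)
    · rw [if_neg hf] at h₁
      exact key hi h₁ hl'.here.silent_exit
  | bind ho ih =>
    have hl' := hl.of_occ ⟨1, _, .bind (.here _ _ _)⟩
    exact ih hT.bind hl' (key hi hT.here.1 hl'.here.silent_exit) h

/-! ### Residual languages of states -/

/-- The words that remain to be read in the state behind node `j`. -/
def exitLanguage (j : ℕ) (k' : Language (RefSym A X × ℕ)) :
    Expr A X → Language (RefSym A X × ℕ)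
  | .bind x _ => {[(RefSym.closing x, 2 * j + 1)]} * k'
  | _ => k'

/-- `L` consists of the words that remain to be read in state `v` of the expression `β`. -/
def Residual (β : Expr A X) (v : ℕ) (L : Language (RefSym A X × ℕ)) : Prop :=
  ∃ j δ k', Occ β 0 1 j δ k' ∧
    (v = 2 * j ∧ L = δ.posLanguage j * k' ∨ v = 2 * j + 1 ∧ L = exitLanguage j k' δ)

theorem Residual.unique {v L'} (h : Residual β v L) (h' : Residual β v L') : L = L' := by
  obtain ⟨j, δ, k, ho, h⟩ := h
  obtain ⟨j', δ', k', ho', h'⟩ := h'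
  obtain rfl : j = j' := by omega
  obtain ⟨rfl, rfl⟩ := ho.unique ho'
  rcases h with ⟨hv, rfl⟩ | ⟨hv, rfl⟩ <;> rcases h' with ⟨hv', rfl⟩ | ⟨hv', rfl⟩ <;>
    first | rfl | omega

theorem Residual.lt {v} (h : Residual β v L) : v < 2 * β.size := by
  obtain ⟨j, δ, k, ho, h⟩ := h
  have := ho.bounds
  have := δ.size_pos
  omega

theorem Residual.nonempty [DecidableEq X] {v} (h : Residual β v L) (hβ : β.WellFormed) :
    ∃ ρ, ρ ∈ L := by
  obtain ⟨j, δ, k, ho, h⟩ := h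
  obtain ⟨hδ, a, ha⟩ := ho.nonempty hβ ⟨[], rfl⟩
  rcases h with ⟨-, rfl⟩ | ⟨-, rfl⟩
  · obtain ⟨b, hb⟩ := hδ.posLanguage_nonempty j
    exact ⟨_, Language.append_mem_mul hb ha⟩
  · cases δ with
    | bind x δ => exact ⟨_, Language.append_mem_mul rfl ha⟩
    | _ => exact ⟨_, ha⟩

theorem Residual.enter (ho : Occ β 0 1 j δ k') : Residual β (2 * j) (δ.posLanguage j * k') :=
  ⟨j, δ, k', ho, Or.inl ⟨rfl, rfl⟩⟩

theorem Residual.exit (ho : Occ β 0 1 j δ k') : Residual β (2 * j + 1) (exitLanguage j k' δ) :=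
  ⟨j, δ, k', ho, Or.inr ⟨rfl, rfl⟩⟩

/-- Completeness of the table: where a suitable letter can be read next, there is an edge. No letter
follows the whole expression, so the condition on the state behind the root is void. -/
theorem Residual.ne_zero {v} (h : Residual β v L) (hT : IsTable Q nx β 0) (hQ : HasFirst Q L)
    : nx v ≠ 0 := by
  obtain ⟨j, δ, k, ho, h⟩ := h
  have h1 : HasFirst Q (1 : Language (RefSym A X × ℕ)) → nx (2 * 0 + 1) ≠ 0 := by
    rintro ⟨γ, b, p, s, -, -, -, h⟩
    rw [Language.mem_one] at h
    simp at h
  rcases h with ⟨rfl, rfl⟩ | ⟨rfl, rfl⟩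
  · rw [LocalTable.enter_ne_zero (hT _ _ _ _ ho)]
    exact (Expr.first_or_nu hQ).imp_right fun h => ⟨h.1, ho.exit_ne_zero hT h1 h.2⟩
  · refine ho.exit_ne_zero hT h1 ?_
    cases δ with
    | bind x δ => exact HasFirst.of_mul_singleton (b := .closing x) trivial hQ
    | _ => exact hQ

/-- Soundness of the table: a nonzero entry begins a finite route to a suitable letter. The
assumption `nx 1 = 0` excludes routes that leave the root. -/
theorem Residual.reach {v} (h : Residual β v L) (hT : IsTable Q nx β 0)
    (hl : IsLabelling lab β 0) (h0 : nx 1 = 0) (hv : nx v ≠ 0) : Reach Q nx lab v := by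
  obtain ⟨j, δ, k, ho, h⟩ := h
  have hexit : nx (2 * j + 1) ≠ 0 → Reach Q nx lab (2 * j + 1) :=
    ho.reach_exit hT hl (fun h => absurd h0 h)
  rcases h with ⟨rfl, rfl⟩ | ⟨rfl, rfl⟩
  · have hTδ := hT.of_occ ho
    have hlδ := hl.of_occ ⟨_, _, ho⟩
    rcases hTδ.here.enter_ne_zero.1 hv with h | h
    · exact (hTδ.reach hlδ).1 h
    · exact (hTδ.reach hlδ).2 h.1 (hexit h.2)
  · exact hexit hv

/-- The word that is read when leaving a state. -/
def labelWord (lab : ℕ → Option (RefSym A X)) (v : ℕ) : List (RefSym A X × ℕ) :=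
  match lab v with
  | some b => [(b, v)]
  | none => []

/-- `Child j δ k j' δ' k'`: the node `j'` is a child of the node `j`. -/
inductive Child (j : ℕ) : Expr A X → Language (RefSym A X × ℕ) → ℕ → Expr A X →
    Language (RefSym A X × ℕ) → Prop
  | catL (β γ : Expr A X) (k : Language (RefSym A X × ℕ)) :
      Child j (.cat β γ) k (j + 1) β (γ.posLanguage (j + 1 + β.size) * k)
  | catR (β γ : Expr A X) (k : Language (RefSym A X × ℕ)) :
      Child j (.cat β γ) k (j + 1 + β.size) γ k
  | altL (β γ : Expr A X) (k : Language (RefSym A X × ℕ)) :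
      Child j (.alt β γ) k (j + 1) β k
  | altR (β γ : Expr A X) (k : Language (RefSym A X × ℕ)) :
      Child j (.alt β γ) k (j + 1 + β.size) γ k
  | plus (β : Expr A X) (k : Language (RefSym A X × ℕ)) :
      Child j (.plus β) k (j + 1) β (KStar.kstar (β.posLanguage (j + 1)) * k)
  | bind (x : X) (β : Expr A X) (k : Language (RefSym A X × ℕ)) :
      Child j (.bind x β) k (j + 1) β ({[(RefSym.closing x, 2 * j + 1)]} * k)

theorem Child.occ {j' δ' k''} (h : Child j δ k j' δ' k'') : Occ δ j k j' δ' k'' := by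
  cases h
  · exact .catL (.here _ _ _)
  · exact .catR (.here _ _ _)
  · exact .altL (.here _ _ _)
  · exact .altR (.here _ _ _)
  · exact .plus (.here _ _ _)
  · exact .bind (.here _ _ _)

/-- The edge that leaves the state behind a node is determined by its parent, so the parent has to
be recovered. -/
theorem Occ.parent (h : Occ β i k j δ k') :
    j = i ∨ ∃ j₀ δ₀ k₀, Occ β i k j₀ δ₀ k₀ ∧ Child j₀ δ₀ k₀ j δ k' := by
  have key : ∀ {β : Expr A X} {i k β₁ i₁ k₁}, Child i β k i₁ β₁ k₁ → Occ β₁ i₁ k₁ j δ k' →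
      (j = i₁ ∨ ∃ j₀ δ₀ k₀, Occ β₁ i₁ k₁ j₀ δ₀ k₀ ∧ Child j₀ δ₀ k₀ j δ k') →
      j = i ∨ ∃ j₀ δ₀ k₀, Occ β i k j₀ δ₀ k₀ ∧ Child j₀ δ₀ k₀ j δ k' := by
    rintro β i k β₁ i₁ k₁ hc ho (rfl | ⟨j₀, δ₀, k₀, ho', hc'⟩)
    · obtain ⟨rfl, rfl⟩ := ho.unique (.here _ _ _)
      exact Or.inr ⟨_, _, _, .here _ _ _, hc⟩
    · exact Or.inr ⟨_, _, _, hc.occ.trans ho', hc'⟩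
  induction h with
  | here => exact Or.inl rfl
  | catL h ih => exact key (.catL _ _ _) h (ih @key)
  | catR h ih => exact key (.catR _ _ _) h (ih @key)
  | altL h ih => exact key (.altL _ _ _) h (ih @key)
  | altR h ih => exact key (.altR _ _ _) h (ih @key)
  | plus h ih => exact key (.plus _ _) h (ih @key)
  | bind h ih => exact key (.bind _ _ _) h (ih @key)

theorem labelWord_append_exit (hl : LocalLabel lab j δ) {τ : List (RefSym A X × ℕ)}
    (h : τ ∈ k') : labelWord lab (2 * j + 1) ++ τ ∈ exitLanguage j k' δ := by
  cases δ with
  | bind x δ =>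
    have : lab (2 * j + 1) = some (.closing x) := hl.2
    simp only [labelWord, this]
    exact Language.append_mem_mul rfl h
  | _ =>
    have : lab (2 * j + 1) = none := hl.2
    simpa only [labelWord, this, exitLanguage, List.nil_append] using h

/-- The table gives edges of the expression. -/
theorem Residual.next {v} (h : Residual β v L) (hT : IsTable Q nx β 0)
    (hl : IsLabelling lab β 0) (h0 : nx 1 = 0) (hv : nx v ≠ 0) :
    ∃ L', Residual β (nx v) L' ∧ ∀ τ ∈ L', labelWord lab v ++ τ ∈ L := by
  obtain ⟨j, δ, k, ho, ⟨rfl, rfl⟩ | ⟨rfl, rfl⟩⟩ := h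
  · have hTj := hT _ _ _ _ ho
    have hlj := hl _ _ _ _ ho
    have down : ∀ {j' δ' k''} (hc : Child j δ k j' δ' k''), nx (2 * j) = 2 * j' →
        Residual β (nx (2 * j)) (δ'.posLanguage j' * k'') := by
      intro j' δ' k'' hc h
      rw [h]
      exact Residual.enter (ho.trans hc.occ)
    cases δ with
    | empty => exact absurd hTj hv
    | eps =>
      have h : nx (2 * j) = 2 * j + 1 := by
        simp only [LocalTable, exitTarget] at hTj
        split_ifs at hTj <;> omega
      refine ⟨_, h ▸ Residual.exit ho, fun τ hτ => ?_⟩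
      simp only [labelWord, hlj.1, Expr.posLanguage, one_mul]
      exact hτ
    | term a =>
      have h : nx (2 * j) = 2 * j + 1 := by
        simp only [LocalTable] at hTj
        split_ifs at hTj <;> omega
      refine ⟨_, h ▸ Residual.exit ho, fun τ hτ => ?_⟩
      simp only [labelWord, hlj.1, Expr.posLanguage]
      exact Language.append_mem_mul rfl hτ
    | ref a =>
      have h : nx (2 * j) = 2 * j + 1 := by
        simp only [LocalTable] at hTj
        split_ifs at hTj <;> omega
      refine ⟨_, h ▸ Residual.exit ho, fun τ hτ => ?_⟩
      simp only [labelWord, hlj.1, Expr.posLanguage]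
      exact Language.append_mem_mul rfl hτ
    | cat γ₁ γ₂ =>
      have h : nx (2 * j) = 2 * (j + 1) := by
        have := hTj.2.2
        split_ifs at this <;> omega
      refine ⟨_, down (.catL _ _ _) h, fun τ hτ => ?_⟩
      simp only [labelWord, hlj.1, Expr.posLanguage, mul_assoc]
      exact hτ
    | alt γ₁ γ₂ =>
      have h : nx (2 * j) = 2 * (j + 1) ∨ nx (2 * j) = 2 * (j + 1 + γ₁.size) := by
        have := hTj.2.2
        split_ifs at this <;> omega
      rcases h with h | h
      · refine ⟨_, down (.altL _ _ _) h, fun τ hτ => ?_⟩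
        simp only [labelWord, hlj.1, Expr.posLanguage, add_mul]
        exact Or.inl hτ
      · refine ⟨_, down (.altR _ _ _) h, fun τ hτ => ?_⟩
        simp only [labelWord, hlj.1, Expr.posLanguage, add_mul]
        exact Or.inr hτ
    | plus γ =>
      have h : nx (2 * j) = 2 * (j + 1) := by
        have := hTj.2
        split_ifs at this <;> omega
      refine ⟨_, down (.plus _ _) h, fun τ hτ => ?_⟩
      simp only [labelWord, hlj.1, Expr.posLanguage, mul_assoc]
      exact hτ
    | bind x γ =>
      have h : nx (2 * j) = 2 * (j + 1) := by
        have := hTj.2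
        split_ifs at this <;> omega
      refine ⟨_, down (.bind _ _ _) h, fun τ hτ => ?_⟩
      simp only [labelWord, hlj.1, Expr.posLanguage, mul_assoc]
      exact Language.append_mem_mul rfl hτ
  · have hlj := hl _ _ _ _ ho
    suffices ∃ L', Residual β (nx (2 * j + 1)) L' ∧ ∀ τ ∈ L', τ ∈ k by
      obtain ⟨L', hL', h⟩ := this
      exact ⟨L', hL', fun τ hτ => labelWord_append_exit hlj (h τ hτ)⟩
    rcases ho.parent with rfl | ⟨j₀, δ₀, k₀, ho₀, hc⟩
    · exact absurd h0 hv
    have hTj := hT _ _ _ _ ho₀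
    have up : ∀ {i}, nx (2 * i + 1) = exitTarget nx j₀ → nx (2 * i + 1) ≠ 0 →
        Residual β (nx (2 * i + 1)) (exitLanguage j₀ k₀ δ₀) := by
      intro i h hv
      rw [h, exitTarget_ne_zero] at hv
      rw [exitTarget, if_neg hv] at h
      rw [h]
      exact Residual.exit ho₀
    cases hc with
    | catL γ₁ γ₂ =>
      have h : nx (2 * (j₀ + 1) + 1) = 2 * (j₀ + 1 + δ.size) := by
        have := hTj.2.1
        split_ifs at this <;> omega
      refine ⟨_, ?_, fun τ hτ => hτ⟩
      rw [h]
      exact Residual.enter (ho₀.trans (.catR (.here _ _ _)))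
    | catR => exact ⟨_, up hTj.1 hv, fun τ hτ => hτ⟩
    | altL => exact ⟨_, up hTj.2.1 hv, fun τ hτ => hτ⟩
    | altR => exact ⟨_, up hTj.1 hv, fun τ hτ => hτ⟩
    | plus =>
      -- The continuation of the body is `β* k = k + β (β* k)`: going back to the front of the body
      -- uses the second summand, leaving the loop the first.
      by_cases hf : δ.first Q ≠ 0
      · have h : nx (2 * (j₀ + 1) + 1) = 2 * (j₀ + 1) := by rw [hTj.1, if_pos hf]
        refine ⟨δ.posLanguage (j₀ + 1) * (KStar.kstar (δ.posLanguage (j₀ + 1)) * k₀), ?_,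
          fun τ hτ => ?_⟩
        · rw [h]
          exact Residual.enter ho
        · rw [← Language.one_add_self_mul_kstar_eq_kstar, add_mul, mul_assoc]
          exact Or.inr hτ
      · have h := hTj.1
        rw [if_neg hf] at h
        refine ⟨_, up h hv, fun τ hτ => ?_⟩
        rw [← Language.one_add_self_mul_kstar_eq_kstar, add_mul, one_mul]
        exact Or.inl hτ
    | bind => exact ⟨_, up hTj.1 hv, fun τ hτ => hτ⟩

end Residuals

end DetRegex

/-! ### The rest of a word after a letter, and evaluation without output. -/

namespace DetRegex

universe u v

section Following

variable {A : Type u} {X : Type v} {Q : RefSym A X → Bool} {nx : ℕ → ℕ}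
  {lab : ℕ → Option (RefSym A X)} {β δ : Expr A X} {i j : ℕ}
  {k k' L : Language (RefSym A X × ℕ)}

/-- After every letter, the words of the language go on as in the state behind the letter. -/
def LettersIn (β : Expr A X) (L : Language (RefSym A X × ℕ)) : Prop :=
  ∀ r b p s, ¬ b.IsBracket → r ++ (b, p) :: s ∈ L →
    ∃ j δ k', Occ β 0 1 j δ k' ∧ δ.IsLetter b ∧ p = 2 * j ∧ s ∈ k'

theorem LettersIn.of_append {x y r s : List (RefSym A X × ℕ)} {b : RefSym A X} {p : ℕ}
    (ho : Occ β 0 1 j δ k') (hk : LettersIn β k') (hb : ¬ b.IsBracket)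
    (h : x ++ y = r ++ (b, p) :: s) (hx : x ∈ δ.posLanguage j) (hy : y ∈ k') :
    ∃ j δ k', Occ β 0 1 j δ k' ∧ δ.IsLetter b ∧ p = 2 * j ∧ s ∈ k' := by
  rcases List.append_eq_append_iff.1 h with ⟨t, -, ht⟩ | ⟨t, ht, ht'⟩
  · exact hk t b p s hb (ht ▸ hy)
  · rcases t with _ | ⟨q, t⟩
    · exact hk [] b p s hb (by simpa using ht'.symm ▸ hy)
    · simp only [List.cons_append, List.cons.injEq] at ht'
      obtain ⟨rfl, rfl⟩ := ht'
      subst ht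
      obtain ⟨j, δ, k', ho', h⟩ := Expr.exists_occ_of_mem hb hx hy
      exact ⟨j, δ, k', ho.trans ho', h⟩

theorem LettersIn.mul (ho : Occ β 0 1 j δ k') (hk : LettersIn β k') :
    LettersIn β (δ.posLanguage j * k') := by
  intro r b p s hb h
  obtain ⟨x, hx, y, hy, hxy⟩ := Language.mem_mul.1 h
  exact LettersIn.of_append ho hk hb hxy hx hy

theorem LettersIn.bracket_mul {b : RefSym A X} {p : ℕ} (hb : b.IsBracket) (hk : LettersIn β k') :
    LettersIn β ({[(b, p)]} * k') := by
  intro r c q s hc h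
  obtain ⟨x, hx, y, hy, hxy⟩ := Language.mem_mul.1 h
  rw [Language.mem_singleton_word] at hx
  subst hx
  rcases r with _ | ⟨p', r⟩
  · simp only [List.cons_append, List.nil_append, List.cons.injEq, Prod.mk.injEq] at hxy
    exact absurd (hxy.1.1 ▸ hb) hc
  · simp only [List.cons_append, List.nil_append, List.cons.injEq] at hxy
    exact hk r c q s hc (hxy.2 ▸ hy)

/-- A continuation is composed of languages of nodes, stars of such languages and closing brackets.
Going down from the root each new piece is again covered by `Expr.exists_occ_of_mem`; for a star the
proof runs over the iterations. -/
theorem Occ.lettersIn (ho : Occ β 0 1 j δ k') : LettersIn β k' := by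
  have key : ∀ {γ i k j δ k'}, Occ γ i k j δ k' → Occ β 0 1 i γ k → LettersIn β k →
      LettersIn β k' := by
    intro γ i k j δ k' ho
    induction ho with
    | here => exact fun _ h => h
    | catL _ ih =>
      intro ho h
      refine ih (ho.trans (.catL (.here _ _ _))) ?_
      exact LettersIn.mul (ho.trans (.catR (.here _ _ _))) h
    | catR _ ih => exact fun ho h => ih (ho.trans (.catR (.here _ _ _))) h
    | altL _ ih => exact fun ho h => ih (ho.trans (.altL (.here _ _ _))) h
    | altR _ ih => exact fun ho h => ih (ho.trans (.altR (.here _ _ _))) h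
    | @plus γ i k j δ k' _ ih =>
      intro ho h
      have ho' := ho.trans (.plus (.here _ _ _))
      refine ih ho' ?_
      intro r b p s hb hmem
      obtain ⟨x, hx, y, hy, hxy⟩ := Language.mem_mul.1 hmem
      obtain ⟨l, rfl, hl⟩ := Language.mem_kstar.1 hx
      clear hmem hx
      induction l generalizing r with
      | nil => exact h r b p s hb (by simpa using hxy ▸ hy)
      | cons z l ihl =>
        have hl' : ∀ y ∈ l, y ∈ γ.posLanguage (i + 1) := fun y hy => hl y (by simp [hy])
        have hmem : l.flatten ++ y ∈ KStar.kstar (γ.posLanguage (i + 1)) * k :=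
          Language.append_mem_mul (Language.join_mem_kstar hl') hy
        rw [List.flatten_cons, List.append_assoc] at hxy
        rcases List.append_eq_append_iff.1 hxy with ⟨t, -, ht⟩ | ⟨t, ht, ht'⟩
        · exact ihl t hl' ht
        · rcases t with _ | ⟨q, t⟩
          · exact ihl [] hl' (by simpa using ht'.symm)
          · simp only [List.cons_append, List.cons.injEq] at ht'
            obtain ⟨rfl, rfl⟩ := ht'
            obtain ⟨j, δ, k', ho'', h⟩ := Expr.exists_occ_of_mem hb
              (ht ▸ hl z (by simp)) hmem
            exact ⟨j, δ, k', ho'.trans ho'', h⟩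
    | bind _ ih =>
      intro ho h
      exact ih (ho.trans (.bind (.here _ _ _))) (LettersIn.bracket_mul trivial h)
  refine key ho (.here _ _ _) ?_
  intro r b p s _ h
  rw [Language.mem_one] at h
  simp at h

/-- The position of a letter is the number of its state, so after reading it the word continues from
the next number, whatever route led there. Routes may hence be compared by their last letter alone.
-/
theorem Residual.after_letter {v : ℕ} (h : Residual β v L) {r s : List (RefSym A X × ℕ)}
    {b : RefSym A X} {p : ℕ} (hb : ¬ b.IsBracket) (hmem : r ++ (b, p) :: s ∈ L) :
    ∃ L', Residual β (p + 1) L' ∧ s ∈ L' := by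
  have hL : LettersIn β L := by
    obtain ⟨j, δ, k, ho, ⟨rfl, rfl⟩ | ⟨rfl, rfl⟩⟩ := h
    · exact LettersIn.mul ho ho.lettersIn
    · cases δ with
      | bind x δ => exact LettersIn.bracket_mul trivial ho.lettersIn
      | _ => exact ho.lettersIn
  obtain ⟨j, δ, k, ho, hδ, rfl, hs⟩ := hL r b p s hb hmem
  refine ⟨_, Residual.exit ho, ?_⟩
  cases δ with
  | bind x δ => exact hδ.elim
  | _ => exact hs

theorem IsSilent.isBracketWord {v : ℕ} (h : IsSilent lab v) :
    Expr.IsBracketWord (labelWord lab v) := by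
  intro g hg
  unfold labelWord at hg
  split at hg
  · rename_i b hb
    simp only [List.mem_singleton] at hg
    subst hg
    exact h _ hb
  · simp at hg

/-- The word that is read on the way to a letter that satisfies `Q`. -/
theorem Reach.exists_word {v : ℕ} (h : Reach Q nx lab v) (hT : IsTable Q nx β 0)
    (hl : IsLabelling lab β 0) (h0 : nx 1 = 0) (hv : Residual β v L) :
    ∃ γ b p ω L' M, Expr.IsBracketWord γ ∧ ¬ b.IsBracket ∧ Q b ∧
      (lab p = some b ∧ ∃ L₀, Residual β p L₀) ∧ Residual β (p + 1) L' ∧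
      Residual β (nx v) M ∧ γ ++ [(b, p)] = labelWord lab v ++ ω ∧ (∀ s ∈ L', ω ++ s ∈ M) ∧
      ∀ τ ∈ M, labelWord lab v ++ τ ∈ L := by
  induction h generalizing L with
  | @letter v b hb hbr hQ hn =>
    obtain ⟨M, hM, hmem⟩ := hv.next hT hl h0 (by omega)
    refine ⟨[], b, v, [], M, M, fun _ h => by simp at h, hbr, hQ, ⟨hb, _, hv⟩, hn ▸ hM,
      hM, ?_,
      fun s hs => hs, hmem⟩
    simp [labelWord, hb]
  | @step v hs hn _ ih =>
    obtain ⟨M, hM, hmem⟩ := hv.next hT hl h0 hn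
    obtain ⟨γ, b, p, ω, L', M', hγ, hb, hQ, hp, hL', -, he, hω, hmem'⟩ := ih hM
    refine ⟨labelWord lab v ++ γ, b, p, γ ++ [(b, p)], L', M,
      Expr.isBracketWord_append.2 ⟨hs.isBracketWord, hγ⟩, hb, hQ, hp, hL', hM, by simp,
      fun s hs => ?_, hmem⟩
    rw [he, List.append_assoc]
    exact hmem' _ (hω s hs)

theorem exists_first_letter (τ : List (RefSym A X × ℕ)) : Expr.IsBracketWord τ ∨
    ∃ γ b p s, Expr.IsBracketWord γ ∧ ¬ b.IsBracket ∧ τ = γ ++ (b, p) :: s := by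
  induction τ with
  | nil => exact Or.inl fun _ h => by simp at h
  | cons q τ ih =>
    by_cases hq : q.1.IsBracket
    · rcases ih with h | ⟨γ, b, p, s, hγ, hb, rfl⟩
      · refine Or.inl fun g hg => ?_
        rcases List.mem_cons.1 hg with rfl | hg
        · exact hq
        · exact h g hg
      · refine Or.inr ⟨q :: γ, b, p, s, fun g hg => ?_, hb, rfl⟩
        rcases List.mem_cons.1 hg with rfl | hg
        · exact hq
        · exact hγ g hg
    · exact Or.inr ⟨[], q.1, q.2, τ, fun _ h => by simp at h, hq, rfl⟩

/-! ### Evaluation of words with positions -/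

theorem DerefState.eq_of_fields {d d' : DerefState A X} (ho : d.out = d'.out)
    (hs : ∀ y, d.start y = d'.start y) (hv : ∀ y, d.value y = d'.value y) : d = d' := by
  obtain ⟨o, s, v⟩ := d
  obtain ⟨o', s', v'⟩ := d'
  simp only [DerefState.mk.injEq]
  exact ⟨ho, funext hs, funext hv⟩

variable [DecidableEq X]

/-- Evaluation of a word with positions. -/
def runWord (d : DerefState A X) (τ : List (RefSym A X × ℕ)) : DerefState A X :=
  (τ.map Prod.fst).foldl DerefState.step d

@[simp]
theorem runWord_nil (d : DerefState A X) : runWord d [] = d := rfl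

@[simp]
theorem runWord_cons (d : DerefState A X) (p : RefSym A X × ℕ) (τ) :
    runWord d (p :: τ) = runWord (d.step p.1) τ := rfl

theorem runWord_append (d : DerefState A X) (τ τ' : List (RefSym A X × ℕ)) :
    runWord d (τ ++ τ') = runWord (runWord d τ) τ' := by
  simp [runWord]

theorem out_prefix_step (d : DerefState A X) (b : RefSym A X) : d.out <+: (d.step b).out := by
  cases b <;> simp [DerefState.step]

theorem out_prefix_runWord (d : DerefState A X) (τ : List (RefSym A X × ℕ)) :
    d.out <+: (runWord d τ).out := by
  induction τ generalizing d with
  | nil => simp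
  | cons p τ ih => exact (out_prefix_step d p.1).trans (ih _)

theorem out_step_of_isBracket (d : DerefState A X) {b : RefSym A X} (hb : b.IsBracket) :
    (d.step b).out = d.out := by
  cases b <;> first | rfl | exact hb.elim

theorem out_runWord_of_isBracketWord (d : DerefState A X) {γ : List (RefSym A X × ℕ)}
    (hγ : Expr.IsBracketWord γ) : (runWord d γ).out = d.out := by
  induction γ generalizing d with
  | nil => rfl
  | cons p γ ih =>
    rw [runWord_cons, ih _ (fun g hg => hγ g (by simp [hg])),
      out_step_of_isBracket _ (hγ p (by simp))]

theorem out_step_of_out_runWord {d : DerefState A X} {p : RefSym A X × ℕ} {τ}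
    (h : (runWord d (p :: τ)).out = d.out) : (d.step p.1).out = d.out ∧
      (runWord (d.step p.1) τ).out = (d.step p.1).out := by
  have h₁ := out_prefix_step d p.1
  have h₂ := out_prefix_runWord (d.step p.1) τ
  rw [runWord_cons] at h
  have h₃ : (d.step p.1).out = d.out :=
    (h₂.eq_of_length_le (by rw [h]; exact h₁.length_le)).trans h
  exact ⟨h₃, h.trans h₃.symm⟩

section NoOutput

variable {d : DerefState A X} {τ : List (RefSym A X × ℕ)} {y : X}

open Classical in
-- As long as there is no output all positions coincide, so the order of the brackets is irrelevant
-- and only the presence of an opening one counts.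
theorem start_runWord (h : (runWord d τ).out = d.out) :
    (runWord d τ).start y =
      if RefSym.opening y ∈ τ.map Prod.fst then d.out.length else d.start y := by
  induction τ generalizing d with
  | nil => simp
  | cons p τ ih =>
    obtain ⟨h₁, h₂⟩ := out_step_of_out_runWord h
    rw [runWord_cons, ih h₂, h₁]
    obtain ⟨b | x | x | x, q⟩ := p
    · simp [DerefState.step]
    · simp [DerefState.step]
    · by_cases hx : y = x
      · simp [DerefState.step, hx]
      · simp [DerefState.step, hx]
    · simp [DerefState.step]

open Classical in
-- Neither the output nor the start of `y` moves, so every closing bracket of `y` stores the same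
-- factor.
theorem value_runWord_of_not_mem (h : (runWord d τ).out = d.out)
    (hy : RefSym.opening y ∉ τ.map Prod.fst) :
    (runWord d τ).value y =
      if RefSym.closing y ∈ τ.map Prod.fst then d.out.drop (d.start y) else d.value y := by
  induction τ generalizing d with
  | nil => simp
  | cons p τ ih =>
    obtain ⟨h₁, h₂⟩ := out_step_of_out_runWord h
    simp only [List.map_cons, List.mem_cons, not_or] at hy
    rw [runWord_cons, ih h₂ hy.2, h₁]
    obtain ⟨b | x | x | x, q⟩ := p
    · simp [DerefState.step]
    · simp [DerefState.step]
    · have hx : y ≠ x := fun hx => hy.1 (by rw [hx])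
      simp [DerefState.step, hx]
    · by_cases hx : y = x
      · subst hx; simp [DerefState.step]
      · simp [DerefState.step, hx]

open Classical in
-- The factor for `y` starts at the end of the output and keeps doing so, hence every closing
-- bracket of `y` stores the empty word.
theorem value_runWord_of_start (h : (runWord d τ).out = d.out) (hy : d.start y = d.out.length) :
    (runWord d τ).value y =
      if RefSym.closing y ∈ τ.map Prod.fst then [] else d.value y := by
  induction τ generalizing d with
  | nil => simp
  | cons p τ ih =>
    obtain ⟨h₁, h₂⟩ := out_step_of_out_runWord h
    have hs : (d.step p.1).start y = (d.step p.1).out.length := by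
      rw [h₁]
      obtain ⟨b | x | x | x, q⟩ := p
      · exact hy
      · exact hy
      · by_cases hx : y = x
        · simp [DerefState.step, hx]
        · simp [DerefState.step, hx, hy]
      · exact hy
    rw [runWord_cons, ih h₂ hs]
    obtain ⟨b | x | x | x, q⟩ := p
    · simp [DerefState.step]
    · simp [DerefState.step]
    · simp [DerefState.step]
    · by_cases hx : y = x
      · subst hx; simp [DerefState.step, hy]
      · simp [DerefState.step, hx]

/-- A word that is repeated without output has no effect from the third time on. -/
theorem runWord_three (h₁ : (runWord d τ).out = d.out)
    (h₂ : (runWord (runWord d τ) τ).out = d.out)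
    (h₃ : (runWord (runWord (runWord d τ) τ) τ).out = d.out) :
    runWord (runWord (runWord d τ) τ) τ = runWord (runWord d τ) τ := by
  have e₂ : (runWord (runWord d τ) τ).out = (runWord d τ).out := h₂.trans h₁.symm
  have e₃ : (runWord (runWord (runWord d τ) τ) τ).out = (runWord (runWord d τ) τ).out :=
    h₃.trans h₂.symm
  have hs : ∀ y, (runWord (runWord (runWord d τ) τ) τ).start y =
      (runWord (runWord d τ) τ).start y := by
    intro y
    rw [start_runWord e₃, start_runWord e₂, h₂, h₁]
    split_ifs <;> rfl
  have hv : ∀ y, (runWord (runWord (runWord d τ) τ) τ).value y =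
      (runWord (runWord d τ) τ).value y := by
    intro y
    -- If the word opens `y`, then after one pass the start of `y` is the end of the output and
    -- closing brackets store `ε`; otherwise they always store the same factor. For `]_y [_y` the
    -- first pass may store a nonempty factor and the second stores `ε`, so one pass does not
    -- suffice to stabilise.
    by_cases ho : RefSym.opening y ∈ τ.map Prod.fst
    · have s₁ : (runWord d τ).start y = (runWord d τ).out.length := by
        rw [start_runWord h₁, if_pos ho, h₁]
      have s₂ : (runWord (runWord d τ) τ).start y = (runWord (runWord d τ) τ).out.length := by
        rw [start_runWord e₂, if_pos ho, e₂]
      rw [value_runWord_of_start e₃ s₂, value_runWord_of_start e₂ s₁]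
      split_ifs <;> rfl
    · rw [value_runWord_of_not_mem e₃ ho, value_runWord_of_not_mem e₂ ho, h₂, h₁,
        start_runWord e₂, start_runWord h₁, if_neg ho, if_neg ho]
      split_ifs <;> rfl
  exact DerefState.eq_of_fields e₃ hs hv

end NoOutput

end Following

end DetRegex

/-! ### Determinism makes the table walk correct; cycles without output. -/

namespace DetRegex

section System

/-- The symbol is the terminal `a`. -/
def isTerm (a : ℕ) : RefSym ℕ ℕ → Bool
  | .term b => b = a
  | _ => false

/-- The symbol is a variable. -/
def isVar : RefSym ℕ ℕ → Bool
  | .var _ => true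
  | _ => false

theorem eq_of_isTerm {a : ℕ} {b : RefSym ℕ ℕ} (h : isTerm a b) : b = .term a := by
  cases b <;> simp_all [isTerm]

theorem eq_of_isVar {b : RefSym ℕ ℕ} (h : isVar b) : ∃ x, b = .var x := by
  cases b <;> simp_all [isVar]

/-- The expression `α` with an end marker `e`, labels of its states, and its table for
variables. -/
structure IsSystem (α : Expr ℕ ℕ) (e : ℕ) (lab : ℕ → Option (RefSym ℕ ℕ)) (nv : ℕ → ℕ) :
    Prop where
  regex : α.IsRegex
  det : IsDetLanguage (α.posLanguage 1)
  noTerm : ∀ k j k', ¬ Occ α 1 k j (.term e) k'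
  labels : IsLabelling lab (α.cat (.term e)) 0
  varTable : IsTable isVar nv (α.cat (.term e)) 0
  varTable_one : nv 1 = 0

/-- The table of a class of letters, with no letter behind the root. -/
structure IsRow (Q : RefSym ℕ ℕ → Bool) (α : Expr ℕ ℕ) (e : ℕ) (nc : ℕ → ℕ) : Prop where
  table : IsTable Q nc (α.cat (.term e)) 0
  one : nc 1 = 0

/-- The evaluation can be completed to the word `w` from state `v`. -/
def Accepts (β : Expr ℕ ℕ) (w : List ℕ) (v : ℕ) (d : DerefState ℕ ℕ) : Prop :=
  ∃ L τ, Residual β v L ∧ τ ∈ L ∧ (runWord d τ).out = w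

/-- The state `v` can be reached by some word. -/
def Live (β : Expr ℕ ℕ) (v : ℕ) : Prop :=
  ∃ L r, Residual β v L ∧ ∀ τ ∈ L, r ++ τ ∈ β.posLanguage 0

/-- The next state, preferably on the way to a letter of the class of `nc`, else to a variable. -/
def nextState (nv nc : ℕ → ℕ) (v : ℕ) : ℕ :=
  if nc v ≠ 0 then nc v else nv v

variable {α : Expr ℕ ℕ} {e : ℕ} {lab : ℕ → Option (RefSym ℕ ℕ)} {nv nc : ℕ → ℕ}
  {L : Language (RefSym ℕ ℕ × ℕ)} {v : ℕ} {Q : RefSym ℕ ℕ → Bool}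

theorem IsSystem.varRow (S : IsSystem α e lab nv) : IsRow isVar α e nv :=
  ⟨S.varTable, S.varTable_one⟩

theorem Live.start (β : Expr ℕ ℕ) : Live β 0 :=
  ⟨_, [], Residual.enter (.here _ _ _), fun τ h => by simpa using h⟩

theorem mem_posLanguage_cat_term {ρ : List (RefSym ℕ ℕ × ℕ)} :
    ρ ∈ (α.cat (.term e)).posLanguage 0 ↔
      ∃ ρ' ∈ α.posLanguage 1, ρ = ρ' ++ [(.term e, 2 * (1 + α.size))] := by
  constructor
  · intro h
    obtain ⟨x, hx, y, hy, rfl⟩ := Language.mem_mul.1 h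
    rw [Expr.posLanguage, Language.mem_singleton_word] at hy
    subst hy
    exact ⟨x, hx, by simp⟩
  · rintro ⟨ρ', h, rfl⟩
    refine Language.append_mem_mul h ?_
    rw [Expr.posLanguage, Language.mem_singleton_word]

theorem IsSystem.wellFormed (S : IsSystem α e lab nv) {ρ}
    (h : ρ ∈ (α.cat (.term e)).posLanguage 0) : (α.cat (.term e)).WellFormed := by
  obtain ⟨ρ', h, -⟩ := mem_posLanguage_cat_term.1 h
  rcases S.regex with rfl | hα
  · exact absurd h (Language.notMem_zero _)
  · exact ⟨hα, trivial⟩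

/-- Determinism is known for `α` only. A letter other than the marker occurs before the last one, so
the final marker can be dropped without touching the prefix up to that letter. -/
theorem exists_mem_posLanguage {x s : List (RefSym ℕ ℕ × ℕ)} {b i}
    (h : x ++ (b, i) :: s ∈ (α.cat (.term e)).posLanguage 0) (hb : b ≠ .term e) :
    ∃ s', x ++ (b, i) :: s' ∈ α.posLanguage 1 := by
  obtain ⟨ρ', hρ', h⟩ := mem_posLanguage_cat_term.1 h
  rcases List.eq_nil_or_concat s with rfl | ⟨s', q, rfl⟩
  · obtain ⟨-, h⟩ := List.append_inj' h rfl
    simp only [List.cons.injEq, Prod.mk.injEq] at h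
    exact absurd h.1.1 hb
  · refine ⟨s', ?_⟩
    have : (x ++ (b, i) :: s') ++ [q] = ρ' ++ [(.term e, 2 * (1 + α.size))] := by
      rw [← h]; simp
    obtain ⟨rfl, -⟩ := List.append_inj' this rfl
    exact hρ'

/-- The only letter that can be read next is the one to which the table leads. -/
theorem IsSystem.follow (S : IsSystem α e lab nv) {r γ s : List (RefSym ℕ ℕ × ℕ)} {b i}
    (hR : IsRow Q α e nc) (hv : Residual (α.cat (.term e)) v L)
    (hr : ∀ τ ∈ L, r ++ τ ∈ (α.cat (.term e)).posLanguage 0) (hn : nc v ≠ 0)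
    (hγ : Expr.IsBracketWord γ) (hb : ¬ b.IsBracket) (hmem : γ ++ (b, i) :: s ∈ L)
    (hbe : b ≠ .term e)
    (hQ : ∀ c, Q c → c ≠ .term e ∧ (c = b ∨ (∃ x, b = .var x) ∨ ∃ x, c = .var x)) :
    ∃ M τ', Residual (α.cat (.term e)) (nc v) M ∧ τ' ∈ M ∧
      γ ++ (b, i) :: s = labelWord lab v ++ τ' := by
  obtain ⟨γ', c, p, ω, L', M, hγ', hc, hQc, -, hL', hM, he, hω, hMw⟩ :=
    (hv.reach hR.table S.labels hR.one hn).exists_word hR.table S.labels hR.one hv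
  obtain ⟨hce, hcb⟩ := hQ c hQc
  -- Complete the route of the table to a full word. It shares the prefix `r` with the given word,
  -- so the two can be compared by determinism.
  obtain ⟨s₂, hs₂⟩ := hL'.nonempty (S.wellFormed (hr _ hmem))
  have hmem₂ : γ' ++ (c, p) :: s₂ ∈ L := by
    have := hMw _ (hω _ hs₂)
    rw [← List.append_assoc, ← he] at this
    simpa using this
  have h₁ := hr _ hmem
  have h₂ := hr _ hmem₂
  rw [← List.append_assoc] at h₁ h₂
  obtain ⟨t₁, h₁⟩ := exists_mem_posLanguage h₁ hbe
  obtain ⟨t₂, h₂⟩ := exists_mem_posLanguage h₂ hce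
  -- The two next letters are in conflict: they are equal, or one of them is a variable. So they are
  -- the same occurrence.
  have hip : i = p := by
    rcases hcb with rfl | ⟨x, rfl⟩ | ⟨x, rfl⟩
    · cases c with
      | term a => exact S.det.term h₁ h₂ hγ hγ'
      | var x => exact S.det.var h₁ h₂ hγ hγ' hc
      | opening => exact absurd trivial hc
      | closing => exact absurd trivial hc
    · exact S.det.var h₁ h₂ hγ hγ' hc
    · exact (S.det.var h₂ h₁ hγ' hγ hb).symm
  subst hip
  obtain rfl := S.det.symbol h₁ h₂
  obtain rfl := S.det.brackets h₁ h₂ hγ hγ' hb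
  -- The brackets agree as well. Behind the common letter both words are in the same state, so the
  -- rest of the given word may be appended to the route of the table.
  obtain ⟨L'', hL'', hs⟩ := hv.after_letter hb hmem
  obtain rfl := hL''.unique hL'
  refine ⟨M, ω ++ s, hM, hω s hs, ?_⟩
  rw [← List.append_assoc, ← he]
  simp

theorem LocalLabel.eq_term {j : ℕ} {δ : Expr ℕ ℕ} {a : ℕ} (h : LocalLabel lab j δ)
    (ha : lab (2 * j) = some (.term a)) : δ = .term a := by
  cases δ <;> simp_all [LocalLabel]

/-- The terminal `e` does not occur in `α`, so a state with this label is the one in front of the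
marker, and nothing is left behind it. -/
theorem IsSystem.end_residual (S : IsSystem α e lab nv) {p : ℕ}
    (hp : Residual (α.cat (.term e)) p L) (hlab : lab p = some (.term e)) :
    Residual (α.cat (.term e)) (p + 1) 1 := by
  obtain ⟨j, δ, k, ho, ⟨rfl, rfl⟩ | ⟨rfl, rfl⟩⟩ := hp
  · obtain rfl := (S.labels _ _ _ _ ho).eq_term hlab
    cases ho with
    | catL ho => exact absurd ho (S.noTerm _ _ _)
    | catR ho =>
      cases ho with
      | here => exact Residual.exit (.catR (.here _ _ _))
  · exact absurd ((S.labels _ _ _ _ ho).silent_exit _ hlab) id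

/-! ### The steps of the evaluation -/

variable {w rem : List ℕ} {d : DerefState ℕ ℕ} {a : ℕ}

theorem Live.of_next (S : IsSystem α e lab nv) (hR : IsRow Q α e nc)
    (hv : Live (α.cat (.term e)) v) (hn : nc v ≠ 0) : Live (α.cat (.term e)) (nc v) := by
  obtain ⟨L, r, hL, hr⟩ := hv
  obtain ⟨M, hM, h⟩ := hL.next hR.table S.labels hR.one hn
  exact ⟨M, r ++ labelWord lab v, hM, fun τ hτ => by
    rw [List.append_assoc]; exact hr _ (h τ hτ)⟩

theorem Live.nextState (S : IsSystem α e lab nv) (hR : IsRow Q α e nc)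
    (hv : Live (α.cat (.term e)) v) (hn : nextState nv nc v ≠ 0) :
    Live (α.cat (.term e)) (nextState nv nc v) := by
  unfold DetRegex.nextState at *
  split_ifs at * with h
  · exact hv.of_next S hR h
  · exact hv.of_next S S.varRow hn

theorem Residual.nextState (S : IsSystem α e lab nv) (hR : IsRow Q α e nc)
    (hv : Residual (α.cat (.term e)) v L) (hn : nextState nv nc v ≠ 0) :
    ∃ M, Residual (α.cat (.term e)) (nextState nv nc v) M ∧
      ∀ τ ∈ M, labelWord lab v ++ τ ∈ L := by
  unfold DetRegex.nextState at *
  split_ifs at * with h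
  · exact hv.next hR.table S.labels hR.one h
  · exact hv.next S.varTable S.labels S.varTable_one hn

theorem exists_letter_of_out {τ : List (RefSym ℕ ℕ × ℕ)}
    (h : (runWord d τ).out = d.out ++ a :: rem) :
    ∃ γ b p s, Expr.IsBracketWord γ ∧ ¬ b.IsBracket ∧ τ = γ ++ (b, p) :: s ∧
      (b = .term a ∨ ∃ x, b = .var x) := by
  rcases exists_first_letter τ with hτ | ⟨γ, b, p, s, hγ, hb, rfl⟩
  · rw [out_runWord_of_isBracketWord d hτ] at h
    simp at h
  · refine ⟨γ, b, p, s, hγ, hb, rfl, ?_⟩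
    cases b with
    | term c =>
      refine Or.inl ?_
      rw [runWord_append, runWord_cons] at h
      have hp := out_prefix_runWord ((runWord d γ).step (.term c)) s
      rw [h] at hp
      simp only [DerefState.step, out_runWord_of_isBracketWord d hγ] at hp
      rw [List.prefix_append_right_inj] at hp
      rw [(List.cons_prefix_cons.1 hp).1]
    | var x => exact Or.inr ⟨x, rfl⟩
    | opening => exact absurd trivial hb
    | closing => exact absurd trivial hb

/-- If no suitable terminal can be read, the next letter is a variable. -/
theorem IsSystem.var_step (S : IsSystem α e lab nv) (hR : IsRow (isTerm a) α e nc)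
    (hv : Residual (α.cat (.term e)) v L) {r : List (RefSym ℕ ℕ × ℕ)}
    (hr : ∀ τ ∈ L, r ++ τ ∈ (α.cat (.term e)).posLanguage 0) (hn : nc v = 0)
    {τ : List (RefSym ℕ ℕ × ℕ)} (hτ : τ ∈ L) (h : (runWord d τ).out = d.out ++ a :: rem) :
    nv v ≠ 0 ∧ ∃ M τ', Residual (α.cat (.term e)) (nv v) M ∧ τ' ∈ M ∧
      τ = labelWord lab v ++ τ' := by
  obtain ⟨γ, b, p, s, hγ, hb, rfl, rfl | ⟨x, rfl⟩⟩ := exists_letter_of_out h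
  · exact absurd hn (hv.ne_zero hR.table ⟨γ, _, p, s, hγ, hb, by simp [isTerm], hτ⟩)
  · have hnv : nv v ≠ 0 := hv.ne_zero S.varTable ⟨γ, _, p, s, hγ, hb, rfl, hτ⟩
    refine ⟨hnv, S.follow S.varRow hv hr hnv hγ hb hτ (by simp) fun c hc => ?_⟩
    obtain ⟨y, rfl⟩ := eq_of_isVar hc
    exact ⟨by simp, Or.inr (Or.inl ⟨x, rfl⟩)⟩

/-- One step of the evaluation. -/
theorem IsSystem.accepts_iff (S : IsSystem α e lab nv) (hR : IsRow (isTerm a) α e nc)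
    (hv : Live (α.cat (.term e)) v) (hw : w = d.out ++ a :: rem) (hrem : a = e → rem = []) :
    Accepts (α.cat (.term e)) w v d ↔ nextState nv nc v ≠ 0 ∧
      Accepts (α.cat (.term e)) w (nextState nv nc v) (runWord d (labelWord lab v)) := by
  obtain ⟨L, r, hL, hr⟩ := hv
  constructor
  · rintro ⟨L', τ, hL', hτ, hout⟩
    obtain rfl := hL.unique hL'
    rw [hw] at hout
    by_cases hn : nc v = 0
    · obtain ⟨hnv, M, τ', hM, hτ', rfl⟩ := S.var_step hR hL hr hn hτ hout
      have hg : nextState nv nc v = nv v := by simp [nextState, hn]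
      rw [hg]
      refine ⟨hnv, M, τ', hM, hτ', ?_⟩
      rw [← runWord_append, hout, hw]
    · have hg : nextState nv nc v = nc v := by simp [nextState, hn]
      rw [hg]
      refine ⟨hn, ?_⟩
      -- If the marker is next, the given word is replaced by the route of the table: it reads
      -- brackets and the marker, outputs exactly the missing letter and is complete.
      by_cases hae : a = e
      · subst hae
        obtain ⟨γ, b, p, ω, L', M, hγ, hb, hQ, ⟨hlab, L₀, hL₀⟩, hL', hM, he, hω, -⟩ :=
          (hL.reach hR.table S.labels hR.one hn).exists_word hR.table S.labels hR.one hL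
        obtain rfl := eq_of_isTerm hQ
        obtain rfl := hL'.unique (S.end_residual hL₀ hlab)
        refine ⟨M, ω, hM, by simpa using hω [] rfl, ?_⟩
        rw [← runWord_append, ← he, runWord_append, hw, hrem rfl]
        simp [DerefState.step, out_runWord_of_isBracketWord d hγ]
      · obtain ⟨γ, b, p, s, hγ, hb, rfl, hba⟩ := exists_letter_of_out hout
        have hbe : b ≠ .term e := by
          rcases hba with rfl | ⟨x, rfl⟩
          · simpa using hae
          · simp
        obtain ⟨M, τ', hM, hτ', he⟩ := S.follow hR hL hr hn hγ hb hτ hbe fun c hc => by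
          obtain rfl := eq_of_isTerm hc
          exact ⟨by simpa using hae, hba.elim (fun h => Or.inl h.symm) fun h => Or.inr (Or.inl h)⟩
        refine ⟨M, τ', hM, hτ', ?_⟩
        rw [← runWord_append, ← he, hout, hw]
  · rintro ⟨hn, M, τ, hM, hτ, hout⟩
    obtain ⟨M', hM', h⟩ := hL.nextState S hR hn
    obtain rfl := hM.unique hM'
    refine ⟨L, _, hL, h τ hτ, ?_⟩
    rw [runWord_append, hout]

theorem Accepts.out_prefix {β : Expr ℕ ℕ} (h : Accepts β w v d) : d.out <+: w := by
  obtain ⟨L, τ, -, -, rfl⟩ := h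
  exact out_prefix_runWord d τ

/-! ### Cycles without output -/

/-- The word that is read in `n` steps. -/
def walkWord (lab : ℕ → Option (RefSym ℕ ℕ)) (g : ℕ → ℕ) : ℕ → ℕ → List (RefSym ℕ ℕ × ℕ)
  | 0, _ => []
  | n + 1, v => labelWord lab v ++ walkWord lab g n (g v)

theorem walkWord_add (lab : ℕ → Option (RefSym ℕ ℕ)) (g : ℕ → ℕ) (m n v : ℕ) :
    walkWord lab g (m + n) v = walkWord lab g m v ++ walkWord lab g n (g^[m] v) := by
  induction m generalizing v with
  | zero => simp [walkWord]
  | succ m ih => rw [Nat.succ_add]; simp [walkWord, ih]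

theorem Reach.exists_iterate {nx g : ℕ → ℕ} (h : Reach Q nx lab v)
    (hg : ∀ n, nx (g^[n] v) ≠ 0 → g (g^[n] v) = nx (g^[n] v)) :
    ∃ n b, lab (g^[n] v) = some b ∧ Q b := by
  induction h with
  | letter hb _ hQ _ => exact ⟨0, _, hb, hQ⟩
  | @step v _ hn _ ih =>
    have h0 : g v = nx v := hg 0 hn
    obtain ⟨n, b, h⟩ := ih fun n => by
      rw [← h0, ← Function.iterate_succ_apply]
      exact hg (n + 1)
    exact ⟨n + 1, b, by rwa [Function.iterate_succ_apply, h0]⟩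

/-- Among the first `2 * size + 1` states of the walk one is repeated. No terminal lies on the walk,
so the table of `a` is nowhere defined on it, and by determinism every accepted word begins with the
word of the walk. If there is an accepted word, a shortest one thus contains three rounds of the
cycle without output; by `runWord_three` the last of them can be removed, a contradiction. The bound
on `N` leaves room for the way to the cycle and three rounds. -/
theorem IsSystem.not_accepts_of_loop (S : IsSystem α e lab nv) (hR : IsRow (isTerm a) α e nc)
    (hv : Live (α.cat (.term e)) v) (hw : w = d.out ++ a :: rem)
    {N : ℕ} (hN : 3 * (2 * (α.cat (.term e)).size) ≤ N)
    (hg : ∀ n ≤ N, nextState nv nc ((nextState nv nc)^[n] v) ≠ 0)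
    (hlab : ∀ n ≤ N, ∀ c, lab ((nextState nv nc)^[n] v) ≠ some (.term c))
    (hout : ∀ n ≤ N, (runWord d (walkWord lab (nextState nv nc) n v)).out = d.out) :
    ¬ Accepts (α.cat (.term e)) w v d := by
  set β := α.cat (.term e) with hβ
  set g := nextState nv nc with hgdef
  have hlive : ∀ n ≤ N, Live β (g^[n] v) := by
    intro n
    induction n with
    | zero => exact fun _ => hv
    | succ n ih =>
      intro hn
      rw [Function.iterate_succ_apply']
      exact (ih (by omega)).nextState S hR (hg n (by omega))
  -- Pigeonhole principle: all states are below `2 * β.size`.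
  obtain ⟨i, j, hij, hj, hcyc⟩ : ∃ i j, i < j ∧ j ≤ 2 * β.size ∧ g^[i] v = g^[j] v := by
    obtain ⟨i, hi, j, hj, hne, heq⟩ := Finset.exists_ne_map_eq_of_card_lt_of_maps_to
      (s := Finset.range (2 * β.size + 1)) (t := Finset.range (2 * β.size)) (by simp)
      (f := fun n => g^[n] v) (by
        intro n hn
        simp only [Finset.coe_range, Set.mem_Iio] at hn ⊢
        obtain ⟨L, -, hL, -⟩ := hlive n (by omega)
        exact hL.lt)
    simp only [Finset.mem_range] at hi hj
    rcases lt_or_gt_of_ne hne with h | h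
    · exact ⟨i, j, h, by omega, heq⟩
    · exact ⟨j, i, h, by omega, heq.symm⟩
  obtain ⟨P, rfl⟩ : ∃ P, j = i + P := ⟨j - i, by omega⟩
  set p := g^[i] v with hp
  have hper : Function.IsPeriodicPt g P p := by
    rw [add_comm, Function.iterate_add_apply] at hcyc
    exact hcyc.symm
  -- From the repeated state on the walk is periodic, so the assumptions on its first `N` steps hold
  -- for all steps.
  have hall : ∀ n, ∃ m ≤ N, g^[n] v = g^[m] v := by
    intro n
    rcases Nat.lt_or_ge n i with hn | hn
    · exact ⟨n, by omega, rfl⟩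
    · obtain ⟨n, rfl⟩ := Nat.exists_eq_add_of_le hn
      have : n % P < P := Nat.mod_lt _ (by omega)
      refine ⟨i + n % P, by omega, ?_⟩
      rw [add_comm i n, add_comm i (n % P), Function.iterate_add_apply,
        Function.iterate_add_apply, hper.iterate_mod_apply]
  have hlive' : ∀ n, Live β (g^[n] v) := by
    intro n; obtain ⟨m, hm, h⟩ := hall n; rw [h]; exact hlive m hm
  have hg' : ∀ n, g (g^[n] v) ≠ 0 := by
    intro n; obtain ⟨m, hm, h⟩ := hall n; rw [h]; exact hg m hm
  have hlab' : ∀ n c, lab (g^[n] v) ≠ some (.term c) := by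
    intro n; obtain ⟨m, hm, h⟩ := hall n; rw [h]; exact hlab m hm
  -- Where the table of `a` is defined the walk follows it to the letter `a`, but the walk meets no
  -- terminal.
  have hnc : ∀ n, nc (g^[n] v) = 0 := by
    intro n
    by_contra hn
    obtain ⟨L, -, hL, -⟩ := hlive' n
    obtain ⟨m, b, hb, hQ⟩ := (hL.reach hR.table S.labels hR.one hn).exists_iterate (g := g)
      fun n h => by rw [hgdef, nextState, if_pos h]
    rw [eq_of_isTerm hQ, ← Function.iterate_add_apply] at hb
    exact hlab' _ _ hb
  have hgnv : ∀ n, g (g^[n] v) = nv (g^[n] v) := by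
    intro n
    rw [hgdef, nextState, if_neg (not_not.2 (hnc n))]
  obtain ⟨L, r, hL, hr⟩ := hv
  have hback : ∀ n, ∀ M, Residual β (g^[n] v) M → ∀ τ ∈ M, walkWord lab g n v ++ τ ∈ L := by
    intro n
    induction n with
    | zero => intro M hM τ hτ; obtain rfl := hL.unique hM; exact hτ
    | succ n ih =>
      intro M hM τ hτ
      obtain ⟨L', -, hL', -⟩ := hlive' n
      obtain ⟨M', hM', h⟩ := hL'.nextState S hR (hg' n)
      rw [Function.iterate_succ_apply'] at hM
      obtain rfl := hM.unique hM'
      rw [walkWord_add, List.append_assoc]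
      refine ih L' hL' _ ?_
      simpa [walkWord] using h τ hτ
  have hforth : ∀ τ ∈ L, (runWord d τ).out = w → ∀ n ≤ N, ∃ M τ', Residual β (g^[n] v) M ∧
      τ' ∈ M ∧ τ = walkWord lab g n v ++ τ' := by
    intro τ hτ hτw n
    induction n with
    | zero => exact fun _ => ⟨L, τ, hL, hτ, rfl⟩
    | succ n ih =>
      intro hn
      obtain ⟨M, τ', hM, hτ', he⟩ := ih (by omega)
      obtain ⟨M', r', hM', hr'⟩ := hlive' n
      obtain rfl := hM.unique hM'
      have h : (runWord (runWord d (walkWord lab g n v)) τ').out =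
          (runWord d (walkWord lab g n v)).out ++ a :: rem := by
        rw [← runWord_append, ← he, hτw, hw, hout n (by omega)]
      obtain ⟨-, M'', τ'', hM'', hτ'', he'⟩ := S.var_step hR hM hr' (hnc n) hτ' h
      rw [Function.iterate_succ_apply', hgnv]
      refine ⟨M'', τ'', hM'', hτ'', ?_⟩
      rw [walkWord_add, he, he']
      simp [walkWord]
  -- A round reads at least one letter: otherwise nothing at all would be read from `p` on, although
  -- the table of the variables leads to a variable.
  have hu : walkWord lab g P p ≠ [] := by
    intro hu
    have hmul : ∀ n, walkWord lab g (P * n) p = [] := by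
      intro n
      induction n with
      | zero => rfl
      | succ n ih =>
        rw [Nat.mul_succ, walkWord_add, ih, (hper.mul_const n).eq, hu]
        rfl
    have hnil : ∀ n, walkWord lab g n p = [] := by
      intro n
      have h := hmul (n + 1)
      have hle : n ≤ P * (n + 1) := by
        have : 1 ≤ P := by omega
        nlinarith
      obtain ⟨m, hm⟩ := Nat.exists_eq_add_of_le hle
      rw [hm, walkWord_add] at h
      exact (List.append_eq_nil_iff.1 h).1
    obtain ⟨M, -, hM, -⟩ := hlive' i
    obtain ⟨m, b, hb, -⟩ := (hM.reach S.varTable S.labels S.varTable_one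
      (by rw [← hgnv]; exact hg' i)).exists_iterate (g := g) fun n _ => by
        rw [← Function.iterate_add_apply]; exact hgnv _
    have h := hnil (m + 1)
    rw [walkWord_add] at h
    have h := (List.append_eq_nil_iff.1 h).2
    rw [walkWord, labelWord, hb] at h
    simp at h
  rintro ⟨L', τ₀, hL', hτ₀, hτ₀w⟩
  obtain rfl := hL.unique hL'
  -- A shortest accepted word.
  obtain ⟨τ, ⟨hτ, hτw⟩, hmin⟩ := WellFounded.has_min (measure List.length).wf
    {τ | τ ∈ L ∧ (runWord d τ).out = w} ⟨τ₀, hτ₀, hτ₀w⟩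
  have hword : ∀ n, walkWord lab g (i + P * (n + 1)) v =
      walkWord lab g (i + P * n) v ++ walkWord lab g P p := by
    intro n
    rw [Nat.mul_succ, ← add_assoc, walkWord_add _ _ (i + P * n)]
    congr 2
    rw [add_comm i, Function.iterate_add_apply]
    exact (hper.mul_const n).eq
  have hstate : ∀ n, g^[i + P * n] v = p := by
    intro n
    rw [add_comm i, Function.iterate_add_apply]
    exact (hper.mul_const n).eq
  -- Three rounds lead to the same state as two, so the rest `τ'` may be appended after two rounds.
  obtain ⟨M, τ', hM, hτ', he⟩ := hforth τ hτ hτw (i + P * 3) (by omega)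
  rw [hstate] at hM
  have hshort := hback (i + P * 2) M (by rw [hstate]; exact hM) τ' hτ'
  refine hmin (walkWord lab g (i + P * 2) v ++ τ') ⟨hshort, ?_⟩ ?_
  · have h0 := hout (i + P * 0) (by omega)
    have h1 := hout (i + P * 1) (by omega)
    have h2 := hout (i + P * 2) (by omega)
    have h3 := hout (i + P * 3) (by omega)
    rw [← hτw, he, runWord_append, runWord_append]
    congr 2
    rw [hword 2, hword 1, hword 0] at *
    simp only [runWord_append] at *
    rw [← h0] at h1 h2 h3
    exact (runWord_three h1 h2 h3).symm
  · change List.length _ < List.length _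
    rw [he, hword 2]
    have := List.length_pos_iff.2 hu
    simp only [List.length_append]
    omega

end System

end DetRegex

/-! ### Total correctness and cost of structured programs. -/

namespace DetRegex
namespace RAM

/-! ### Verification of structured programs -/

instance (n : ℕ) : OfNat Exp n := ⟨.lit n⟩
instance : Add Exp := ⟨.add⟩
instance : Sub Exp := ⟨.sub⟩

section Eval

variable (σ : Store)

@[simp] theorem Exp.eval_lit (n : ℕ) : (Exp.lit n).eval σ = n := by simp [Exp.eval]
@[simp] theorem Exp.eval_zero : (0 : Exp).eval σ = 0 := eval_lit σ 0
@[simp] theorem Exp.eval_one : (1 : Exp).eval σ = 1 := eval_lit σ 1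
@[simp] theorem Exp.eval_ofNat (n : ℕ) :
    (no_index (OfNat.ofNat n) : Exp).eval σ = OfNat.ofNat n := eval_lit σ n
@[simp] theorem Exp.eval_var (r : ℕ) : (Exp.var r).eval σ = σ.reg r := by simp [Exp.eval]
@[simp] theorem Exp.eval_add (a b : Exp) : (a + b).eval σ = a.eval σ + b.eval σ := by
  change (Exp.add a b).eval σ = _; simp [Exp.eval]
@[simp] theorem Exp.eval_sub (a b : Exp) : (a - b).eval σ = a.eval σ - b.eval σ := by
  change (Exp.sub a b).eval σ = _; simp [Exp.eval]
@[simp] theorem Exp.eval_rd (k : Fin 32) (i : Exp) : (Exp.rd k i).eval σ = σ.arr k (i.eval σ) := by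
  simp [Exp.eval]
@[simp] theorem Exp.eval_ite (a b t f : Exp) :
    (Exp.ite a b t f).eval σ = if a.eval σ = b.eval σ then t.eval σ else f.eval σ := by
  simp [Exp.eval]

@[simp] theorem Store.setReg_reg (r n r' : ℕ) :
    (σ.setReg r n).reg r' = if r' = r then n else σ.reg r' := by
  simp [setReg, Function.update_apply]

@[simp] theorem Store.setReg_arr (r n : ℕ) : (σ.setReg r n).arr = σ.arr := by
  simp [setReg]

@[simp] theorem Store.setArr_reg (k : Fin 32) (i n : ℕ) : (σ.setArr k i n).reg = σ.reg := by
  simp [setArr]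

@[simp] theorem Store.setArr_arr (k : Fin 32) (i n : ℕ) (k' : Fin 32) :
    (σ.setArr k i n).arr k' = if k' = k then Function.update (σ.arr k) i n else σ.arr k' := by
  simp only [setArr, Function.update_apply]

end Eval

/-- The program terminates and the final store and the cost satisfy `Q`. -/
def Runs (inp : ℕ → ℕ) (m : ℕ) (c : Cmd) (σ : Store) (Q : Store → ℕ → Prop) : Prop :=
  ∃ σ' n, Exec inp m c σ σ' n ∧ Q σ' n

variable {inp : ℕ → ℕ} {m : ℕ} {c d : Cmd} {σ : Store} {Q R : Store → ℕ → Prop} {e : Exp}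

theorem Runs.mono (h : Runs inp m c σ Q) (hQ : ∀ σ' n, Q σ' n → R σ' n) : Runs inp m c σ R := by
  obtain ⟨σ', n, h, hq⟩ := h
  exact ⟨σ', n, h, hQ _ _ hq⟩

@[simp] theorem runs_skip : Runs inp m .skip σ Q ↔ Q σ 0 :=
  ⟨fun ⟨_, _, h, hQ⟩ => by cases h; exact hQ, fun h => ⟨_, _, .skip _, h⟩⟩

@[simp] theorem runs_asg {r : ℕ} :
    Runs inp m (.asg r e) σ Q ↔ Q (σ.setReg r (e.eval σ)) 1 :=
  ⟨fun ⟨_, _, h, hQ⟩ => by cases h; exact hQ, fun h => ⟨_, _, .asg _ _ _, h⟩⟩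

@[simp] theorem runs_st {k : Fin 32} {i : Exp} :
    Runs inp m (.st k i e) σ Q ↔ Q (σ.setArr k (i.eval σ) (e.eval σ)) 1 :=
  ⟨fun ⟨_, _, h, hQ⟩ => by cases h; exact hQ, fun h => ⟨_, _, .st _ _ _ _, h⟩⟩

@[simp] theorem runs_inp {r : ℕ} :
    Runs inp m (.inp r e) σ Q ↔ e.eval σ < m ∧ Q (σ.setReg r (inp (e.eval σ))) 1 :=
  ⟨fun ⟨_, _, h, hQ⟩ => by cases h; exact ⟨‹_›, hQ⟩, fun h => ⟨_, _, .inp _ _ _ h.1, h.2⟩⟩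

@[simp] theorem runs_seq : Runs inp m (.seq c d) σ Q ↔
    Runs inp m c σ fun σ' n => Runs inp m d σ' fun σ'' n' => Q σ'' (n + n') := by
  constructor
  · rintro ⟨_, _, h, hQ⟩
    cases h with
    | seq h₁ h₂ => exact ⟨_, _, h₁, _, _, h₂, hQ⟩
  · rintro ⟨_, _, h₁, _, _, h₂, hQ⟩
    exact ⟨_, _, .seq h₁ h₂, hQ⟩

@[simp] theorem runs_ite : Runs inp m (.ite e c d) σ Q ↔
    if e.eval σ = 0 then Runs inp m d σ fun σ' n => Q σ' (n + 1)
    else Runs inp m c σ fun σ' n => Q σ' (n + 1) := by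
  constructor
  · rintro ⟨_, _, h, hQ⟩
    cases h with
    | iteTrue h h₁ => rw [if_neg h]; exact ⟨_, _, h₁, hQ⟩
    | iteFalse h h₁ => rw [if_pos h]; exact ⟨_, _, h₁, hQ⟩
  · intro h
    split_ifs at h with he <;> obtain ⟨_, _, h, hQ⟩ := h
    · exact ⟨_, _, .iteFalse he h, hQ⟩
    · exact ⟨_, _, .iteTrue he h, hQ⟩

/-- A sequence of commands. -/
def Cmd.block : List Cmd → Cmd
  | [] => .skip
  | c :: l => .seq c (block l)

@[simp] theorem runs_block_nil : Runs inp m (.block []) σ Q ↔ Q σ 0 := runs_skip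

@[simp] theorem runs_block_cons {l : List Cmd} : Runs inp m (.block (c :: l)) σ Q ↔
    Runs inp m c σ fun σ' n => Runs inp m (.block l) σ' fun σ'' n' => Q σ'' (n + n') := runs_seq

/-- Execution of `c` if `a = b`, else of `d`. -/
def Cmd.ifEq (a b : Exp) (c d : Cmd) : Cmd := .ite (.ite a b 1 0) c d

@[simp] theorem runs_ifEq {a b : Exp} : Runs inp m (.ifEq a b c d) σ Q ↔
    if a.eval σ = b.eval σ then Runs inp m c σ fun σ' n => Q σ' (n + 1)
    else Runs inp m d σ fun σ' n => Q σ' (n + 1) := by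
  rw [Cmd.ifEq, runs_ite]
  by_cases h : a.eval σ = b.eval σ <;> simp [h]

/-! ### What a program may change -/

/-- The program assigns to the register. -/
def Cmd.setsReg (r : ℕ) : Cmd → Bool
  | skip => false
  | asg r' _ => r = r'
  | st _ _ _ => false
  | .inp r' _ => r = r'
  | seq c d => c.setsReg r || d.setsReg r
  | ite _ c d => c.setsReg r || d.setsReg r
  | loop _ c => c.setsReg r

/-- The program assigns to the array. -/
def Cmd.setsArr (k : Fin 32) : Cmd → Bool
  | skip => false
  | asg _ _ => false
  | st k' _ _ => k = k'
  | .inp _ _ => false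
  | seq c d => c.setsArr k || d.setsArr k
  | ite _ c d => c.setsArr k || d.setsArr k
  | loop _ c => c.setsArr k

/-- The stores agree on everything that the program does not assign to. -/
structure Frame (c : Cmd) (σ σ' : Store) : Prop where
  reg : ∀ r, c.setsReg r = false → σ'.reg r = σ.reg r
  arr : ∀ k, c.setsArr k = false → σ'.arr k = σ.arr k

theorem Frame.refl (c : Cmd) (σ : Store) : Frame c σ σ := ⟨fun _ _ => rfl, fun _ _ => rfl⟩

theorem Frame.trans {σ σ' σ'' : Store} (h : Frame c σ σ') (h' : Frame c σ' σ'') :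
    Frame c σ σ'' :=
  ⟨fun r hr => (h'.reg r hr).trans (h.reg r hr), fun r hr => (h'.arr r hr).trans (h.arr r hr)⟩

theorem Frame.of_imp {σ σ' : Store} (h : Frame c σ σ')
    (hr : ∀ r, d.setsReg r = false → c.setsReg r = false)
    (ha : ∀ r, d.setsArr r = false → c.setsArr r = false) : Frame d σ σ' :=
  ⟨fun r h' => h.reg r (hr r h'), fun r h' => h.arr r (ha r h')⟩

theorem Exec.frame {σ' : Store} {n : ℕ} (h : Exec inp m c σ σ' n) : Frame c σ σ' := by
  induction h with
  | skip => exact .refl _ _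
  | asg σ r e =>
    refine ⟨fun r' h => ?_, fun _ _ => rfl⟩
    rw [Store.setReg_reg, if_neg (by simpa [Cmd.setsReg] using h)]
  | st σ k i e =>
    refine ⟨fun _ _ => rfl, fun k' h => ?_⟩
    rw [Store.setArr_arr, if_neg (by simpa [Cmd.setsArr] using h)]
  | inp σ r e =>
    refine ⟨fun r' h => ?_, fun _ _ => rfl⟩
    rw [Store.setReg_reg, if_neg (by simpa [Cmd.setsReg] using h)]
  | seq _ _ ih₁ ih₂ =>
    exact (ih₁.of_imp (by simp +contextual [Cmd.setsReg]) (by simp +contextual [Cmd.setsArr])).trans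
      (ih₂.of_imp (by simp +contextual [Cmd.setsReg]) (by simp +contextual [Cmd.setsArr]))
  | iteTrue _ _ ih =>
    exact ih.of_imp (by simp +contextual [Cmd.setsReg]) (by simp +contextual [Cmd.setsArr])
  | iteFalse _ _ ih =>
    exact ih.of_imp (by simp +contextual [Cmd.setsReg]) (by simp +contextual [Cmd.setsArr])
  | loopTrue _ _ _ ih₁ ih₂ => exact (ih₁.of_imp (d := .loop _ _) (fun _ h => h) (fun _ h => h)).trans ih₂
  | loopFalse => exact .refl _ _

theorem Runs.frame (h : Runs inp m c σ Q) :
    Runs inp m c σ fun σ' n => Q σ' n ∧ Frame c σ σ' := by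
  obtain ⟨σ', n, h, hQ⟩ := h
  exact ⟨σ', n, h, hQ, h.frame⟩

/-! ### Loops -/

/-- A loop that preserves `I` and pays for its cost with the potential `Φ`. -/
theorem Runs.loop {σ₀ : Store} (I : Store → Prop) (Φ : Store → ℕ)
    (hbody : ∀ σ, Frame c σ₀ σ → I σ → e.eval σ ≠ 0 →
      Runs inp m c σ fun σ' n => I σ' ∧ n + 1 + Φ σ' ≤ Φ σ)
    (h₀ : I σ₀) :
    Runs inp m (.loop e c) σ₀ fun σ' n => I σ' ∧ e.eval σ' = 0 ∧ n + Φ σ' ≤ Φ σ₀ + 1 := by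
  suffices ∀ N σ, Φ σ = N → Frame c σ₀ σ → I σ →
      Runs inp m (.loop e c) σ fun σ' n => I σ' ∧ e.eval σ' = 0 ∧ n + Φ σ' ≤ Φ σ + 1 from
    this _ _ rfl (.refl _ _) h₀
  intro N
  induction N using Nat.strong_induction_on with
  | _ N ih =>
    intro σ hN hF hI
    by_cases he : e.eval σ = 0
    · exact ⟨_, _, .loopFalse he, hI, he, by omega⟩
    · obtain ⟨σ', n, h, ⟨hI', hn⟩, hF'⟩ := (hbody σ hF hI he).frame
      obtain ⟨σ'', n', h', hI'', he', hn'⟩ := ih (Φ σ') (by omega) σ' rfl (hF.trans hF') hI'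
      exact ⟨σ'', n + n' + 1, .loopTrue he h h', hI'', he', by omega⟩

/-- A loop with a counter that goes up to the value of `e`. -/
def Cmd.forUp (r : ℕ) (e : Exp) (c : Cmd) : Cmd :=
  .seq (.asg r 0) (.loop (e - .var r) (.seq c (.asg r (.var r + 1))))

/-- Each round pays for the test and for the increment in addition to its body; the last `2` stands
for the initial assignment and the final test. The bound `e` is evaluated anew in every round, so it
must not depend on what the loop changes. The invariant `I` gets the counter as an argument and must
be insensitive to the register `r`. -/
theorem Runs.forUp {r N : ℕ} (I : ℕ → Store → Prop) (B : ℕ → ℕ)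
    (hr : c.setsReg r = false)
    (he : ∀ σ', Frame (.forUp r e c) σ σ' → e.eval σ' = N)
    (hI : ∀ i σ x, I i σ → I i (σ.setReg r x))
    (hbody : ∀ i < N, ∀ σ', Frame (.forUp r e c) σ σ' → I i σ' → σ'.reg r = i →
      Runs inp m c σ' fun σ'' n => I (i + 1) σ'' ∧ n ≤ B i)
    (h₀ : I 0 σ) :
    Runs inp m (.forUp r e c) σ fun σ' n => I N σ' ∧ n ≤ (∑ i ∈ Finset.range N, (B i + 2)) + 2 := by
  rw [Cmd.forUp, runs_seq, runs_asg]
  have hF : ∀ σ', Frame (.seq c (.asg r (.var r + 1))) (σ.setReg r ((0 : Exp).eval σ)) σ' →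
      Frame (.forUp r e c) σ σ' := fun σ' h =>
    (Exec.frame (inp := inp) (m := m) (.asg σ r 0)).of_imp
      (by simp +contextual [Cmd.setsReg, Cmd.forUp])
      (by simp +contextual [Cmd.setsArr, Cmd.forUp]) |>.trans <| h.of_imp
      (by simp +contextual [Cmd.setsReg, Cmd.forUp])
      (by simp +contextual [Cmd.setsArr, Cmd.forUp])
  refine ((Runs.loop (σ₀ := σ.setReg r ((0 : Exp).eval σ))
    (fun σ' => σ'.reg r ≤ N ∧ I (σ'.reg r) σ' ∧ Frame (.forUp r e c) σ σ')
    (fun σ' => ∑ i ∈ Finset.Ico (σ'.reg r) N, (B i + 2)) ?_ ?_).mono ?_)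
  · rintro σ' hfr ⟨hle, hI', hfr'⟩ hne
    simp only [Exp.eval_sub, Exp.eval_var, he σ' hfr'] at hne
    have hlt : σ'.reg r < N := by omega
    rw [runs_seq]
    refine (hbody _ hlt σ' hfr' hI' rfl).frame.mono ?_
    rintro σ'' n ⟨⟨hI'', hn⟩, hf⟩
    have hreg := hf.reg r hr
    rw [runs_asg]
    simp only [Exp.eval_add, Exp.eval_var, Exp.eval_one, Store.setReg_reg, if_true, hreg]
    refine ⟨⟨hlt, hI _ _ _ hI'', ?_⟩, ?_⟩
    · refine hfr'.trans (.trans (hf.of_imp ?_ ?_)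
        ((Exec.frame (inp := inp) (m := m) (.asg σ'' r (.lit (σ'.reg r + 1)))).of_imp ?_ ?_)) <;>
        simp +contextual [Cmd.setsReg, Cmd.setsArr, Cmd.forUp]
    · rw [Finset.sum_eq_sum_Ico_succ_bot hlt]
      omega
  · refine ⟨by simp, ?_, hF _ (.refl _ _)⟩
    simpa using hI _ _ _ h₀
  · rintro σ' n ⟨⟨hle, hI', hfr⟩, hz, hn⟩
    simp only [Exp.eval_sub, Exp.eval_var, he σ' hfr] at hz
    have : σ'.reg r = N := by omega
    rw [this] at hI'
    refine ⟨hI', ?_⟩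
    simp only [Store.setReg_reg, if_true, Exp.eval_zero, ← Finset.range_eq_Ico] at hn
    omega

/-- A loop with a counter that goes down from the value of `e`. -/
def Cmd.forDown (r : ℕ) (e : Exp) (c : Cmd) : Cmd :=
  .seq (.asg r e) (.loop (.var r) (.seq (.asg r (.var r - 1)) c))

/-- Here the bound is evaluated only once. During the body the counter has already been decreased,
which is why the body turns `I (i + 1)` into `I i` with `i` in the register. -/
theorem Runs.forDown {r N : ℕ} (I : ℕ → Store → Prop) (B : ℕ)
    (hr : c.setsReg r = false) (he : e.eval σ = N)
    (hI : ∀ i σ x, I i σ → I i (σ.setReg r x))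
    (hbody : ∀ i < N, ∀ σ', Frame (.forDown r e c) σ σ' → I (i + 1) σ' → σ'.reg r = i →
      Runs inp m c σ' fun σ'' n => I i σ'' ∧ n ≤ B)
    (h₀ : I N σ) :
    Runs inp m (.forDown r e c) σ fun σ' n => I 0 σ' ∧ n ≤ N * (B + 2) + 2 := by
  rw [Cmd.forDown, runs_seq, runs_asg, he]
  refine ((Runs.loop (σ₀ := σ.setReg r N)
    (fun σ' => σ'.reg r ≤ N ∧ I (σ'.reg r) σ' ∧ Frame (.forDown r e c) σ σ')
    (fun σ' => σ'.reg r * (B + 2)) ?_ ?_).mono ?_)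
  · rintro σ' hfr ⟨hle, hI', hfr'⟩ hne
    rw [Exp.eval_var] at hne
    obtain ⟨i, hi⟩ := Nat.exists_eq_succ_of_ne_zero hne
    rw [runs_seq, runs_asg]
    simp only [Exp.eval_sub, Exp.eval_var, Exp.eval_one, hi, Nat.succ_sub_one]
    have hfs : Frame (.forDown r e c) σ' (σ'.setReg r i) :=
      (Exec.frame (inp := inp) (m := m) (.asg σ' r (.lit i))).of_imp
        (by simp +contextual [Cmd.setsReg, Cmd.forDown])
        (by simp +contextual [Cmd.setsArr, Cmd.forDown])
    rw [hi] at hI' hle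
    refine (hbody i (by omega) _ (hfr'.trans hfs) (hI _ _ _ hI') (by simp)).frame.mono ?_
    rintro σ'' n ⟨⟨hI'', hn⟩, hf⟩
    have hreg := hf.reg r hr
    simp only [Store.setReg_reg, if_true] at hreg
    rw [hreg]
    refine ⟨⟨by omega, hI'', hfr'.trans (hfs.trans (hf.of_imp ?_ ?_))⟩, ?_⟩
    · simp +contextual [Cmd.setsReg, Cmd.forDown]
    · simp +contextual [Cmd.setsArr, Cmd.forDown]
    · rw [Nat.succ_mul]; omega
  · refine ⟨by simp, by simpa using hI _ _ _ h₀, ?_⟩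
    exact (Exec.frame (inp := inp) (m := m) (.asg σ r (.lit N))).of_imp
        (by simp +contextual [Cmd.setsReg, Cmd.forDown])
        (by simp +contextual [Cmd.setsArr, Cmd.forDown])
  · rintro σ' n ⟨⟨hle, hI', hfr⟩, hz, hn⟩
    rw [Exp.eval_var] at hz
    rw [hz] at hI'
    refine ⟨hI', ?_⟩
    simp only [Store.setReg_reg, if_true] at hn
    omega

end RAM
end DetRegex

/-! ### The syntax tree in memory. -/

namespace DetRegex

universe u v

/-! ### The syntax tree as a list of numbers -/

/-- The kind of the root node. -/
def Expr.kind : Expr ℕ ℕ → ℕ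
  | .empty => 0
  | .eps => 1
  | .term _ => 2
  | .ref _ => 3
  | .cat _ _ => 4
  | .alt _ _ => 5
  | .plus _ => 6
  | .bind _ _ => 7

/-- The terminal or variable at the root node. -/
def Expr.arg : Expr ℕ ℕ → ℕ
  | .term a => a
  | .ref x => x
  | .bind x _ => x
  | _ => 0

/-- The syntax tree in prefix order. -/
def Expr.codes : Expr ℕ ℕ → List ℕ
  | .empty => [0, 0]
  | .eps => [1, 0]
  | .term a => [2, a]
  | .ref x => [3, x]
  | .cat β γ => [4, 0] ++ β.codes ++ γ.codes
  | .alt β γ => [5, 0] ++ β.codes ++ γ.codes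
  | .plus β => [6, 0] ++ β.codes
  | .bind x β => [7, x] ++ β.codes

theorem Expr.codes_mapTerm {s : ℕ} (α : Expr (Fin s) ℕ) :
    (α.mapTerm Fin.val).codes = α.encode := by
  induction α <;> simp_all [codes, encode, mapTerm]

theorem Expr.length_codes (α : Expr ℕ ℕ) : α.codes.length = 2 * α.size := by
  induction α <;> simp_all [codes, size] <;> omega

/-- Nodes are numbered in prefix order and take two cells each, so the number of a node gives its
address. -/
theorem Occ.codes {β δ : Expr ℕ ℕ} {i j : ℕ} {k k' : Language (RefSym ℕ ℕ × ℕ)}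
    (h : Occ β i k j δ k') : ∃ l₁ l₂, l₁.length = 2 * (j - i) ∧
      β.codes = l₁ ++ δ.kind :: δ.arg :: l₂ := by
  induction h with
  | here β => cases β <;> exact ⟨[], _, by simp, rfl⟩
  | @catL β γ _ _ _ _ _ h ih =>
    obtain ⟨l₁, l₂, h₁, h₂⟩ := ih
    have := h.bounds
    exact ⟨4 :: 0 :: l₁, l₂ ++ γ.codes, by simp; omega, by simp [Expr.codes, h₂]⟩
  | @catR β γ _ _ _ _ _ h ih =>
    obtain ⟨l₁, l₂, h₁, h₂⟩ := ih
    have := h.bounds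
    exact ⟨4 :: 0 :: β.codes ++ l₁, l₂, by simp [Expr.length_codes]; omega,
      by simp [Expr.codes, h₂]⟩
  | @altL β γ _ _ _ _ _ h ih =>
    obtain ⟨l₁, l₂, h₁, h₂⟩ := ih
    have := h.bounds
    exact ⟨5 :: 0 :: l₁, l₂ ++ γ.codes, by simp; omega, by simp [Expr.codes, h₂]⟩
  | @altR β γ _ _ _ _ _ h ih =>
    obtain ⟨l₁, l₂, h₁, h₂⟩ := ih
    have := h.bounds
    exact ⟨5 :: 0 :: β.codes ++ l₁, l₂, by simp [Expr.length_codes]; omega,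
      by simp [Expr.codes, h₂]⟩
  | plus h ih =>
    obtain ⟨l₁, l₂, h₁, h₂⟩ := ih
    have := h.bounds
    exact ⟨6 :: 0 :: l₁, l₂, by simp; omega, by simp [Expr.codes, h₂]⟩
  | @bind x β _ _ _ _ _ h ih =>
    obtain ⟨l₁, l₂, h₁, h₂⟩ := ih
    have := h.bounds
    exact ⟨7 :: x :: l₁, l₂, by simp; omega, by simp [Expr.codes, h₂]⟩

theorem Occ.codes_getD {β δ : Expr ℕ ℕ} {i j : ℕ} {k k' : Language (RefSym ℕ ℕ × ℕ)}
    (h : Occ β i k j δ k') :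
    β.codes.getD (2 * (j - i)) 0 = δ.kind ∧ β.codes.getD (2 * (j - i) + 1) 0 = δ.arg := by
  obtain ⟨l₁, l₂, h₁, h₂⟩ := h.codes
  rw [h₂, ← h₁]
  simp

/-- There is a node at every index. -/
theorem Expr.exists_occ {A : Type u} {X : Type v} (β : Expr A X) {i j : ℕ} (hi : i ≤ j)
    (hj : j < i + β.size) (k : Language (RefSym A X × ℕ)) :
    ∃ δ k', Occ β i k j δ k' := by
  induction β generalizing i k with
  | cat β γ ihβ ihγ =>
    simp only [size] at hj
    rcases Nat.eq_or_lt_of_le hi with rfl | hi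
    · exact ⟨_, _, .here _ _ _⟩
    · rcases Nat.lt_or_ge j (i + 1 + β.size) with h | h
      · obtain ⟨δ, k', ho⟩ := ihβ (i := i + 1) hi h
          (γ.posLanguage (i + 1 + β.size) * k)
        exact ⟨δ, k', .catL ho⟩
      · obtain ⟨δ, k', ho⟩ := ihγ (i := i + 1 + β.size) h (by omega) k
        exact ⟨δ, k', .catR ho⟩
  | alt β γ ihβ ihγ =>
    simp only [size] at hj
    rcases Nat.eq_or_lt_of_le hi with rfl | hi
    · exact ⟨_, _, .here _ _ _⟩
    · rcases Nat.lt_or_ge j (i + 1 + β.size) with h | h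
      · obtain ⟨δ, k', ho⟩ := ihβ (i := i + 1) hi h k
        exact ⟨δ, k', .altL ho⟩
      · obtain ⟨δ, k', ho⟩ := ihγ (i := i + 1 + β.size) h (by omega) k
        exact ⟨δ, k', .altR ho⟩
  | plus β ih =>
    simp only [size] at hj
    rcases Nat.eq_or_lt_of_le hi with rfl | hi
    · exact ⟨_, _, .here _ _ _⟩
    · obtain ⟨δ, k', ho⟩ := ih (i := i + 1) hi (by omega) _
      exact ⟨δ, k', .plus ho⟩
  | bind x β ih =>
    simp only [size] at hj
    rcases Nat.eq_or_lt_of_le hi with rfl | hi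
    · exact ⟨_, _, .here _ _ _⟩
    · obtain ⟨δ, k', ho⟩ := ih (i := i + 1) hi (by omega) _
      exact ⟨δ, k', .bind ho⟩
  | _ =>
    simp only [size] at hj
    obtain rfl : i = j := by omega
    exact ⟨_, _, .here _ _ _⟩

/-- The arrays `lb` and `la` hold kinds and arguments of the labels of the states. -/
def Coded (lb la : ℕ → ℕ) (β : Expr ℕ ℕ) (i : ℕ) : Prop :=
  ∀ k j δ k', Occ β i k j δ k' → lb (2 * j) = δ.kind ∧ la (2 * j) = δ.arg ∧
    lb (2 * j + 1) = (if δ.kind = 7 then 8 else 0) ∧ la (2 * j + 1) = δ.arg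

/-- The label given by a kind and an argument. -/
def labelOf (lb la : ℕ → ℕ) (v : ℕ) : Option (RefSym ℕ ℕ) :=
  if lb v = 2 then some (.term (la v)) else if lb v = 3 then some (.var (la v))
  else if lb v = 7 then some (.opening (la v)) else if lb v = 8 then some (.closing (la v))
  else none

theorem Coded.isLabelling {lb la : ℕ → ℕ} {β : Expr ℕ ℕ} {i : ℕ} (h : Coded lb la β i) :
    IsLabelling (labelOf lb la) β i := by
  intro k j δ k' ho
  obtain ⟨h₁, h₂, h₃, h₄⟩ := h k j δ k' ho
  cases δ <;> simp_all [LocalLabel, labelOf, Expr.kind, Expr.arg]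

theorem coded_cat_term {lb la : ℕ → ℕ} {α : Expr ℕ ℕ} {e : ℕ}
    (h0 : lb 0 = 4 ∧ la 0 = 0 ∧ lb 1 = 0 ∧ la 1 = 0)
    (hα : ∀ i < α.size, lb (2 + 2 * i) = α.codes.getD (2 * i) 0 ∧
      la (2 + 2 * i) = α.codes.getD (2 * i + 1) 0 ∧
      lb (3 + 2 * i) = (if α.codes.getD (2 * i) 0 = 7 then 8 else 0) ∧
      la (3 + 2 * i) = α.codes.getD (2 * i + 1) 0)
    (he : lb (2 + 2 * α.size) = 2 ∧ la (2 + 2 * α.size) = e ∧ lb (3 + 2 * α.size) = 0 ∧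
      la (3 + 2 * α.size) = e) :
    Coded lb la (α.cat (.term e)) 0 := by
  intro k j δ k' ho
  cases ho with
  | here => simpa [Expr.kind, Expr.arg] using h0
  | catL ho =>
    have hb := ho.bounds
    have hs := δ.size_pos
    obtain ⟨h₁, h₂⟩ := ho.codes_getD
    have := hα (j - 1) (by omega)
    rw [h₁, h₂, show 2 + 2 * (j - 1) = 2 * j by omega,
      show 3 + 2 * (j - 1) = 2 * j + 1 by omega] at this
    exact ⟨this.1, this.2.1, this.2.2.1, this.2.2.2⟩
  | catR ho =>
    cases ho with
    | here =>
      rw [show 2 * (0 + 1 + α.size) = 2 + 2 * α.size by omega,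
        show 2 + 2 * α.size + 1 = 3 + 2 * α.size by omega]
      simpa [Expr.kind, Expr.arg] using he

namespace Decider

open RAM RAM.Exp

/-! ### Names of registers and arrays -/

notation "rOK" => (0 : ℕ)
notation "rS" => (1 : ℕ)
notation "rZ" => (2 : ℕ)
notation "rN" => (3 : ℕ)
notation "rM" => (4 : ℕ)
notation "rJ" => (5 : ℕ)
notation "rK" => (6 : ℕ)
notation "rX" => (7 : ℕ)
notation "rB" => (8 : ℕ)
notation "rP" => (9 : ℕ)
notation "rG" => (10 : ℕ)
notation "rV" => (11 : ℕ)
notation "rU" => (12 : ℕ)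
notation "rD" => (13 : ℕ)
notation "rI" => (14 : ℕ)
notation "rY" => (15 : ℕ)
notation "rC" => (16 : ℕ)
notation "rE" => (17 : ℕ)
notation "aLB" => (0 : Fin 32)
notation "aLA" => (1 : Fin 32)
notation "aW" => (2 : Fin 32)
notation "aSZ" => (3 : Fin 32)
notation "aNU" => (4 : Fin 32)
notation "aF" => (5 : Fin 32)
notation "aNV" => (6 : Fin 32)
notation "aNC" => (7 : Fin 32)
notation "aFS" => (8 : Fin 32)
notation "aFE" => (9 : Fin 32)
notation "aFV" => (10 : Fin 32)
notation "aH" => (11 : Fin 32)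
notation "aRB" => (12 : Fin 32)
notation "aPK" => (13 : Fin 32)
notation "aPX" => (14 : Fin 32)
notation "aPT" => (15 : Fin 32)
notation "aST" => (16 : Fin 32)
notation "aVS" => (17 : Fin 32)
notation "aVE" => (18 : Fin 32)

/-! ### Reading the input -/

/-- Copy the syntax tree of `α` and the word into arrays; add an end marker to both. -/
def copyTree : Cmd :=
  .forUp rJ (var rZ) <| .block [
    .inp rK (3 + (var rJ + var rJ)),
    .st aLB (2 + (var rJ + var rJ)) (var rK),
    .st aLB (3 + (var rJ + var rJ)) (Exp.ite (var rK) 7 8 0),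
    .inp rK (4 + (var rJ + var rJ)),
    .st aLA (2 + (var rJ + var rJ)) (var rK),
    .st aLA (3 + (var rJ + var rJ)) (var rK)]

def copyWord : Cmd :=
  .forUp rJ (var rN) <| .block [
    .inp rK (3 + (var rZ + var rZ) + var rJ), .st aW (var rJ) (var rK)]

/-- The expression `α` takes the nodes from `1` on. Node `0` is the concatenation with the marker,
and the marker is the last node, with the terminal `rS`; hence two more nodes than in the input. The
remaining label cells of these two nodes must be `0` and are not written. -/
def copyInput : Cmd := .block [
  .inp rS 0, .inp rZ 1, .inp rN 2, .asg rM (var rZ + 2), .st aLB 0 4,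
  copyTree,
  .st aLB (2 + (var rZ + var rZ)) 2,
  .st aLA (2 + (var rZ + var rZ)) (var rS),
  .st aLA (3 + (var rZ + var rZ)) (var rS),
  copyWord,
  .st aW (var rN) (var rS),
  .asg rN (var rN + 1)]

variable {inp : ℕ → ℕ} {m z L : ℕ} {σ : Store} {f : ℕ → ℕ}

theorem runs_copyTree (hZ : σ.reg rZ = z) (hm : 3 + 2 * z ≤ m)
    (hf : ∀ i < 2 * z, inp (3 + i) = f i) :
    Runs inp m copyTree σ fun σ' n => n ≤ 8 * z + 2 ∧
      (∀ i < z, σ'.arr aLB (2 + 2 * i) = f (2 * i) ∧ σ'.arr aLA (2 + 2 * i) = f (2 * i + 1) ∧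
        σ'.arr aLB (3 + 2 * i) = (if f (2 * i) = 7 then 8 else 0) ∧
        σ'.arr aLA (3 + 2 * i) = f (2 * i + 1)) ∧
      ∀ v, v < 2 ∨ 2 + 2 * z ≤ v → σ'.arr aLB v = σ.arr aLB v ∧ σ'.arr aLA v = σ.arr aLA v := by
  refine (Runs.forUp (N := z) (fun j σ' =>
      (∀ i < j, σ'.arr aLB (2 + 2 * i) = f (2 * i) ∧ σ'.arr aLA (2 + 2 * i) = f (2 * i + 1) ∧
        σ'.arr aLB (3 + 2 * i) = (if f (2 * i) = 7 then 8 else 0) ∧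
        σ'.arr aLA (3 + 2 * i) = f (2 * i + 1)) ∧
      ∀ v, v < 2 ∨ 2 + 2 * j ≤ v → σ'.arr aLB v = σ.arr aLB v ∧ σ'.arr aLA v = σ.arr aLA v)
      (fun _ => 6) rfl ?_ (fun _ _ _ h => h) ?_ ?_).mono ?_
  · intro σ' hF
    simpa using (hF.reg rZ rfl).trans hZ
  · rintro j hj σ' hF ⟨h₁, h₂⟩ hJ
    have i₁ := hf (2 * j) (by omega)
    have i₂ := hf (2 * j + 1) (by omega)
    rw [show 3 + (2 * j + 1) = 4 + 2 * j by omega] at i₂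
    simp [hJ, ← Nat.two_mul, i₁, i₂]
    refine ⟨by omega, by omega, ?_, ?_⟩
    · intro i hi
      rcases Nat.lt_or_eq_of_le hi with hi | rfl
      · obtain ⟨a, b, c, d⟩ := h₁ i hi
        simp (disch := omega) [a, b, c, d]
      · simp (disch := omega)
    · intro v hv
      have := h₂ v (by omega)
      simp (disch := omega) [this]
  · simp
  · rintro σ' n ⟨⟨h₁, h₂⟩, hn⟩
    refine ⟨?_, h₁, h₂⟩
    simp at hn; omega

theorem runs_copyWord (hZ : σ.reg rZ = z) (hN : σ.reg rN = L) (hm : 3 + 2 * z + L ≤ m) :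
    Runs inp m copyWord σ fun σ' n => n ≤ 4 * L + 2 ∧
      ∀ i < L, σ'.arr aW i = inp (3 + 2 * z + i) := by
  refine (Runs.forUp (N := L) (fun j σ' => ∀ i < j, σ'.arr aW i = inp (3 + 2 * z + i))
      (fun _ => 2) rfl ?_ (fun _ _ _ h => h) ?_ ?_).mono ?_
  · intro σ' hF
    simpa using (hF.reg rN rfl).trans hN
  · rintro j hj σ' hF h₁ hJ
    have hZ' := (hF.reg rZ rfl).trans hZ
    simp [hJ, hZ', ← Nat.two_mul]
    refine ⟨by omega, ?_⟩
    intro i hi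
    rcases Nat.lt_or_eq_of_le hi with hi | rfl
    · simp (disch := omega) [h₁]
    · simp
  · simp
  · rintro σ' n ⟨h₁, hn⟩
    refine ⟨?_, h₁⟩
    simp at hn; omega

/-- The arrays hold the expression `β`, and the word `w`. -/
structure Loaded (σ : Store) (s : ℕ) (β : Expr ℕ ℕ) (w : List ℕ) : Prop where
  alphabet : σ.reg rS = s
  size : σ.reg rM = β.size
  length : σ.reg rN = w.length
  coded : Coded (σ.arr aLB) (σ.arr aLA) β 0
  word : ∀ i < w.length, σ.arr aW i = w.getD i 0

theorem runs_copyInput {s : ℕ} {α : Expr ℕ ℕ} {w : List ℕ} (hσ : ∀ k i, σ.arr k i = 0)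
    (hinp : ∀ i, inp i = ([s, α.size, w.length] ++ α.codes ++ w).getD i 0)
    (hm : m = 3 + 2 * α.size + w.length) :
    Runs inp m copyInput σ fun σ' n => n ≤ 8 * α.size + 4 * w.length + 14 ∧
      Loaded σ' s (α.cat (.term s)) (w ++ [s]) := by
  have i0 : inp 0 = s := by rw [hinp]; rfl
  have i1 : inp 1 = α.size := by rw [hinp]; rfl
  have i2 : inp 2 = w.length := by rw [hinp]; rfl
  have i3 : ∀ i < 2 * α.size, inp (3 + i) = α.codes.getD i 0 := by
    intro i hi
    rw [hinp, List.append_assoc, List.getD_append_right _ _ _ _ (by simp),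
      List.getD_append _ _ _ _ (by simpa [Expr.length_codes] using hi)]
    simp
  have i4 : ∀ i, inp (3 + 2 * α.size + i) = w.getD i 0 := by
    intro i
    rw [hinp, List.getD_append_right _ _ _ _ (by simp [Expr.length_codes]; omega)]
    congr 1
    simp [Expr.length_codes]; omega
  unfold copyInput
  simp only [runs_block_cons, runs_inp, runs_asg, runs_st, runs_block_nil]
  simp [i0, i1, i2]
  refine ⟨by omega, by omega, by omega, ?_⟩
  refine (runs_copyTree (z := α.size) (by simp) (by omega) i3).frame.mono ?_
  rintro σ₁ n₁ ⟨⟨hn₁, h₁, h₂⟩, hF₁⟩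
  have r₁ := hF₁.reg rS rfl
  have r₂ := hF₁.reg rZ rfl
  have r₃ := hF₁.reg rN rfl
  have r₄ := hF₁.reg rM rfl
  simp at r₁ r₂ r₃ r₄
  refine (runs_copyWord (z := α.size) (L := w.length) (by simpa) (by simpa) (by omega)).frame.mono ?_
  rintro σ₂ n₂ ⟨⟨hn₂, h₃⟩, hF₂⟩
  have q₁ := hF₂.reg rS rfl
  have q₃ := hF₂.reg rN rfl
  have q₄ := hF₂.reg rM rfl
  have q₅ := hF₂.arr aLB rfl
  have q₆ := hF₂.arr aLA rfl
  simp [r₁, r₂, r₃, r₄, ← Nat.two_mul] at q₁ q₃ q₄ q₅ q₆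
  refine ⟨by omega, ?_, ?_, ?_, ?_, ?_⟩
  · simp [q₁]
  · simp [q₄, Expr.size]
  · simp [q₃]
  · simp only [Store.setReg_arr, Store.setArr_arr]
    simp [q₅, q₆]
    refine coded_cat_term ?_ ?_ ?_
    · have a := h₂ 0 (by omega)
      have b := h₂ 1 (by omega)
      simp [hσ] at a b
      simp (disch := omega) [a, b]
    · intro i hi
      have := h₁ i hi
      simp only [Function.update_apply]
      simp (disch := omega) only [if_neg]
      exact this
    · have a := h₂ (2 + 2 * α.size) (by omega)
      have b := h₂ (3 + 2 * α.size) (by omega)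
      simp (disch := omega) [hσ] at a b
      simp (disch := omega) [b]
  · intro i hi
    simp at hi
    simp [q₃, q₁]
    rcases Nat.lt_or_eq_of_le hi with hi | rfl
    · rw [Function.update_of_ne (by omega), h₃ i hi, i4, List.getElem?_append_left hi]
      simp
    · simp

end Decider
end DetRegex

/-! ### Computing sizes, first letters and tables in linear time. -/

namespace DetRegex

universe u v

section Sequences

variable {A : Type u} {X : Type v} {Q : RefSym A X → Bool} {β γ δ : Expr A X} {nx nx' : ℕ → ℕ}
  {i j : ℕ}

/-- The states whose table entries are computed at a node. -/
def Touches (j v : ℕ) : Expr A X → Prop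
  | .cat β _ => v = 2 * j ∨ v = 2 * (j + 1) + 1 ∨ v = 2 * (j + 1 + β.size) + 1
  | .alt β _ => v = 2 * j ∨ v = 2 * (j + 1) + 1 ∨ v = 2 * (j + 1 + β.size) + 1
  | .plus _ => v = 2 * j ∨ v = 2 * (j + 1) + 1
  | .bind _ _ => v = 2 * j ∨ v = 2 * (j + 1) + 1
  | _ => v = 2 * j

theorem Touches.lt {v : ℕ} (h : Touches j v δ ∨ v = 2 * j + 1) : v < 2 * (j + δ.size) := by
  cases δ with
  | cat β γ | alt β γ =>
    have := γ.size_pos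
    simp only [Touches, Expr.size] at *
    omega
  | plus β | bind x β =>
    have := β.size_pos
    simp only [Touches, Expr.size] at *
    omega
  | _ => simp only [Touches, Expr.size] at *; omega

theorem LocalTable.congr (h : LocalTable Q nx j δ)
    (he : ∀ v, Touches j v δ ∨ v = 2 * j + 1 → nx' v = nx v) : LocalTable Q nx' j δ := by
  cases δ <;> simp_all [LocalTable, Touches, exitTarget, enterValue]

/-- The entries at node `j` are filled in. -/
def FillsIn (Q : RefSym A X → Bool) (j : ℕ) (δ : Expr A X) (nx nx' : ℕ → ℕ) : Prop :=
  LocalTable Q nx' j δ ∧ ∀ v, ¬ Touches j v δ → nx' v = nx v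

/-- Here `t j` is the table just before node `j` is treated. Each entry is written once: the one in
front of a node by the node itself, the one behind it by its parent, that is, earlier. Hence nothing
that was used at a node changes later, and the final table satisfies all local conditions at once.
-/
theorem isTable_of_fillsIn (t : ℕ → ℕ → ℕ)
    (h : ∀ k j δ k', Occ β i k j δ k' → FillsIn Q j δ (t j) (t (j + 1))) :
    IsTable Q (t (i + β.size)) β i ∧
      ∀ v, v < 2 * i ∨ 2 * (i + β.size) ≤ v ∨ v = 2 * i + 1 → t (i + β.size) v = t i v := by
  induction β generalizing i with
  | cat β γ ihβ ihγ =>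
    obtain ⟨hl, hf⟩ := h 1 _ _ _ (.here _ _ _)
    obtain ⟨tβ, fβ⟩ := ihβ (i := i + 1) fun k j δ k' ho =>
      h 1 j δ _ (.catL (ho.change _).choose_spec)
    obtain ⟨tγ, fγ⟩ := ihγ (i := i + 1 + β.size) fun k j δ k' ho =>
      h 1 j δ _ (.catR (ho.change _).choose_spec)
    have hs := β.size_pos
    have hs' := γ.size_pos
    have e : i + (β.cat γ).size = i + 1 + β.size + γ.size := by simp only [Expr.size]; omega
    rw [e]
    refine ⟨?_, fun v hv => ?_⟩
    · intro k j δ k' ho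
      cases ho with
      | here =>
        refine hl.congr fun v hv => ?_
        simp only [Touches] at hv
        rw [fγ v (by omega), fβ v (by omega)]
      | catL ho =>
        refine (tβ _ _ _ _ ho).congr fun v hv => ?_
        have := ho.bounds
        have := Touches.lt hv
        rw [fγ v (by omega)]
      | catR ho => exact tγ _ _ _ _ ho
    · rw [fγ v (by omega), fβ v (by omega), hf v (by simp only [Touches]; omega)]
  | alt β γ ihβ ihγ =>
    obtain ⟨hl, hf⟩ := h 1 _ _ _ (.here _ _ _)
    obtain ⟨tβ, fβ⟩ := ihβ (i := i + 1) fun k j δ k' ho =>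
      h 1 j δ _ (.altL (ho.change _).choose_spec)
    obtain ⟨tγ, fγ⟩ := ihγ (i := i + 1 + β.size) fun k j δ k' ho =>
      h 1 j δ _ (.altR (ho.change _).choose_spec)
    have hs := β.size_pos
    have hs' := γ.size_pos
    have e : i + (β.alt γ).size = i + 1 + β.size + γ.size := by simp only [Expr.size]; omega
    rw [e]
    refine ⟨?_, fun v hv => ?_⟩
    · intro k j δ k' ho
      cases ho with
      | here =>
        refine hl.congr fun v hv => ?_
        simp only [Touches] at hv
        rw [fγ v (by omega), fβ v (by omega)]
      | altL ho =>
        refine (tβ _ _ _ _ ho).congr fun v hv => ?_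
        have := ho.bounds
        have := Touches.lt hv
        rw [fγ v (by omega)]
      | altR ho => exact tγ _ _ _ _ ho
    · rw [fγ v (by omega), fβ v (by omega), hf v (by simp only [Touches]; omega)]
  | plus β ih =>
    obtain ⟨hl, hf⟩ := h 1 _ _ _ (.here _ _ _)
    obtain ⟨tβ, fβ⟩ := ih (i := i + 1) fun k j δ k' ho =>
      h 1 j δ _ (.plus (ho.change _).choose_spec)
    have hs := β.size_pos
    have e : i + (β.plus).size = i + 1 + β.size := by simp only [Expr.size]; omega
    rw [e]
    refine ⟨?_, fun v hv => ?_⟩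
    · intro k j δ k' ho
      cases ho with
      | here =>
        refine hl.congr fun v hv => ?_
        simp only [Touches] at hv
        rw [fβ v (by omega)]
      | plus ho => exact tβ _ _ _ _ ho
    · rw [fβ v (by omega), hf v (by simp only [Touches]; omega)]
  | bind x β ih =>
    obtain ⟨hl, hf⟩ := h 1 _ _ _ (.here _ _ _)
    obtain ⟨tβ, fβ⟩ := ih (i := i + 1) fun k j δ k' ho =>
      h 1 j δ _ (.bind (ho.change _).choose_spec)
    have hs := β.size_pos
    have e : i + (β.bind x).size = i + 1 + β.size := by simp only [Expr.size]; omega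
    rw [e]
    refine ⟨?_, fun v hv => ?_⟩
    · intro k j δ k' ho
      cases ho with
      | here =>
        refine hl.congr fun v hv => ?_
        simp only [Touches] at hv
        rw [fβ v (by omega)]
      | bind ho => exact tβ _ _ _ _ ho
    · rw [fβ v (by omega), hf v (by simp only [Touches]; omega)]
  | _ =>
    obtain ⟨hl, hf⟩ := h 1 _ _ _ (.here _ _ _)
    refine ⟨?_, fun v hv => hf v (by simp only [Touches, Expr.size] at hv ⊢; omega)⟩
    intro k j δ k' ho
    cases ho with
    | here => exact hl

end Sequences

namespace Decider

open RAM RAM.Exp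

/-! ### Sizes, nullability, first letters -/

/-- Children have larger numbers than their parent, so the nodes are treated backwards. The second
child is found by means of the size of the first; at nodes without children `rI` and `rY` hold
numbers that are not used. -/
def computeSizes : Cmd :=
  .forDown rJ (var rM) <| .block [
    .asg rK (rd aLB (var rJ + var rJ)),
    .asg rI (var rJ + 1),
    .asg rY (var rI + rd aSZ (var rI)),
    .st aSZ (var rJ) (
      Exp.ite (var rK) 4 (rd aSZ (var rI) + rd aSZ (var rY) + 1) <|
      Exp.ite (var rK) 5 (rd aSZ (var rI) + rd aSZ (var rY) + 1) <|
      Exp.ite (var rK) 6 (rd aSZ (var rI) + 1) <|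
      Exp.ite (var rK) 7 (rd aSZ (var rI) + 1) 1),
    .st aNU (var rJ) (
      Exp.ite (var rK) 4 (Exp.ite (rd aNU (var rI)) 0 0 (rd aNU (var rY))) <|
      Exp.ite (var rK) 5 (rd aNU (var rI) + rd aNU (var rY)) <|
      Exp.ite (var rK) 6 (rd aNU (var rI)) <|
      Exp.ite (var rK) 7 (rd aNU (var rI)) <|
      Exp.ite (var rK) 1 1 0)]

def computeFirst : Cmd :=
  .forDown rJ (var rM) <| .block [
    .asg rK (rd aLB (var rJ + var rJ)),
    .asg rI (var rJ + 1),
    .asg rY (var rI + rd aSZ (var rI)),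
    .st aF (var rJ) (
      Exp.ite (var rK) 4 (Exp.ite (rd aNU (var rI)) 0 (rd aF (var rI))
        (rd aF (var rI) + rd aF (var rY))) <|
      Exp.ite (var rK) 5 (rd aF (var rI) + rd aF (var rY)) <|
      Exp.ite (var rK) 6 (rd aF (var rI)) <|
      Exp.ite (var rK) 7 (rd aF (var rI)) <|
      Exp.ite (var rK) 2 (Exp.ite (rd aLA (var rJ + var rJ)) (var rX) 1 0) <|
      Exp.ite (var rK) 3 (Exp.ite (var rX) (var rS + 1) 1 0) 0)]

variable {inp : ℕ → ℕ} {m s : ℕ} {σ : Store} {β : Expr ℕ ℕ} {w : List ℕ}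

/-- The arrays hold sizes and nullability of the subexpressions. -/
structure Sized (σ : Store) (β : Expr ℕ ℕ) : Prop where
  size : ∀ j δ k', Occ β 0 1 j δ k' → σ.arr aSZ j = δ.size
  nu : ∀ j δ k', Occ β 0 1 j δ k' → σ.arr aNU j = δ.nu

theorem runs_computeSizes (h : Loaded σ s β w) :
    Runs inp m computeSizes σ fun σ' n => n ≤ 7 * β.size + 2 ∧ Sized σ' β := by
  refine (Runs.forDown (N := β.size) (fun i σ' => ∀ j δ k', i ≤ j → Occ β 0 1 j δ k' →
    σ'.arr aSZ j = δ.size ∧ σ'.arr aNU j = δ.nu) 5 rfl (by simpa using h.size)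
    (fun _ _ _ h => h) ?_ ?_).mono ?_
  · rintro i hi σ' hF hI hJ
    obtain ⟨δ, k', ho⟩ := β.exists_occ (Nat.zero_le i) (by omega) 1
    have hK : σ'.arr aLB (2 * i) = δ.kind := by
      rw [hF.arr aLB rfl]; exact (h.coded _ _ _ _ ho).1
    simp [hJ, ← Nat.two_mul, hK]
    intro j δ' k'' hj ho'
    have hs := δ.size_pos
    rcases Nat.eq_or_lt_of_le hj with rfl | hj
    · obtain ⟨rfl, rfl⟩ := ho.unique ho'
      simp
      cases δ with
      | cat β₁ β₂ =>
        obtain ⟨a₁, b₁⟩ := hI (i + 1) β₁ _ (by omega) (ho.trans (.catL (.here _ _ _)))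
        obtain ⟨a₂, b₂⟩ := hI (i + 1 + β₁.size) β₂ _ (by omega) (ho.trans (.catR (.here _ _ _)))
        simp [Expr.kind, Expr.size, Expr.nu, a₁, b₁, a₂, b₂]
      | alt β₁ β₂ =>
        obtain ⟨a₁, b₁⟩ := hI (i + 1) β₁ _ (by omega) (ho.trans (.altL (.here _ _ _)))
        obtain ⟨a₂, b₂⟩ := hI (i + 1 + β₁.size) β₂ _ (by omega) (ho.trans (.altR (.here _ _ _)))
        simp [Expr.kind, Expr.size, Expr.nu, a₁, b₁, a₂, b₂]
      | plus β₁ =>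
        obtain ⟨a₁, b₁⟩ := hI (i + 1) β₁ _ (by omega) (ho.trans (.plus (.here _ _ _)))
        simp [Expr.kind, Expr.size, Expr.nu, a₁, b₁]
      | bind x β₁ =>
        obtain ⟨a₁, b₁⟩ := hI (i + 1) β₁ _ (by omega) (ho.trans (.bind (.here _ _ _)))
        simp [Expr.kind, Expr.size, Expr.nu, a₁, b₁]
      | _ => simp [Expr.kind, Expr.size, Expr.nu]
    · have := hI j δ' k'' hj ho'
      simp (disch := omega) [this]
  · intro j δ k' hj ho
    have := ho.bounds
    have := δ.size_pos
    omega
  · rintro σ' n ⟨hI, hn⟩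
    exact ⟨by omega, ⟨fun j δ k' ho => (hI j δ k' (by omega) ho).1,
      fun j δ k' ho => (hI j δ k' (by omega) ho).2⟩⟩

/-- The class of letters `Q` has the number `χ`. -/
structure IsClass (Q : RefSym ℕ ℕ → Bool) (β : Expr ℕ ℕ) (s χ : ℕ) : Prop where
  term : ∀ j a k', Occ β 0 1 j (.term a) k' → (Q (.term a) ↔ a = χ)
  var : ∀ x, Q (.var x) ↔ χ = s + 1

variable {Q : RefSym ℕ ℕ → Bool} {χ : ℕ}

theorem runs_computeFirst (h : Loaded σ s β w) (hs : Sized σ β) (hQ : IsClass Q β s χ)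
    (hX : σ.reg rX = χ) :
    Runs inp m computeFirst σ fun σ' n => n ≤ 6 * β.size + 2 ∧
      ∀ j δ k', Occ β 0 1 j δ k' → σ'.arr aF j = δ.first Q := by
  refine (Runs.forDown (N := β.size) (fun i σ' => ∀ j δ k', i ≤ j → Occ β 0 1 j δ k' →
    σ'.arr aF j = δ.first Q) 4 rfl (by simpa using h.size)
    (fun _ _ _ h => h) ?_ ?_).mono ?_
  · rintro i hi σ' hF hI hJ
    obtain ⟨δ, k', ho⟩ := β.exists_occ (Nat.zero_le i) (by omega) 1
    have hK : σ'.arr aLB (2 * i) = δ.kind := by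
      rw [hF.arr aLB rfl]; exact (h.coded _ _ _ _ ho).1
    have hA : σ'.arr aLA (2 * i) = δ.arg := by
      rw [hF.arr aLA rfl]; exact (h.coded _ _ _ _ ho).2.1
    have hSZ := hs.size
    have hNU := hs.nu
    rw [← hF.arr aSZ rfl] at hSZ
    rw [← hF.arr aNU rfl] at hNU
    have hX' : σ'.reg rX = χ := (hF.reg rX rfl).trans hX
    have hS' : σ'.reg rS = s := (hF.reg rS rfl).trans h.alphabet
    simp [hJ, ← Nat.two_mul, hK, hA, hX', hS']
    intro j δ' k'' hj ho'
    have hs := δ.size_pos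
    rcases Nat.eq_or_lt_of_le hj with rfl | hj
    · obtain ⟨rfl, rfl⟩ := ho.unique ho'
      simp
      cases δ with
      | cat β₁ β₂ =>
        have o₁ := ho.trans (.catL (.here _ _ _))
        have o₂ := ho.trans (.catR (.here _ _ _))
        simp [Expr.kind, Expr.first, hSZ _ _ _ o₁, hNU _ _ _ o₁, hI _ _ _ (by omega) o₁,
          hI _ _ _ (by omega) o₂]
      | alt β₁ β₂ =>
        have o₁ := ho.trans (.altL (.here _ _ _))
        have o₂ := ho.trans (.altR (.here _ _ _))
        simp [Expr.kind, Expr.first, hSZ _ _ _ o₁, hI _ _ _ (by omega) o₁,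
          hI _ _ _ (by omega) o₂]
      | plus β₁ =>
        have o₁ := ho.trans (.plus (.here _ _ _))
        simp [Expr.kind, Expr.first, hI _ _ _ (by omega) o₁]
      | bind x β₁ =>
        have o₁ := ho.trans (.bind (.here _ _ _))
        simp [Expr.kind, Expr.first, hI _ _ _ (by omega) o₁]
      | term a => simp [Expr.kind, Expr.first, Expr.arg, hQ.term _ _ _ ho]; congr
      | ref x => simp [Expr.kind, Expr.first, hQ.var]
      | _ => simp [Expr.kind, Expr.first]
    · have := hI j δ' k'' hj ho'
      simp (disch := omega) [this]
  · intro j δ k' hj ho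
    have := ho.bounds
    have := δ.size_pos
    omega
  · rintro σ' n ⟨hI, hn⟩
    exact ⟨by omega, fun j δ k' ho => hI j δ k' (by omega) ho⟩

/-! ### Tables -/

/-- The value of `enterValue` at the node in register `r`. -/
def enterExp (r : ℕ) : Exp :=
  rd aF (var r) + Exp.ite (rd aNU (var r)) 0 0 (rd aNC (var r + var r + 1))

/-- The nodes are treated forwards, since the entry behind a node comes from its parent. At one node
the entries behind the children precede the entry in front, and the second child precedes the first,
in the order in which they are needed. Old values in the array are overwritten before they are read.
-/
def computeTable : Cmd := .block [
  .st aNC 1 0,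
  .forUp rJ (var rM) <| .block [
    .asg rK (rd aLB (var rJ + var rJ)),
    .asg rI (var rJ + 1),
    .asg rY (var rI + rd aSZ (var rI)),
    .asg rU (Exp.ite (rd aNC (var rJ + var rJ + 1)) 0 0 (var rJ + var rJ + 1)),
    .ifEq (var rK) 4 (.block [
      .st aNC (var rY + var rY + 1) (var rU),
      .st aNC (var rI + var rI + 1) (Exp.ite (enterExp rY) 0 0 (var rY + var rY)),
      .st aNC (var rJ + var rJ) (Exp.ite (enterExp rI) 0 0 (var rI + var rI))]) <|
    .ifEq (var rK) 5 (.block [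
      .st aNC (var rY + var rY + 1) (var rU),
      .st aNC (var rI + var rI + 1) (var rU),
      .st aNC (var rJ + var rJ) <|
        Exp.ite (rd aF (var rI)) 0 (
        Exp.ite (rd aF (var rY)) 0 (
        Exp.ite (enterExp rI) 0 (
        Exp.ite (enterExp rY) 0 0 (var rY + var rY)) (var rI + var rI)) (var rY + var rY))
        (var rI + var rI)]) <|
    .ifEq (var rK) 6 (.block [
      .st aNC (var rI + var rI + 1) (Exp.ite (rd aF (var rI)) 0 (var rU) (var rI + var rI)),
      .st aNC (var rJ + var rJ) (Exp.ite (enterExp rI) 0 0 (var rI + var rI))]) <|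
    .ifEq (var rK) 7 (.block [
      .st aNC (var rI + var rI + 1) (var rU),
      .st aNC (var rJ + var rJ) (Exp.ite (enterExp rI) 0 0 (var rI + var rI))]) <|
    .ifEq (var rK) 0 (.st aNC (var rJ + var rJ) 0) <|
    .ifEq (var rK) 1 (.st aNC (var rJ + var rJ) (var rU)) <|
    .st aNC (var rJ + var rJ) (Exp.ite (rd aF (var rJ)) 0 0 (var rJ + var rJ + 1))]]

set_option maxHeartbeats 1000000 in
theorem runs_computeTable (h : Loaded σ s β w) (hs : Sized σ β)
    (hf : ∀ j δ k', Occ β 0 1 j δ k' → σ.arr aF j = δ.first Q) :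
    Runs inp m computeTable σ fun σ' n => n ≤ 16 * β.size + 3 ∧
      IsTable Q (σ'.arr aNC) β 0 ∧ σ'.arr aNC 1 = 0 := by
  rw [computeTable]
  simp only [runs_block_cons, runs_st, runs_block_nil]
  refine (Runs.forUp (N := β.size) (fun i σ' => ∃ t : ℕ → ℕ → ℕ, t i = σ'.arr aNC ∧ t 0 1 = 0 ∧
    ∀ j < i, ∀ δ k', Occ β 0 1 j δ k' → FillsIn Q j δ (t j) (t (j + 1)))
    (fun _ => 14) rfl ?_ (fun _ _ _ h => h) ?_ ?_).mono ?_
  · intro σ' hF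
    have := hF.reg rM rfl
    simpa [h.size] using this
  · rintro i hi σ' hF ⟨t, ht, ht0, hI⟩ hJ
    obtain ⟨δ, k', ho⟩ := β.exists_occ (Nat.zero_le i) (by omega) 1
    have hK : σ'.arr aLB (2 * i) = δ.kind := by
      rw [hF.arr aLB rfl]; exact (h.coded _ _ _ _ ho).1
    have hSZ := hs.size
    have hNU := hs.nu
    have e₁ := hF.arr aSZ rfl
    have e₂ := hF.arr aNU rfl
    have e₃ := hF.arr aF rfl
    simp at e₁ e₂ e₃
    rw [← e₁] at hSZ
    rw [← e₂] at hNU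
    have hf' := hf
    rw [← e₃] at hf'
    -- The tables of all past moments are kept as a sequence, which is prolonged by the table after
    -- node `i`.
    have key : ∀ nx, FillsIn Q i δ (σ'.arr aNC) nx →
        ∃ t : ℕ → ℕ → ℕ, t (i + 1) = nx ∧ t 0 1 = 0 ∧
          ∀ j ≤ i, ∀ δ k', Occ β 0 1 j δ k' → FillsIn Q j δ (t j) (t (j + 1)) := by
      intro nx hfill
      refine ⟨Function.update t (i + 1) nx, by simp, ?_, ?_⟩
      · simp [ht0]
      · intro j hj δ' k'' ho'
        rcases Nat.lt_or_eq_of_le hj with hj | rfl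
        · rw [Function.update_of_ne (by omega), Function.update_of_ne (by omega)]
          exact hI j hj δ' k'' ho'
        · obtain ⟨rfl, -⟩ := ho.unique ho'
          rw [Function.update_of_ne (by omega), Function.update_self, ht]
          exact hfill
    simp only [runs_block_cons, runs_asg, runs_block_nil, runs_ifEq, runs_st]
    simp only [enterExp, Exp.eval_add, Exp.eval_rd, Exp.eval_var, Exp.eval_ite,
      Exp.eval_ofNat, Store.setReg_reg, Store.setReg_arr]
    cases δ with
    | cat β₁ β₂ =>
      have o₁ := ho.trans (.catL (.here _ _ _))
      have o₂ := ho.trans (.catR (.here _ _ _))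
      have s₁ := β₁.size_pos
      simp [hJ, ← Nat.two_mul, hK, Expr.kind, hSZ _ _ _ o₁, hNU _ _ _ o₁, hNU _ _ _ o₂,
        hf' _ _ _ o₁, hf' _ _ _ o₂]
      refine key _ ?_
      refine ⟨⟨?_, ?_, ?_⟩, ?_⟩
      · simp (disch := omega) [exitTarget]
      · simp (disch := omega) [enterValue]
      · simp (disch := omega) [enterValue]
      · intro v hv
        simp only [Touches, not_or] at hv
        simp (disch := omega)
    | alt β₁ β₂ =>
      have o₁ := ho.trans (.altL (.here _ _ _))
      have o₂ := ho.trans (.altR (.here _ _ _))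
      have s₁ := β₁.size_pos
      simp [hJ, ← Nat.two_mul, hK, Expr.kind, hSZ _ _ _ o₁, hNU _ _ _ o₁, hNU _ _ _ o₂,
        hf' _ _ _ o₁, hf' _ _ _ o₂]
      refine key _ ?_
      refine ⟨⟨?_, ?_, ?_⟩, ?_⟩
      · simp (disch := omega) [exitTarget]
      · simp (disch := omega) [exitTarget]
      · simp (disch := omega) [enterValue]
        split_ifs <;> simp_all
      · intro v hv
        simp only [Touches, not_or] at hv
        simp (disch := omega)
    | plus β₁ =>
      have o₁ := ho.trans (.plus (.here _ _ _))
      have s₁ := β₁.size_pos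
      simp [hJ, ← Nat.two_mul, hK, Expr.kind, hNU _ _ _ o₁, hf' _ _ _ o₁]
      refine key _ ?_
      refine ⟨⟨?_, ?_⟩, ?_⟩
      · simp (disch := omega) [exitTarget]
      · simp (disch := omega) [enterValue]
      · intro v hv
        simp only [Touches, not_or] at hv
        simp (disch := omega)
    | bind x β₁ =>
      have o₁ := ho.trans (.bind (.here _ _ _))
      have s₁ := β₁.size_pos
      simp [hJ, ← Nat.two_mul, hK, Expr.kind, hNU _ _ _ o₁, hf' _ _ _ o₁]
      refine key _ ?_
      refine ⟨⟨?_, ?_⟩, ?_⟩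
      · simp (disch := omega) [exitTarget]
      · simp (disch := omega) [enterValue]
      · intro v hv
        simp only [Touches, not_or] at hv
        simp (disch := omega)
    | empty =>
      simp [hJ, ← Nat.two_mul, hK, Expr.kind]
      refine key _ ?_
      refine ⟨by simp [LocalTable], ?_⟩
      intro v hv
      simp only [Touches] at hv
      simp (disch := omega)
    | eps =>
      simp [hJ, ← Nat.two_mul, hK, Expr.kind]
      refine key _ ?_
      refine ⟨by simp (disch := omega) [LocalTable, exitTarget], ?_⟩
      intro v hv
      simp only [Touches] at hv
      simp (disch := omega)
    | term a =>
      simp [hJ, ← Nat.two_mul, hK, Expr.kind, hf' _ _ _ ho]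
      refine key _ ?_
      refine ⟨by simp [LocalTable], ?_⟩
      intro v hv
      simp only [Touches] at hv
      simp (disch := omega)
    | ref a =>
      simp [hJ, ← Nat.two_mul, hK, Expr.kind, hf' _ _ _ ho]
      refine key _ ?_
      refine ⟨by simp [LocalTable], ?_⟩
      intro v hv
      simp only [Touches] at hv
      simp (disch := omega)
  · exact ⟨fun _ => Function.update (σ.arr aNC) 1 0, by simp, by simp, by simp⟩
  · rintro σ' n ⟨⟨t, ht, ht0, hI⟩, hn⟩
    obtain ⟨h₁, h₂⟩ := isTable_of_fillsIn (β := β) (i := 0) (Q := Q) t fun k j δ k' ho => by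
      have := ho.bounds
      have := δ.size_pos
      exact hI j (by omega) δ _ (ho.change 1).choose_spec
    rw [Nat.zero_add, ht] at h₁ h₂
    refine ⟨?_, h₁, ?_⟩
    · simp at hn; omega
    · rw [h₂ 1 (by omega), ht0]

/-! ### The table of variables -/

/-- The table of the class in register `rX`. -/
def computeRow : Cmd := .seq computeFirst computeTable

theorem runs_computeRow (h : Loaded σ s β w) (hs : Sized σ β) (hQ : IsClass Q β s χ)
    (hX : σ.reg rX = χ) :
    Runs inp m computeRow σ fun σ' n => n ≤ 22 * β.size + 5 ∧
      IsTable Q (σ'.arr aNC) β 0 ∧ σ'.arr aNC 1 = 0 := by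
  rw [computeRow, runs_seq]
  refine (runs_computeFirst h hs hQ hX).frame.mono ?_
  rintro σ₁ n₁ ⟨⟨hn₁, h₁⟩, hF⟩
  have hl : Loaded σ₁ s β w := by
    refine ⟨?_, ?_, ?_, ?_, ?_⟩
    · rw [hF.reg rS rfl, h.alphabet]
    · rw [hF.reg rM rfl, h.size]
    · rw [hF.reg rN rfl, h.length]
    · rw [hF.arr aLB rfl, hF.arr aLA rfl]; exact h.coded
    · rw [hF.arr aW rfl]; exact h.word
  have hs₁ : Sized σ₁ β := by
    refine ⟨?_, ?_⟩
    · rw [hF.arr aSZ rfl]; exact hs.size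
    · rw [hF.arr aNU rfl]; exact hs.nu
  refine (runs_computeTable hl hs₁ h₁).mono ?_
  rintro σ₂ n₂ ⟨hn₂, h₂⟩
  exact ⟨by omega, h₂⟩

end Decider
end DetRegex

/-! ### Compressed walks: correctness and length. -/

namespace DetRegex

/-! ### Compressed walks -/

/-- The instructions to which the walk from a state is compressed. -/
inductive Entry : Type
  | fail : Entry
  | done (u : ℕ) : Entry
  | opening (x : ℕ) : Entry
  | closing (x : ℕ) : Entry
  | copy (x u : ℕ) : Entry

section Walks

/-- The walk from the state `v`, compressed by leaving out steps without effect. The entry of the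
array `fs`, `fe`, `fv` at `x` is `D` if the factor `[ₓ` was read at the current position, if the
value of `x` is empty, and if `]ₓ` was read since `[ₓ`, respectively. -/
def walkList (lb la nv nc : ℕ → ℕ) (D : ℕ) :
    ℕ → ℕ → (ℕ → ℕ) → (ℕ → ℕ) → (ℕ → ℕ) → List Entry
  | 0, _, _, _, _ => [.fail]
  | n + 1, v, fs, fe, fv =>
    if nextState nv nc v = 0 then [.fail]
    else if lb v = 2 then [.done (nextState nv nc v), .fail]
    else if lb v = 7 then
      if fs (la v) = D then walkList lb la nv nc D n (nextState nv nc v) fs fe fv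
      else .opening (la v) :: walkList lb la nv nc D n (nextState nv nc v)
        (Function.update fs (la v) D) fe (Function.update fv (la v) 0)
    else if lb v = 8 then
      if fv (la v) = D then walkList lb la nv nc D n (nextState nv nc v) fs fe fv
      else .closing (la v) :: walkList lb la nv nc D n (nextState nv nc v) fs
        (Function.update fe (la v) (if fs (la v) = D then D else 0))
        (Function.update fv (la v) D)
    else if lb v = 3 then
      if fe (la v) = D then walkList lb la nv nc D n (nextState nv nc v) fs fe fv
      else .copy (la v) (nextState nv nc v) :: walkList lb la nv nc D n (nextState nv nc v) fs
        (Function.update fe (la v) D) fv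
    else walkList lb la nv nc D n (nextState nv nc v) fs fe fv

/-- The evaluation by a list of entries, in front of the letter `a`, leads to acceptance. -/
def EntriesAccept (β : Expr ℕ ℕ) (w : List ℕ) (a : ℕ) : List Entry → DerefState ℕ ℕ → Prop
  | [], _ => False
  | .fail :: _, _ => False
  | .done u :: _, d => Accepts β w u (d.step (.term a))
  | .opening x :: l, d => EntriesAccept β w a l (d.step (.opening x))
  | .closing x :: l, d => EntriesAccept β w a l (d.step (.closing x))
  | .copy x u :: l, d =>
    if d.value x = [] then EntriesAccept β w a l d else Accepts β w u (d.step (.var x))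

/-- The flags are correct for the state of the evaluation. -/
def FlagsOk (D : ℕ) (fs fe fv : ℕ → ℕ) (d : DerefState ℕ ℕ) : Prop :=
  ∀ x, (fs x = D → d.start x = d.out.length) ∧ (fe x = D → d.value x = []) ∧
    (fv x = D → d.value x = d.out.drop (d.start x))

variable {α : Expr ℕ ℕ} {e : ℕ} {lb la nv nc : ℕ → ℕ} {v D n a : ℕ} {fs fe fv : ℕ → ℕ}
  {d : DerefState ℕ ℕ} {w rem : List ℕ} {Q : RefSym ℕ ℕ → Bool} {x : ℕ}

/-- This and the next two equations are the reasons for leaving out a step: a flag that equals `D`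
asserts the corresponding premise. -/
theorem step_opening_eq_self (h : d.start x = d.out.length) : d.step (.opening x) = d := by
  refine DerefState.eq_of_fields rfl (fun y => ?_) fun _ => rfl
  simp [DerefState.step, ← h]

theorem step_closing_eq_self (h : d.value x = d.out.drop (d.start x)) :
    d.step (.closing x) = d := by
  refine DerefState.eq_of_fields rfl (fun _ => rfl) fun y => ?_
  simp [DerefState.step, ← h]

theorem step_var_eq_self (h : d.value x = []) : d.step (.var x) = d := by
  refine DerefState.eq_of_fields ?_ (fun _ => rfl) fun _ => rfl
  simp [DerefState.step, h]

/-- The opening bracket moves the start of `x`, so the value need no longer be the factor that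
begins there, and the flag `fv` is cleared. The value `0` clears a flag because `D ≠ 0`. -/
theorem FlagsOk.opening (h : FlagsOk D fs fe fv d) (hD : D ≠ 0) :
    FlagsOk D (Function.update fs x D) fe (Function.update fv x 0) (d.step (.opening x)) := by
  intro y
  obtain ⟨h₁, h₂, h₃⟩ := h y
  by_cases hy : y = x
  · subst hy
    refine ⟨fun _ => by simp [DerefState.step], h₂, fun hf => ?_⟩
    simp only [Function.update_self] at hf
    exact absurd hf.symm hD
  · simpa [DerefState.step, Function.update_of_ne hy] using ⟨h₁, h₂, h₃⟩

/-- The new value is known to be empty if the factor was opened at the present position. Otherwise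
it may be nonempty, and an earlier flag `fe` has to be cleared. -/
theorem FlagsOk.closing (h : FlagsOk D fs fe fv d) (hD : D ≠ 0) :
    FlagsOk D fs (Function.update fe x (if fs x = D then D else 0)) (Function.update fv x D)
      (d.step (.closing x)) := by
  intro y
  obtain ⟨h₁, h₂, h₃⟩ := h y
  by_cases hy : y = x
  · subst hy
    refine ⟨h₁, fun hf => ?_, fun _ => by simp [DerefState.step]⟩
    simp only [Function.update_self] at hf
    split_ifs at hf with hs
    · simp [DerefState.step, h₁ hs]
    · exact absurd hf.symm hD
  · simpa [DerefState.step, Function.update_of_ne hy] using ⟨h₁, h₂, h₃⟩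

theorem FlagsOk.copy (h : FlagsOk D fs fe fv d) (hx : d.value x = []) :
    FlagsOk D fs (Function.update fe x D) fv d := by
  intro y
  obtain ⟨h₁, h₂, h₃⟩ := h y
  by_cases hy : y = x
  · subst hy; exact ⟨h₁, fun _ => hx, h₃⟩
  · simpa [Function.update_of_ne hy] using ⟨h₁, h₂, h₃⟩

/-- A terminal that is read on the way to a letter of the class of `a` is `a`. -/
theorem IsSystem.eq_of_term (S : IsSystem α e (labelOf lb la) nv)
    (hR : IsRow (isTerm a) α e nc) (hv : Live (α.cat (.term e)) v)
    (hn : nextState nv nc v ≠ 0) {c : ℕ} (hc : labelOf lb la v = some (.term c)) : c = a := by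
  obtain ⟨L, -, hL, -⟩ := hv
  unfold nextState at hn
  split_ifs at hn with h
  · cases hL.reach hR.table S.labels hR.one h with
    | letter hb _ hQ _ =>
      rw [hc] at hb
      exact RefSym.term.inj (eq_of_isTerm (Option.some.inj hb ▸ hQ))
    | step hs => exact (hs _ hc).elim
  · cases hL.reach S.varTable S.labels S.varTable_one hn with
    | letter hb _ hQ _ =>
      rw [hc] at hb
      obtain ⟨x, hx⟩ := eq_of_isVar (Option.some.inj hb ▸ hQ)
      cases hx
    | step hs => exact (hs _ hc).elim

/-- One step of a compressed walk. -/
theorem IsSystem.walkList_succ (S : IsSystem α e (labelOf lb la) nv)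
    (hR : IsRow (isTerm a) α e nc) (hv : Live (α.cat (.term e)) v) (hD : D ≠ 0)
    (hF : FlagsOk D fs fe fv d) :
    (nextState nv nc v = 0 ∧ walkList lb la nv nc D (n + 1) v fs fe fv = [.fail]) ∨
    nextState nv nc v ≠ 0 ∧
    (labelOf lb la v = some (.term a) ∧
      walkList lb la nv nc D (n + 1) v fs fe fv = [.done (nextState nv nc v), .fail] ∨
    (∃ x l, labelOf lb la v = some (.var x) ∧ d.value x ≠ [] ∧
      walkList lb la nv nc D (n + 1) v fs fe fv = .copy x (nextState nv nc v) :: l) ∨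
    (∀ c, labelOf lb la v ≠ some (.term c)) ∧
      (runWord d (labelWord (labelOf lb la) v)).out = d.out ∧
      ∃ fs' fe' fv', FlagsOk D fs' fe' fv' (runWord d (labelWord (labelOf lb la) v)) ∧
        ∀ w, EntriesAccept (α.cat (.term e)) w a (walkList lb la nv nc D (n + 1) v fs fe fv) d ↔
          EntriesAccept (α.cat (.term e)) w a
            (walkList lb la nv nc D n (nextState nv nc v) fs' fe' fv')
            (runWord d (labelWord (labelOf lb la) v))) := by
  by_cases hn : nextState nv nc v = 0
  · exact Or.inl ⟨hn, by simp [walkList, hn]⟩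
  refine Or.inr ⟨hn, ?_⟩
  by_cases h2 : lb v = 2
  · have hl : labelOf lb la v = some (.term (la v)) := by simp [labelOf, h2]
    have := S.eq_of_term hR hv hn hl
    exact Or.inl ⟨by rw [hl, this], by simp [walkList, hn, h2]⟩
  refine Or.inr ?_
  by_cases h7 : lb v = 7
  · have hl : labelOf lb la v = some (.opening (la v)) := by simp [labelOf, h7]
    have hr : runWord d (labelWord (labelOf lb la) v) = d.step (.opening (la v)) := by
      simp [labelWord, hl]
    refine Or.inr ⟨by simp [hl], by rw [hr]; rfl, ?_⟩
    rw [hr]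
    by_cases hfs : fs (la v) = D
    · rw [step_opening_eq_self ((hF _).1 hfs)]
      exact ⟨fs, fe, fv, hF, fun w => by simp [walkList, hn, h7, hfs]⟩
    · exact ⟨_, _, _, hF.opening hD, fun w => by simp [walkList, hn, h7, hfs, EntriesAccept]⟩
  by_cases h8 : lb v = 8
  · have hl : labelOf lb la v = some (.closing (la v)) := by simp [labelOf, h8]
    have hr : runWord d (labelWord (labelOf lb la) v) = d.step (.closing (la v)) := by
      simp [labelWord, hl]
    refine Or.inr ⟨by simp [hl], by rw [hr]; rfl, ?_⟩
    rw [hr]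
    by_cases hfs : fv (la v) = D
    · rw [step_closing_eq_self ((hF _).2.2 hfs)]
      exact ⟨fs, fe, fv, hF, fun w => by simp [walkList, hn, h8, hfs]⟩
    · exact ⟨_, _, _, hF.closing hD, fun w => by simp [walkList, hn, h8, hfs, EntriesAccept]⟩
  by_cases h3 : lb v = 3
  · have hl : labelOf lb la v = some (.var (la v)) := by simp [labelOf, h3]
    have hr : runWord d (labelWord (labelOf lb la) v) = d.step (.var (la v)) := by
      simp [labelWord, hl]
    by_cases hval : d.value (la v) = []
    · refine Or.inr ⟨by simp [hl], by rw [hr, step_var_eq_self hval], ?_⟩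
      rw [hr, step_var_eq_self hval]
      by_cases hfs : fe (la v) = D
      · exact ⟨fs, fe, fv, hF, fun w => by simp [walkList, hn, h3, hfs]⟩
      · exact ⟨_, _, _, hF.copy hval, fun w => by
          simp [walkList, hn, h3, hfs, EntriesAccept, hval]⟩
    -- A nonempty value produces output, and the evaluation leaves the list at this entry; what the
    -- list contains afterwards does not matter.
    · have hfs : fe (la v) ≠ D := fun h => hval ((hF _).2.1 h)
      exact Or.inl ⟨_, _, hl, hval, by simp [walkList, hn, h3, hfs]; rfl⟩
  · have hl : labelOf lb la v = none := by simp [labelOf, h2, h3, h7, h8]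
    have hr : runWord d (labelWord (labelOf lb la) v) = d := by simp [labelWord, hl]
    refine Or.inr ⟨by simp [hl], by rw [hr], fs, fe, fv, by rw [hr]; exact hF, fun w => ?_⟩
    rw [hr]
    simp [walkList, hn, h2, h3, h7, h8]

/-- By `IsSystem.accepts_iff` each step of the walk preserves acceptance, and steps that are left
out do not change the state of the evaluation. -/
theorem IsSystem.accepts_of_entriesAccept (S : IsSystem α e (labelOf lb la) nv)
    (hR : IsRow (isTerm a) α e nc) (hv : Live (α.cat (.term e)) v) (hD : D ≠ 0)
    (hF : FlagsOk D fs fe fv d) (hw : w = d.out ++ a :: rem) (hrem : a = e → rem = [])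
    (h : EntriesAccept (α.cat (.term e)) w a (walkList lb la nv nc D n v fs fe fv) d) :
    Accepts (α.cat (.term e)) w v d := by
  induction n generalizing v fs fe fv d with
  | zero => simp [walkList, EntriesAccept] at h
  | succ n ih =>
    rw [S.accepts_iff hR hv hw hrem]
    rcases S.walkList_succ (n := n) hR hv hD hF with
      ⟨-, hl⟩ | ⟨hn, ⟨hlab, hl⟩ | ⟨x, l, hlab, hx, hl⟩ | ⟨-, hout, fs', fe', fv', hF', hl⟩⟩
    · rw [hl] at h; exact h.elim
    · rw [hl] at h
      refine ⟨hn, ?_⟩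
      simpa [labelWord, hlab] using show Accepts _ _ _ _ from h
    · rw [hl, EntriesAccept, if_neg hx] at h
      refine ⟨hn, ?_⟩
      simpa [labelWord, hlab] using h
    · exact ⟨hn, ih (hv.nextState S hR hn) hF' (by rw [hout, hw]) ((hl w).1 h)⟩

/-- The list can miss an acceptance only because the walk was cut off: it then went through all `n`
steps without a terminal and without output. This is the situation of
`IsSystem.not_accepts_of_loop`. -/
theorem IsSystem.stuck_of_not_entriesAccept (S : IsSystem α e (labelOf lb la) nv)
    (hR : IsRow (isTerm a) α e nc) (hv : Live (α.cat (.term e)) v) (hD : D ≠ 0)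
    (hF : FlagsOk D fs fe fv d) (hw : w = d.out ++ a :: rem) (hrem : a = e → rem = [])
    (h : ¬ EntriesAccept (α.cat (.term e)) w a (walkList lb la nv nc D n v fs fe fv) d)
    (hA : Accepts (α.cat (.term e)) w v d) :
    (∀ i < n, nextState nv nc ((nextState nv nc)^[i] v) ≠ 0) ∧
    (∀ i < n, ∀ c, labelOf lb la ((nextState nv nc)^[i] v) ≠ some (.term c)) ∧
    ∀ i ≤ n, (runWord d (walkWord (labelOf lb la) (nextState nv nc) i v)).out = d.out := by
  induction n generalizing v fs fe fv d with
  | zero => simp [walkWord]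
  | succ n ih =>
    rw [S.accepts_iff hR hv hw hrem] at hA
    rcases S.walkList_succ (n := n) hR hv hD hF with
      ⟨hn, hl⟩ | ⟨hn, ⟨hlab, hl⟩ | ⟨x, l, hlab, hx, hl⟩ | ⟨hlab, hout, fs', fe', fv', hF', hl⟩⟩
    · exact absurd hn hA.1
    · rw [hl] at h
      exact absurd (show Accepts _ _ _ _ by simpa [labelWord, hlab] using hA.2) h
    · rw [hl, EntriesAccept, if_neg hx] at h
      exact absurd (by simpa [labelWord, hlab] using hA.2) h
    · obtain ⟨h₁, h₂, h₃⟩ := ih (hv.nextState S hR hn) hF' (by rw [hout, hw])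
        (fun h' => h ((hl w).2 h')) hA.2
      refine ⟨fun i hi => ?_, fun i hi => ?_, fun i hi => ?_⟩
      · rcases i with _ | i
        · exact hn
        · exact h₁ i (by omega)
      · rcases i with _ | i
        · exact hlab
        · exact h₂ i (by omega)
      · rcases i with _ | i
        · rfl
        · rw [walkWord, runWord_append, h₃ i (by omega), hout]

/-- Compressed walks decide acceptance. -/
theorem IsSystem.entriesAccept_iff (S : IsSystem α e (labelOf lb la) nv)
    (hR : IsRow (isTerm a) α e nc) (hv : Live (α.cat (.term e)) v) (hD : D ≠ 0)
    (hF : FlagsOk D fs fe fv d) (hw : w = d.out ++ a :: rem) (hrem : a = e → rem = [])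
    (hN : 6 * (α.cat (.term e)).size < n) :
    EntriesAccept (α.cat (.term e)) w a (walkList lb la nv nc D n v fs fe fv) d ↔
      Accepts (α.cat (.term e)) w v d := by
  refine ⟨S.accepts_of_entriesAccept hR hv hD hF hw hrem, fun hA => ?_⟩
  by_contra h
  obtain ⟨h₁, h₂, h₃⟩ := S.stuck_of_not_entriesAccept hR hv hD hF hw hrem h hA
  -- The steps are counted inclusively there, whence `n - 1`, which is at least six times the size.
  exact S.not_accepts_of_loop hR hv hw (N := n - 1) (by omega) (fun i hi => h₁ i (by omega))
    (fun i hi => h₂ i (by omega)) (fun i hi => h₃ i (by omega)) hA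

/-! ### The length of compressed walks -/

/-- Bound for the number of entries with the variable `x`. -/
def entryBound (D : ℕ) (fs fe fv : ℕ → ℕ) (x : ℕ) : ℕ :=
  (if fe x = D then 0 else 1) +
    if fs x = D then if fv x = D then 0 else 1 else if fv x = D then 2 else 4

theorem sum_lt_of_change {V : Finset ℕ} {f g : ℕ → ℕ} (hx : x ∈ V) (h : ∀ y ≠ x, g y = f y)
    (hlt : g x + 1 ≤ f x) : (∑ y ∈ V, g y) + 1 ≤ ∑ y ∈ V, f y := by
  have := Finset.add_sum_erase V f hx
  have := Finset.add_sum_erase V g hx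
  have : ∑ y ∈ V.erase x, g y = ∑ y ∈ V.erase x, f y :=
    Finset.sum_congr rfl fun y hy => h y (Finset.ne_of_mem_erase hy)
  omega

theorem Occ.vars_subset {β δ : Expr ℕ ℕ} {i j : ℕ} {k k' : Language (RefSym ℕ ℕ × ℕ)}
    (h : Occ β i k j δ k') : δ.vars ⊆ β.vars := by
  induction h with
  | here => exact Finset.Subset.refl _
  | catL _ ih | altL _ ih => exact ih.trans Finset.subset_union_left
  | catR _ ih | altR _ ih => exact ih.trans Finset.subset_union_right
  | plus _ ih => exact ih
  | bind _ ih => exact ih.trans (Finset.subset_insert _ _)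

theorem Coded.arg_mem_vars {β : Expr ℕ ℕ} (h : Coded lb la β 0) {L}
    (hv : Residual β v L) (hl : lb v = 3 ∨ lb v = 7 ∨ lb v = 8) : la v ∈ β.vars := by
  obtain ⟨j, δ, k, ho, ⟨rfl, -⟩ | ⟨rfl, -⟩⟩ := hv
  all_goals
    obtain ⟨h₁, h₂, h₃, h₄⟩ := h _ _ _ _ ho
    refine ho.vars_subset ?_
    cases δ <;> simp_all [Expr.kind, Expr.arg, Expr.vars]

/-- The sum of `entryBound` is a potential that every entry lowers. An opening bracket takes the
second summand from `2` or `4` to `1`. A closing bracket takes it from `1` to `0`, or from `4` to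
`2` if the start is not current; the extra unit pays for clearing `fe`. A copy removes the first
summand. The additional `2` stands for the entries `done` and `fail` at the end. -/
theorem length_walkList_le {β : Expr ℕ ℕ} (hc : Coded lb la β 0)
    (hnext : ∀ v L, Residual β v L → nextState nv nc v ≠ 0 →
      ∃ L, Residual β (nextState nv nc v) L) (hD : D ≠ 0) {L} (hv : Residual β v L) :
    (walkList lb la nv nc D n v fs fe fv).length ≤
      (∑ x ∈ β.vars, entryBound D fs fe fv x) + 2 := by
  induction n generalizing v L fs fe fv with
  | zero => simp [walkList]
  | succ n ih =>
    by_cases hn : nextState nv nc v = 0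
    · simp [walkList, hn]
    obtain ⟨M, hM⟩ := hnext v L hv hn
    have hm := hc.arg_mem_vars hv
    obtain ⟨fe', hfe'⟩ : ∃ f, f = Function.update fe (la v) (if fs (la v) = D then D else 0) :=
      ⟨_, rfl⟩
    simp only [walkList, if_neg hn, ← hfe']
    split_ifs with h2 h7 hfs h8 hfv h3 hfe
    · simp
    · exact ih hM
    · have hlt := sum_lt_of_change (hm (by omega)) (f := entryBound D fs fe fv)
        (g := entryBound D (Function.update fs (la v) D) fe (Function.update fv (la v) 0))
        (fun y hy => by simp [entryBound, Function.update_of_ne hy])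
        (by simp only [entryBound, Function.update_self, if_neg hfs, if_true, if_neg hD.symm]
            split_ifs <;> omega)
      have := ih hM (fs := Function.update fs (la v) D) (fe := fe)
        (fv := Function.update fv (la v) 0)
      simp only [List.length_cons]
      omega
    · exact ih hM
    · have hlt := sum_lt_of_change (hm (by omega)) (f := entryBound D fs fe fv)
        (g := entryBound D fs fe' (Function.update fv (la v) D))
        (fun y hy => by simp [entryBound, hfe', Function.update_of_ne hy])
        (by simp only [entryBound, hfe', Function.update_self, if_neg hfv, if_true]
            split_ifs <;> omega)
      have := ih hM (fs := fs) (fe := fe') (fv := Function.update fv (la v) D)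
      simp only [List.length_cons]
      omega
    · exact ih hM
    · have hlt := sum_lt_of_change (hm (by omega)) (f := entryBound D fs fe fv)
        (g := entryBound D fs (Function.update fe (la v) D) fv)
        (fun y hy => by simp [entryBound, Function.update_of_ne hy])
        (by simp only [entryBound, Function.update_self, if_neg hfe, if_true]
            split_ifs <;> omega)
      have := ih hM (fs := fs) (fe := Function.update fe (la v) D) (fv := fv)
      simp only [List.length_cons]
      omega
    · exact ih hM

theorem length_walkList_le_card {β : Expr ℕ ℕ} (hc : Coded lb la β 0)
    (hnext : ∀ v L, Residual β v L → nextState nv nc v ≠ 0 →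
      ∃ L, Residual β (nextState nv nc v) L) (hD : D ≠ 0) {L} (hv : Residual β v L) :
    (walkList lb la nv nc D n v fs fe fv).length ≤ 5 * β.vars.card + 2 := by
  refine (length_walkList_le hc hnext hD hv).trans ?_
  have : ∑ x ∈ β.vars, entryBound D fs fe fv x ≤ ∑ _x ∈ β.vars, 5 :=
    Finset.sum_le_sum fun x _ => by unfold entryBound; split_ifs <;> omega
  simp only [Finset.sum_const, smul_eq_mul] at this
  omega

end Walks

end DetRegex

/-! ### Writing compressed walks to memory. -/

namespace DetRegex

/-! ### Lists of entries in the memory -/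

namespace Entry

/-- The kind of an entry. -/
def kind : Entry → ℕ
  | fail => 0
  | done _ => 2
  | opening _ => 7
  | closing _ => 8
  | copy _ _ => 3

/-- The variable of an entry. -/
def arg : Entry → ℕ
  | fail => 0
  | done _ => 0
  | opening x => x
  | closing x => x
  | copy x _ => x

/-- The target state of an entry. -/
def target : Entry → ℕ
  | fail => 0
  | done u => u
  | opening _ => 0
  | closing _ => 0
  | copy _ u => u

end Entry

namespace Decider

open RAM RAM.Exp

/-- The entry number `p` of the pool. -/
def EntryAt (σ : Store) (p : ℕ) (t : Entry) : Prop :=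
  σ.arr aPK p = t.kind ∧ σ.arr aPX p = t.arg ∧ σ.arr aPT p = t.target

/-- The pool holds the list at the position `p`. -/
def PoolAt (σ : Store) : ℕ → List Entry → Prop
  | _, [] => True
  | p, t :: l => EntryAt σ p t ∧ PoolAt σ (p + 1) l

/-- The pools agree below the position `b`. -/
def SamePool (b : ℕ) (σ σ' : Store) : Prop :=
  ∀ p < b, σ'.arr aPK p = σ.arr aPK p ∧ σ'.arr aPX p = σ.arr aPX p ∧ σ'.arr aPT p = σ.arr aPT p

variable {inp : ℕ → ℕ} {m s : ℕ} {σ σ' : Store} {β : Expr ℕ ℕ} {w : List ℕ}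

theorem PoolAt.congr {b p : ℕ} {l : List Entry} (h : PoolAt σ p l) (hs : SamePool b σ σ')
    (hb : p + l.length ≤ b) : PoolAt σ' p l := by
  induction l generalizing p with
  | nil => trivial
  | cons t l ih =>
    simp only [List.length_cons] at hb
    obtain ⟨h₁, h₂, h₃⟩ := hs p (by omega)
    refine ⟨?_, ih h.2 (by omega)⟩
    rw [EntryAt, h₁, h₂, h₃]
    exact h.1

theorem PoolAt.append {p : ℕ} {l l' : List Entry} :
    PoolAt σ p (l ++ l') ↔ PoolAt σ p l ∧ PoolAt σ (p + l.length) l' := by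
  induction l generalizing p with
  | nil => simp [PoolAt]
  | cons t l ih =>
    simp only [List.cons_append, PoolAt, ih, List.length_cons, and_assoc,
      show p + 1 + l.length = p + (l.length + 1) by omega]

theorem SamePool.trans {σ'' : Store} {b c : ℕ} (h : SamePool b σ σ') (h' : SamePool c σ' σ'')
    (hbc : b ≤ c) : SamePool b σ σ'' := fun p hp => by
  obtain ⟨h₁, h₂, h₃⟩ := h p hp
  obtain ⟨h₄, h₅, h₆⟩ := h' p (by omega)
  exact ⟨h₄.trans h₁, h₅.trans h₂, h₆.trans h₃⟩

/-- Append an entry to the pool. -/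
def emit (k x t : Exp) : Cmd := .block [
  .st aPK (var rP) k, .st aPX (var rP) x, .st aPT (var rP) t, .asg rP (var rP + 1)]

/-- One step of the walk from the state in register `rV`. -/
def walkStep : Cmd := .block [
  .asg rU (Exp.ite (rd aNC (var rV)) 0 (rd aNV (var rV)) (rd aNC (var rV))),
  .asg rK (rd aLB (var rV)),
  .asg rY (rd aLA (var rV)),
  .ifEq (var rU) 0 (.asg rG 0) <|
  .ifEq (var rK) 2 (.block [emit 2 0 (var rU), .asg rG 0]) <|
  .ifEq (var rK) 7
    (.block [.ifEq (rd aFS (var rY)) (var rD) .skip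
      (.block [emit 7 (var rY) 0, .st aFS (var rY) (var rD), .st aFV (var rY) 0]),
      .asg rV (var rU)]) <|
  .ifEq (var rK) 8
    (.block [.ifEq (rd aFV (var rY)) (var rD) .skip
      (.block [emit 8 (var rY) 0,
        .st aFE (var rY) (Exp.ite (rd aFS (var rY)) (var rD) (var rD) 0),
        .st aFV (var rY) (var rD)]), .asg rV (var rU)]) <|
  .ifEq (var rK) 3
    (.block [.ifEq (rd aFE (var rY)) (var rD) .skip
      (.block [emit 3 (var rY) (var rU), .st aFE (var rY) (var rD)]), .asg rV (var rU)]) <|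
  .asg rV (var rU)]

/-- Append the compressed walk from the state in register `rV` to the pool. -/
def walk : Cmd := .block [
  .asg rG 1,
  .forUp rI (var rM + var rM + var rM + var rM + var rM + var rM + 1)
    (.ite (var rG) walkStep .skip),
  emit 0 0 0]

/-- The part of the compressed walk that is still to be computed. -/
def pending (σ : Store) (n : ℕ) : List Entry :=
  if σ.reg rG = 0 then [.fail]
  else walkList (σ.arr aLB) (σ.arr aLA) (σ.arr aNV) (σ.arr aNC) (σ.reg rD) n (σ.reg rV)
    (σ.arr aFS) (σ.arr aFE) (σ.arr aFV)

/-- All flags are at most `b`. -/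
def FlagsLe (b : ℕ) (σ : Store) : Prop :=
  ∀ x, σ.arr aFS x ≤ b ∧ σ.arr aFE x ≤ b ∧ σ.arr aFV x ≤ b

theorem FlagsLe.update {b : ℕ} {f : ℕ → ℕ} {x c : ℕ} (h : ∀ x, f x ≤ b) (hc : c ≤ b) (y : ℕ) :
    Function.update f x c y ≤ b := by
  rw [Function.update_apply]
  split_ifs
  · exact hc
  · exact h y

/-- The list `l` is appended to the pool. -/
def Appended (σ σ' : Store) (l : List Entry) : Prop :=
  PoolAt σ' (σ.reg rP) l ∧ σ'.reg rP = σ.reg rP + l.length ∧ SamePool (σ.reg rP) σ σ'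

theorem Appended.trans {σ'' : Store} {l l' : List Entry} (h : Appended σ σ' l)
    (h' : Appended σ' σ'' l') : Appended σ σ'' (l ++ l') := by
  obtain ⟨h₁, h₂, h₃⟩ := h
  obtain ⟨h₄, h₅, h₆⟩ := h'
  refine ⟨PoolAt.append.2 ⟨h₁.congr h₆ (by omega), by rwa [← h₂]⟩, ?_, h₃.trans h₆ (by omega)⟩
  rw [h₅, h₂, List.length_append]; omega

theorem Appended.nil (hP : σ'.reg rP = σ.reg rP) (h₁ : σ'.arr aPK = σ.arr aPK)
    (h₂ : σ'.arr aPX = σ.arr aPX) (h₃ : σ'.arr aPT = σ.arr aPT) : Appended σ σ' [] :=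
  ⟨trivial, hP, fun p _ => by rw [h₁, h₂, h₃]; simp⟩

theorem Appended.single {t : Entry} (hP : σ'.reg rP = σ.reg rP + 1)
    (h₁ : σ'.arr aPK = Function.update (σ.arr aPK) (σ.reg rP) t.kind)
    (h₂ : σ'.arr aPX = Function.update (σ.arr aPX) (σ.reg rP) t.arg)
    (h₃ : σ'.arr aPT = Function.update (σ.arr aPT) (σ.reg rP) t.target) :
    Appended σ σ' [t] := by
  refine ⟨⟨⟨?_, ?_, ?_⟩, trivial⟩, hP, fun p hp => ?_⟩
  · simp [h₁]
  · simp [h₂]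
  · simp [h₃]
  · have : p ≠ σ.reg rP := by omega
    simp [h₁, h₂, h₃, Function.update_of_ne this]

/-- What has been written together with what is `pending` is always the same list. A walk that has
ended is marked by `rG = 0`, and then only the final `fail` is pending. -/
theorem runs_walkStep {n : ℕ} (hG : σ.reg rG ≠ 0) (hf : FlagsLe (σ.reg rD) σ) :
    Runs inp m walkStep σ fun σ' t => t ≤ 15 ∧ FlagsLe (σ.reg rD) σ' ∧
      ∃ l, pending σ (n + 1) = l ++ pending σ' n ∧ Appended σ σ' l := by
  have hfS := fun x => (hf x).1
  have hfE := fun x => (hf x).2.1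
  have hfV := fun x => (hf x).2.2
  have hu : (if σ.arr aNC (σ.reg rV) = 0 then σ.arr aNV (σ.reg rV) else σ.arr aNC (σ.reg rV)) =
      nextState (σ.arr aNV) (σ.arr aNC) (σ.reg rV) := by
    unfold nextState; split_ifs <;> simp_all
  simp only [walkStep, emit, runs_block_cons, runs_asg, runs_ifEq, runs_block_nil, runs_st, runs_skip]
  simp only [Exp.eval_ite, Exp.eval_rd, Exp.eval_var, Exp.eval_zero, hu]
  generalize hU : nextState (σ.arr aNV) (σ.arr aNC) (σ.reg rV) = u
  simp
  generalize hq : (if σ.arr aFS (σ.arr aLA (σ.reg rV)) = σ.reg rD then σ.reg rD else 0) = q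
  have hqD : q ≤ σ.reg rD := by rw [← hq]; split_ifs <;> omega
  split_ifs with h0 h2 h7 hfs h8 hfv h3 hfe
  · refine ⟨hf, [], ?_, .nil rfl rfl rfl rfl⟩
    simp [pending, hG, walkList, hU, h0]
  · refine ⟨hf, [.done u], ?_, .single (by simp) ?_ ?_ ?_⟩
    · simp [pending, hG, walkList, hU, h0, h2]
    · simp [Entry.kind]
    · simp [Entry.arg]
    · simp [Entry.target]
  · refine ⟨hf, [], ?_, .nil rfl rfl rfl rfl⟩
    simp [pending, hG, walkList, hU, h0, h7, hfs]
  · refine ⟨?_, [.opening (σ.arr aLA (σ.reg rV))], ?_, .single (by simp) ?_ ?_ ?_⟩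
    · intro x
      simp
      exact ⟨FlagsLe.update hfS le_rfl x, hfE x, FlagsLe.update hfV (Nat.zero_le _) x⟩
    · simp [pending, hG, walkList, hU, h0, h7, hfs]
    · simp [Entry.kind]
    · simp [Entry.arg]
    · simp [Entry.target]
  · refine ⟨hf, [], ?_, .nil rfl rfl rfl rfl⟩
    simp [pending, hG, walkList, hU, h0, h8, hfv]
  · refine ⟨?_, [.closing (σ.arr aLA (σ.reg rV))], ?_, .single (by simp) ?_ ?_ ?_⟩
    · intro x
      simp
      exact ⟨hfS x, FlagsLe.update hfE hqD x, FlagsLe.update hfV le_rfl x⟩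
    · simp [pending, hG, walkList, hU, h0, h8, hfv, hq]
    · simp [Entry.kind]
    · simp [Entry.arg]
    · simp [Entry.target]
  · refine ⟨hf, [], ?_, .nil rfl rfl rfl rfl⟩
    simp [pending, hG, walkList, hU, h0, h3, hfe]
  · refine ⟨?_, [.copy (σ.arr aLA (σ.reg rV)) u], ?_, .single (by simp) ?_ ?_ ?_⟩
    · intro x
      simp
      exact ⟨hfS x, FlagsLe.update hfE le_rfl x, hfV x⟩
    · simp [pending, hG, walkList, hU, h0, h3, hfe]
    · simp [Entry.kind]
    · simp [Entry.arg]
    · simp [Entry.target]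
  · refine ⟨hf, [], ?_, .nil rfl rfl rfl rfl⟩
    simp [pending, hG, walkList, hU, h0, h2, h7, h8, h3]

theorem runs_walk {M : ℕ} (hM : σ.reg rM = M) (hf : FlagsLe (σ.reg rD) σ) :
    Runs inp m walk σ fun σ' t => t ≤ 18 * (6 * M + 1) + 7 ∧ FlagsLe (σ.reg rD) σ' ∧
      Appended σ σ' (walkList (σ.arr aLB) (σ.arr aLA) (σ.arr aNV) (σ.arr aNC) (σ.reg rD)
        (6 * M + 1) (σ.reg rV) (σ.arr aFS) (σ.arr aFE) (σ.arr aFV)) := by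
  rw [walk, runs_block_cons, runs_asg, runs_block_cons]
  refine ((Runs.forUp (N := 6 * M + 1) (fun i σ' => FlagsLe (σ.reg rD) σ' ∧
    ∃ l, walkList (σ.arr aLB) (σ.arr aLA) (σ.arr aNV) (σ.arr aNC) (σ.reg rD)
        (6 * M + 1) (σ.reg rV) (σ.arr aFS) (σ.arr aFE) (σ.arr aFV) =
        l ++ pending σ' (6 * M + 1 - i) ∧ Appended σ σ' l) (fun _ => 16) rfl ?_ ?_ ?_ ?_)).mono ?_
  · intro σ' hF
    have := hF.reg rM rfl
    simp [hM] at this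
    simp [this]; omega
  · rintro i σ' x ⟨h₁, l, h₂, h₃⟩
    refine ⟨h₁, l, ?_, ?_⟩
    · simpa [pending] using h₂
    · simpa using h₃.trans (.nil (σ' := σ'.setReg rI x) (by simp) rfl rfl rfl)
  · rintro i hi σ' hF ⟨h₁, l, h₂, h₃⟩ -
    have hD := hF.reg rD rfl
    simp at hD
    rw [runs_ite]
    simp only [Exp.eval_var]
    split_ifs with hG
    · rw [runs_skip]
      refine ⟨⟨h₁, l, ?_, h₃⟩, by omega⟩
      rw [h₂]
      simp [pending, hG]
    · rw [← hD] at h₁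
      refine (runs_walkStep (n := 6 * M + 1 - (i + 1)) hG h₁).mono ?_
      rintro σ'' t ⟨ht, hf'', l', hl', hA⟩
      refine ⟨⟨by rwa [hD] at hf'', l ++ l', ?_, h₃.trans hA⟩, by omega⟩
      rw [h₂, show 6 * M + 1 - i = 6 * M + 1 - (i + 1) + 1 by omega, hl', List.append_assoc]
  · refine ⟨hf, [], ?_, .nil (by simp) rfl rfl rfl⟩
    simp [pending]
  · rintro σ₁ t₁ ⟨⟨h₁, l, h₂, h₃⟩, ht₁⟩
    -- Whether the walk has ended by itself or was cut off, exactly the final `fail` remains to be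
    -- written.
    have hp : pending σ₁ (6 * M + 1 - (6 * M + 1)) = [.fail] := by
      simp [pending, walkList]
    rw [hp] at h₂
    simp only [emit, runs_block_cons, runs_st, runs_asg, runs_block_nil]
    rw [h₂]
    refine ⟨?_, ?_, h₃.trans (.single ?_ ?_ ?_ ?_)⟩
    · simp at ht₁; omega
    · simpa [FlagsLe] using h₁
    · simp
    · simp [Entry.kind]
    · simp [Entry.arg]
    · simp [Entry.target]

end Decider

end DetRegex

/-! ### The lists for all terminals and all states in which evaluation resumes. -/

namespace DetRegex

namespace Decider

open RAM RAM.Exp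

variable {inp : ℕ → ℕ} {m s : ℕ} {σ σ' : Store} {α β : Expr ℕ ℕ} {w : List ℕ} {c : Cmd}
  {lb la nv nc : ℕ → ℕ} {χ M e : ℕ}

/-! ### All compressed walks -/

/-- The state is the initial state or lies behind a letter. -/
def IsStart (lb : ℕ → ℕ) (M v : ℕ) : Prop :=
  v = 0 ∨ ∃ j < M, (lb (2 * j) = 2 ∨ lb (2 * j) = 3) ∧ v = 2 * j + 1

/-- The memory holds the compressed walk from the state `v` towards the letter `χ`. -/
def HasList (σ : Store) (lb la nv : ℕ → ℕ) (α : Expr ℕ ℕ) (e M χ v : ℕ) : Prop :=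
  ∃ nc D fs fe fv, D ≠ 0 ∧ (∀ x, fs x ≠ D ∧ fe x ≠ D ∧ fv x ≠ D) ∧ IsRow (isTerm χ) α e nc ∧
    PoolAt σ (σ.arr aH (2 * M * χ + v)) (walkList lb la nv nc D (6 * M + 1) v fs fe fv) ∧
    σ.arr aH (2 * M * χ + v) + (walkList lb la nv nc D (6 * M + 1) v fs fe fv).length ≤ σ.reg rP

theorem HasList.congr {v : ℕ} (h : HasList σ lb la nv α e M χ v)
    (hH : σ'.arr aH (2 * M * χ + v) = σ.arr aH (2 * M * χ + v))
    (hP : SamePool (σ.reg rP) σ σ') (hr : σ.reg rP ≤ σ'.reg rP) :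
    HasList σ' lb la nv α e M χ v := by
  obtain ⟨nc, D, fs, fe, fv, h₁, h₂, h₃, h₄, h₅⟩ := h
  exact ⟨nc, D, fs, fe, fv, h₁, h₂, h₃, by rw [hH]; exact h₄.congr hP h₅, by rw [hH]; omega⟩

/-- Compute the list for the state at node `rJ`, if it is an initial state. -/
def nodeList : Cmd := .block [
  .asg rK (rd aLB (var rJ + var rJ)),
  .asg rV (Exp.ite (var rJ) 0 0 (var rJ + var rJ + 1)),
  .asg rY (Exp.ite (var rJ) 0 1 (Exp.ite (var rK) 2 1 (Exp.ite (var rK) 3 1 0))),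
  .ite (var rY) (.block [
    .st aH (var rB + var rV) (var rP),
    .asg rD (var rD + 1),
    walk]) .skip]

/-- The number `D` is a time stamp. All flags are at most the old stamp, so increasing it
invalidates them at once, and the arrays of flags need not be cleared between walks. -/
theorem runs_nodeList {j : ℕ} (hM : σ.reg rM = M) (hJ : σ.reg rJ = j)
    (hf : FlagsLe (σ.reg rD) σ) (hlb : σ.arr aLB = lb) (hla : σ.arr aLA = la)
    (hnv : σ.arr aNV = nv) (hnc : σ.arr aNC = nc) :
    Runs inp m nodeList σ fun σ' t =>
      t ≤ 4 + (if j = 0 ∨ lb (2 * j) = 2 ∨ lb (2 * j) = 3 then 108 * M + 40 else 0) ∧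
      FlagsLe (σ'.reg rD) σ' ∧
      ((¬ (j = 0 ∨ lb (2 * j) = 2 ∨ lb (2 * j) = 3) ∧ Appended σ σ' [] ∧ σ'.arr aH = σ.arr aH) ∨
      (j = 0 ∨ lb (2 * j) = 2 ∨ lb (2 * j) = 3) ∧
      ∃ D fs fe fv, D ≠ 0 ∧ (∀ x, fs x ≠ D ∧ fe x ≠ D ∧ fv x ≠ D) ∧
        Appended σ σ' (walkList lb la nv nc D (6 * M + 1) (if j = 0 then 0 else 2 * j + 1) fs fe fv) ∧
        σ'.arr aH = Function.update (σ.arr aH) (σ.reg rB + if j = 0 then 0 else 2 * j + 1)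
          (σ.reg rP)) := by
  rw [nodeList]
  simp only [runs_block_cons, runs_asg, runs_block_nil, runs_ite, runs_st, runs_skip]
  by_cases hs : j = 0 ∨ lb (2 * j) = 2 ∨ lb (2 * j) = 3
  · have hy : (if j = 0 then 1 else if lb (2 * j) = 2 then 1 else if lb (2 * j) = 3 then 1 else 0) ≠ 0 := by
      split_ifs <;> simp_all
    simp [hJ, ← Nat.two_mul, hlb, hy, hs]
    refine (runs_walk (M := M) (by simpa using hM) ?_).frame.mono ?_
    · intro x
      obtain ⟨h₁, h₂, h₃⟩ := hf x
      simp
      omega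
    · rintro σ' t ⟨⟨ht, h₁, h₂⟩, hF⟩
      have hD := hF.reg rD rfl
      have hH := hF.arr aH rfl
      simp [hlb, hla, hnv, hnc] at hD hH h₁ h₂
      refine ⟨by omega, by rwa [hD], σ.reg rD, σ.arr aFS, σ.arr aFE, σ.arr aFV, fun x => ?_, ?_, hH⟩
      · obtain ⟨h₁, h₂, h₃⟩ := hf x
        omega
      · have := Appended.trans (σ := σ) (l := []) (.nil (by simp) (by simp) (by simp) (by simp)) h₂
        simpa using this
  · have hy : (if j = 0 then 1 else if lb (2 * j) = 2 then 1 else if lb (2 * j) = 3 then 1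
        else 0) = 0 := by
      split_ifs <;> simp_all
    simp [hJ, ← Nat.two_mul, hlb, hy, hs]
    exact ⟨hf, .nil (by simp) (by simp) (by simp) (by simp)⟩

theorem Loaded.frame (h : Loaded σ s β w) (hF : Frame c σ σ')
    (hc : c.setsReg rS = false ∧ c.setsReg rM = false ∧ c.setsReg rN = false ∧
      c.setsArr aLB = false ∧ c.setsArr aLA = false ∧ c.setsArr aW = false) :
    Loaded σ' s β w := by
  obtain ⟨h₁, h₂, h₃, h₄, h₅, h₆⟩ := hc
  refine ⟨?_, ?_, ?_, ?_, ?_⟩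
  · rw [hF.reg _ h₁, h.alphabet]
  · rw [hF.reg _ h₂, h.size]
  · rw [hF.reg _ h₃, h.length]
  · rw [hF.arr _ h₄, hF.arr _ h₅]; exact h.coded
  · rw [hF.arr _ h₆]; exact h.word

theorem Sized.frame (h : Sized σ β) (hF : Frame c σ σ')
    (hc : c.setsArr aSZ = false ∧ c.setsArr aNU = false) : Sized σ' β := by
  refine ⟨?_, ?_⟩
  · rw [hF.arr _ hc.1]; exact h.size
  · rw [hF.arr _ hc.2]; exact h.nu

theorem Appended.samePool {l : List Entry} (h : Appended σ σ' l) :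
    SamePool (σ.reg rP) σ σ' ∧ σ.reg rP ≤ σ'.reg rP :=
  ⟨h.2.2, by rw [h.2.1]; omega⟩

theorem index_ne {M χ χ' v v' : ℕ} (hv : v < 2 * M) (hv' : v' < 2 * M) (h : χ' ≠ χ ∨ v' ≠ v) :
    2 * M * χ' + v' ≠ 2 * M * χ + v := by
  intro he
  have h₁ : (2 * M * χ' + v') / (2 * M) = χ' := by
    rw [Nat.mul_add_div (by omega), Nat.div_eq_of_lt hv', add_zero]
  have h₂ : (2 * M * χ + v) / (2 * M) = χ := by
    rw [Nat.mul_add_div (by omega), Nat.div_eq_of_lt hv, add_zero]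
  rw [he, h₂] at h₁
  subst h₁
  omega

theorem IsStart.lt {v : ℕ} (h : IsStart lb M v) (hM : 0 < M) : v < 2 * M := by
  rcases h with rfl | ⟨j, hj, -, rfl⟩ <;> omega

/-- Bound for the number of initial states. -/
theorem sum_isLetter (h : Coded lb la β M) :
    ∑ j ∈ Finset.Ico M (M + β.size), (if lb (2 * j) = 2 ∨ lb (2 * j) = 3 then 1 else 0) =
      β.occurrences := by
  induction β generalizing M with
  | cat β γ ihβ ihγ =>
    have h0 := (h _ _ _ _ (.here _ _ 1)).1
    have hβ := ihβ (M := M + 1) fun k j δ k' ho => h 1 j δ _ (.catL (ho.change _).choose_spec)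
    have hγ := ihγ (M := M + 1 + β.size) fun k j δ k' ho =>
      h 1 j δ _ (.catR (ho.change _).choose_spec)
    rw [Finset.sum_eq_sum_Ico_succ_bot (by simp [Expr.size]),
      ← Finset.sum_Ico_consecutive _ (show M + 1 ≤ M + 1 + β.size by omega)
        (show M + 1 + β.size ≤ M + (β.cat γ).size by simp [Expr.size]; omega), hβ,
      show M + (β.cat γ).size = M + 1 + β.size + γ.size by simp [Expr.size]; omega, hγ, h0]
    simp [Expr.kind, Expr.occurrences]
  | alt β γ ihβ ihγ =>
    have h0 := (h _ _ _ _ (.here _ _ 1)).1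
    have hβ := ihβ (M := M + 1) fun k j δ k' ho => h 1 j δ _ (.altL (ho.change _).choose_spec)
    have hγ := ihγ (M := M + 1 + β.size) fun k j δ k' ho =>
      h 1 j δ _ (.altR (ho.change _).choose_spec)
    rw [Finset.sum_eq_sum_Ico_succ_bot (by simp [Expr.size]),
      ← Finset.sum_Ico_consecutive _ (show M + 1 ≤ M + 1 + β.size by omega)
        (show M + 1 + β.size ≤ M + (β.alt γ).size by simp [Expr.size]; omega), hβ,
      show M + (β.alt γ).size = M + 1 + β.size + γ.size by simp [Expr.size]; omega, hγ, h0]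
    simp [Expr.kind, Expr.occurrences]
  | plus β ih =>
    have h0 := (h _ _ _ _ (.here _ _ 1)).1
    have hβ := ih (M := M + 1) fun k j δ k' ho => h 1 j δ _ (.plus (ho.change _).choose_spec)
    rw [Finset.sum_eq_sum_Ico_succ_bot (by simp [Expr.size]),
      show M + (β.plus).size = M + 1 + β.size by simp [Expr.size]; omega, hβ, h0]
    simp [Expr.kind, Expr.occurrences]
  | bind x β ih =>
    have h0 := (h _ _ _ _ (.here _ _ 1)).1
    have hβ := ih (M := M + 1) fun k j δ k' ho => h 1 j δ _ (.bind (ho.change _).choose_spec)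
    rw [Finset.sum_eq_sum_Ico_succ_bot (by simp [Expr.size]),
      show M + (β.bind x).size = M + 1 + β.size by simp [Expr.size]; omega, hβ, h0]
    simp [Expr.kind, Expr.occurrences]
  | _ =>
    have h0 := (h _ _ _ _ (.here _ _ 1)).1
    rw [Finset.sum_eq_sum_Ico_succ_bot (by simp [Expr.size]), h0]
    simp [Expr.size, Expr.kind, Expr.occurrences]

/-- Compute the table of the letter in register `rX`, and all lists for this letter. -/
def letterLists : Cmd := .block [
  .st aRB (var rX) (var rB),
  computeRow,
  .forUp rJ (var rM) nodeList,
  .asg rB (var rB + var rM + var rM)]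

/-- The cost of `letterLists`. -/
def letterCost (β : Expr ℕ ℕ) : ℕ :=
  28 * β.size + (108 * β.size + 40) * (β.occurrences + 1) + 10

/-- Lists that are already present stay intact: the pool only grows, and the new heads are stored in
other cells of `aH`. The base `2 * M * χ` of a row is obtained by repeated addition, as the machine
does not multiply. -/
theorem runs_letterLists (h : Loaded σ s (α.cat (.term e)) w) (hs : Sized σ (α.cat (.term e)))
    (hM : (α.cat (.term e)).size = M)
    (hQ : IsClass (isTerm χ) (α.cat (.term e)) s χ) (hX : σ.reg rX = χ)
    (hf : FlagsLe (σ.reg rD) σ) (hlb : σ.arr aLB = lb) (hla : σ.arr aLA = la)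
    (hnv : σ.arr aNV = nv) (hB : σ.reg rB = 2 * M * χ)
    (hL : ∀ χ' < χ, ∀ v, IsStart lb M v → HasList σ lb la nv α e M χ' v) :
    Runs inp m letterLists σ fun σ' t => t ≤ letterCost (α.cat (.term e)) ∧
      FlagsLe (σ'.reg rD) σ' ∧ σ'.reg rB = 2 * M * (χ + 1) ∧
      σ'.arr aRB = Function.update (σ.arr aRB) χ (2 * M * χ) ∧
      ∀ χ' ≤ χ, ∀ v, IsStart lb M v → HasList σ' lb la nv α e M χ' v := by
  have hM0 : 0 < M := hM ▸ Expr.size_pos _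
  have hlb0 : lb 0 = 4 := by
    rw [← hlb]; exact (h.coded _ _ _ _ (.here _ _ 1)).1
  rw [letterLists]
  simp only [runs_block_cons, runs_st, runs_asg, runs_block_nil]
  have h₁ : Loaded (σ.setArr aRB ((var rX).eval σ) ((var rB).eval σ)) s (α.cat (.term e)) w :=
    h.frame (Exec.frame (inp := inp) (m := m) (.st σ aRB (var rX) (var rB)))
      ⟨rfl, rfl, rfl, rfl, rfl, rfl⟩
  have hs₁ : Sized (σ.setArr aRB ((var rX).eval σ) ((var rB).eval σ)) (α.cat (.term e)) :=
    hs.frame (Exec.frame (inp := inp) (m := m) (.st σ aRB (var rX) (var rB))) ⟨rfl, rfl⟩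
  refine (runs_computeRow h₁ hs₁ hQ (by simpa using hX)).frame.mono ?_
  rintro σ₁ t₁ ⟨⟨ht₁, hT₁, hone₁⟩, hF₁⟩
  have hRB₁ : σ₁.arr aRB = Function.update (σ.arr aRB) χ (2 * M * χ) := by
    rw [hF₁.arr aRB rfl]; simp [hX, hB]
  have hM₁ : σ₁.reg rM = M := by rw [hF₁.reg rM rfl]; simpa [hM] using h.size
  have hB₁ : σ₁.reg rB = 2 * M * χ := by rw [hF₁.reg rB rfl]; simpa using hB
  have hlb₁ : σ₁.arr aLB = lb := by rw [hF₁.arr aLB rfl]; simpa using hlb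
  have hla₁ : σ₁.arr aLA = la := by rw [hF₁.arr aLA rfl]; simpa using hla
  have hnv₁ : σ₁.arr aNV = nv := by rw [hF₁.arr aNV rfl]; simpa using hnv
  have hA₁ : Appended σ σ₁ [] := .nil (by rw [hF₁.reg rP rfl]; simp)
    (by rw [hF₁.arr aPK rfl]; simp) (by rw [hF₁.arr aPX rfl]; simp)
    (by rw [hF₁.arr aPT rfl]; simp)
  have hH₁ : σ₁.arr aH = σ.arr aH := by rw [hF₁.arr aH rfl]; simp
  have hf₁ : FlagsLe (σ₁.reg rD) σ₁ := by
    rw [FlagsLe, hF₁.reg rD rfl, hF₁.arr aFS rfl, hF₁.arr aFE rfl, hF₁.arr aFV rfl]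
    simpa [FlagsLe] using hf
  set nc := σ₁.arr aNC with hnc
  refine ((Runs.forUp (N := M) (fun j σ' => FlagsLe (σ'.reg rD) σ' ∧
    (∀ χ' < χ, ∀ v, IsStart lb M v → HasList σ' lb la nv α e M χ' v) ∧
    ∀ v, IsStart lb M v → v < 2 * j → HasList σ' lb la nv α e M χ v)
    (fun j => 4 + if j = 0 ∨ lb (2 * j) = 2 ∨ lb (2 * j) = 3 then 108 * M + 40 else 0)
    rfl ?_ ?_ ?_ ?_).frame).mono ?_
  · intro σ' hF
    have := hF.reg rM rfl
    simpa [hM₁] using this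
  · rintro j σ' x ⟨h₂, h₃, h₄⟩
    refine ⟨?_, fun χ' hχ v hv => ?_, fun v hv hj => ?_⟩
    · simpa [FlagsLe] using h₂
    · exact (h₃ χ' hχ v hv).congr rfl (fun _ _ => ⟨rfl, rfl, rfl⟩) (by simp)
    · exact (h₄ v hv hj).congr rfl (fun _ _ => ⟨rfl, rfl, rfl⟩) (by simp)
  · rintro j hj σ' hF ⟨h₂, h₃, h₄⟩ hJ
    have hM₂ := (hF.reg rM rfl).trans hM₁
    have hB₂ := (hF.reg rB rfl).trans hB₁
    have hlb₂ := (hF.arr aLB rfl).trans hlb₁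
    have hla₂ := (hF.arr aLA rfl).trans hla₁
    have hnv₂ := (hF.arr aNV rfl).trans hnv₁
    have hnc₂ := (hF.arr aNC rfl).trans hnc.symm
    refine (runs_nodeList hM₂ hJ h₂ hlb₂ hla₂ hnv₂ hnc₂).mono ?_
    rintro σ₂ t₂ ⟨ht₂, hf₂, ⟨hns, hA, hH⟩ | ⟨hst, D, fs, fe, fv, hD, hfl, hA, hH⟩⟩
    · obtain ⟨hsp, hP⟩ := hA.samePool
      refine ⟨⟨hf₂, fun χ' hχ v hv => (h₃ χ' hχ v hv).congr (by rw [hH]) hsp hP,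
        fun v hv hvj => (h₄ v hv ?_).congr (by rw [hH]) hsp hP⟩, ht₂⟩
      rcases hv with rfl | ⟨j', hj', hl, rfl⟩
      · omega
      · have : j' ≠ j := fun hjj => hns (hjj ▸ Or.inr hl)
        omega
    · obtain ⟨hsp, hP⟩ := hA.samePool
      rw [hB₂] at hH
      have hv₀ : (if j = 0 then 0 else 2 * j + 1) < 2 * M := by split_ifs <;> omega
      refine ⟨⟨hf₂, fun χ' hχ v hv => (h₃ χ' hχ v hv).congr ?_ hsp hP, fun v hv hvj => ?_⟩, ht₂⟩
      · rw [hH, Function.update_of_ne (index_ne hv₀ (hv.lt hM0) (Or.inl hχ.ne))]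
      · by_cases hvv : v = if j = 0 then 0 else 2 * j + 1
        · rw [← hvv] at hA hH
          refine ⟨nc, D, fs, fe, fv, hD, hfl, ⟨hT₁, hone₁⟩, ?_, ?_⟩
          · rw [hH, Function.update_self]; exact hA.1
          · rw [hH, Function.update_self, hA.2.1]
        · refine (h₄ v hv ?_).congr ?_ hsp hP
          · rcases hv with rfl | ⟨j', hj', hl, rfl⟩
            · by_contra hcon
              rw [if_pos (by omega)] at hvv
              exact hvv rfl
            · by_contra hcon
              obtain rfl : j' = j := by omega
              -- The root is a concatenation and not a letter, so the state behind it needs no list.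
              by_cases hj0 : j' = 0
              · subst hj0
                simp only [mul_zero, hlb0] at hl
                omega
              · rw [if_neg hj0] at hvv
                exact hvv rfl
          · rw [hH, Function.update_of_ne (index_ne hv₀ (hv.lt hM0) (Or.inr hvv))]
  · obtain ⟨hsp, hP⟩ := hA₁.samePool
    exact ⟨hf₁, fun χ' hχ v hv => (hL χ' hχ v hv).congr (by rw [hH₁]) hsp hP, by simp⟩
  · rintro σ₂ t₂ ⟨⟨⟨h₂, h₃, h₄⟩, ht₂⟩, hF₂⟩
    have hcode : Coded lb la (α.cat (.term e)) 0 := by rw [← hlb, ← hla]; exact h.coded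
    have hcount := sum_isLetter hcode
    rw [Nat.zero_add, hM, ← Finset.range_eq_Ico] at hcount
    -- Only the root and the letters require a walk. Each walk has `6 * M + 1` steps of cost at most
    -- `18`, which with its overhead stays below `108 * M + 40`.
    have hsum : ∑ j ∈ Finset.range M,
        (4 + (if j = 0 ∨ lb (2 * j) = 2 ∨ lb (2 * j) = 3 then 108 * M + 40 else 0) + 2) ≤
        6 * M + (108 * M + 40) * ((α.cat (.term e)).occurrences + 1) := by
      have : ∀ j ∈ Finset.range M,
          (4 + (if j = 0 ∨ lb (2 * j) = 2 ∨ lb (2 * j) = 3 then 108 * M + 40 else 0) + 2) ≤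
          6 + (108 * M + 40) * ((if lb (2 * j) = 2 ∨ lb (2 * j) = 3 then 1 else 0) +
            if j = 0 then 1 else 0) := by
        intro j _
        split_ifs <;> omega
      refine (Finset.sum_le_sum this).trans ?_
      rw [Finset.sum_add_distrib, ← Finset.mul_sum, Finset.sum_add_distrib, hcount]
      simp [Finset.sum_ite_eq', hM0]
      omega
    have hB₂ := (hF₂.reg rB rfl).trans hB₁
    have hM₂ := (hF₂.reg rM rfl).trans hM₁
    refine ⟨?_, ?_, ?_, ?_, fun χ' hχ v hv => ?_⟩
    · rw [letterCost, hM]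
      rw [hM] at ht₁
      omega
    · simpa [FlagsLe] using h₂
    · simp [hB₂, hM₂]; ring
    · rw [Store.setReg_arr, hF₂.arr aRB rfl, hRB₁]
    · have : HasList σ₂ lb la nv α e M χ' v := by
        rcases Nat.lt_or_eq_of_le hχ with hχ | rfl
        · exact h₃ χ' hχ v hv
        · exact h₄ v hv (hv.lt hM0)
      exact this.congr rfl (fun _ _ => ⟨rfl, rfl, rfl⟩) (by simp)

end Decider

end DetRegex

/-! ### The preparation as a whole. -/

namespace DetRegex

theorem IsTable.congr {Q : RefSym ℕ ℕ → Bool} {nx nx' : ℕ → ℕ} {β : Expr ℕ ℕ}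
    (h : IsTable Q nx β 0) (he : ∀ v < 2 * β.size, nx' v = nx v) : IsTable Q nx' β 0 := by
  intro k j δ k' ho
  refine (h _ _ _ _ ho).congr fun v hv => he v ?_
  have := ho.bounds
  have := Touches.lt hv
  omega

namespace Decider

open RAM RAM.Exp

variable {inp : ℕ → ℕ} {m s : ℕ} {σ σ' : Store} {α β : Expr ℕ ℕ} {w : List ℕ} {c : Cmd}
  {lb la nv nc : ℕ → ℕ} {χ M e : ℕ}

/-! ### Preparation -/

/-- The table of the variables is needed together with each of the tables of terminals, which are
all built in `aNC`; so it is moved away first. -/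
def copyTable : Cmd := .forUp rJ (var rM + var rM) (.st aNV (var rJ) (rd aNC (var rJ)))

theorem runs_copyTable (hM : σ.reg rM = M) :
    Runs inp m copyTable σ fun σ' n => n ≤ 6 * M + 2 ∧
      ∀ v < 2 * M, σ'.arr aNV v = σ.arr aNC v := by
  refine (Runs.forUp (N := 2 * M) (fun j σ' => ∀ v < j, σ'.arr aNV v = σ.arr aNC v)
      (fun _ => 1) rfl ?_ (fun _ _ _ h v hv => by simpa using h v hv) ?_ ?_).mono ?_
  · intro σ' hF
    have := hF.reg rM rfl
    simp [this, hM]; omega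
  · rintro j hj σ' hF h₁ hJ
    have hNC := hF.arr aNC rfl
    simp [hJ, hNC]
    intro v hv
    rcases Nat.lt_or_eq_of_le hv with hv | rfl
    · rw [Function.update_of_ne (by omega), h₁ v hv]
    · simp
  · simp
  · rintro σ' n ⟨h₁, hn⟩
    refine ⟨?_, h₁⟩
    simp at hn; omega

/-- Read the input and compute all tables and lists. -/
def prepare : Cmd := .block [
  copyInput,
  computeSizes,
  .asg rX (var rS + 1),
  computeRow,
  copyTable,
  .forUp rX (var rS + 1) letterLists]

/-- The result of the preparation. -/
structure Prepared (σ : Store) (s : ℕ) (α : Expr ℕ ℕ) (w : List ℕ) : Prop where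
  loaded : Loaded σ s (α.cat (.term s)) w
  system : IsSystem α s (labelOf (σ.arr aLB) (σ.arr aLA)) (σ.arr aNV)
  lists : ∀ χ ≤ s, ∀ v, IsStart (σ.arr aLB) (α.cat (.term s)).size v →
    HasList σ (σ.arr aLB) (σ.arr aLA) (σ.arr aNV) α s (α.cat (.term s)).size χ v
  rows : ∀ χ ≤ s, σ.arr aRB χ = 2 * (α.cat (.term s)).size * χ

/-- The cost of the preparation. -/
def prepareCost (s L : ℕ) (α : Expr ℕ ℕ) : ℕ :=
  43 * (α.size + 2) + 4 * L + 40 + (s + 1) * (letterCost (α.cat (.term s)) + 2)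

/-- The terminals of `α` are below `s` and the marker is `s`, so `s + 1` is free to denote the class
of variables. -/
theorem isClass_isVar (hα : ∀ k j a k', Occ α 1 k j (.term a) k' → a < s) :
    IsClass isVar (α.cat (.term s)) s (s + 1) := by
  refine ⟨fun j a k' ho => ?_, fun x => by simp [isVar]⟩
  have : a < s + 1 := by
    cases ho with
    | catL ho => exact (hα _ _ _ _ ho).trans (Nat.lt_succ_self s)
    | catR ho => cases ho with
      | here => omega
  simp [isVar]; omega

theorem isClass_isTerm (hχ : χ ≤ s) : IsClass (isTerm χ) β s χ :=
  ⟨fun j a k' _ => by simp [isTerm], fun x => by simp [isTerm]; omega⟩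

theorem runs_prepare (hσ : σ = ⟨fun _ => 0, fun _ _ => 0⟩)
    (hinp : ∀ i, inp i = ([s, α.size, w.length] ++ α.codes ++ w).getD i 0)
    (hm : m = 3 + 2 * α.size + w.length) (hreg : α.IsRegex) (hdet : IsDetLanguage (α.posLanguage 1))
    (hα : ∀ k j a k', Occ α 1 k j (.term a) k' → a < s) :
    Runs inp m prepare σ fun σ' n => n ≤ prepareCost s w.length α ∧
      Prepared σ' s α (w ++ [s]) := by
  set M := (α.cat (.term s)).size with hM
  have hMα : M = α.size + 2 := by simp [hM, Expr.size]
  rw [prepare]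
  simp only [runs_block_cons, runs_asg, runs_block_nil]
  refine (runs_copyInput (by simp [hσ]) hinp hm).frame.mono ?_
  rintro σ₁ t₁ ⟨⟨ht₁, h₁⟩, F₁⟩
  refine (runs_computeSizes h₁).frame.mono ?_
  rintro σ₂ t₂ ⟨⟨ht₂, hs₂⟩, F₂⟩
  have h₂ := h₁.frame F₂ ⟨rfl, rfl, rfl, rfl, rfl, rfl⟩
  have F₃ := Exec.frame (inp := inp) (m := m) (.asg σ₂ rX (var rS + 1))
  have h₃ := h₂.frame F₃ ⟨rfl, rfl, rfl, rfl, rfl, rfl⟩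
  have hs₃ := hs₂.frame F₃ ⟨rfl, rfl⟩
  refine (runs_computeRow h₃ hs₃ (isClass_isVar hα) (by simp [h₂.alphabet])).frame.mono ?_
  rintro σ₄ t₄ ⟨⟨ht₄, hT, hone⟩, F₄⟩
  have h₄ := h₃.frame F₄ ⟨rfl, rfl, rfl, rfl, rfl, rfl⟩
  have hs₄ := hs₃.frame F₄ ⟨rfl, rfl⟩
  refine (runs_copyTable (M := M) h₄.size).frame.mono ?_
  rintro σ₅ t₅ ⟨⟨ht₅, hNV⟩, F₅⟩
  have h₅ := h₄.frame F₅ ⟨rfl, rfl, rfl, rfl, rfl, rfl⟩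
  have hs₅ := hs₄.frame F₅ ⟨rfl, rfl⟩
  have hB : σ₅.reg rB = 0 := by
    rw [F₅.reg rB rfl, F₄.reg rB rfl, F₃.reg rB rfl, F₂.reg rB rfl, F₁.reg rB rfl, hσ]
  have hD : σ₅.reg rD = 0 := by
    rw [F₅.reg rD rfl, F₄.reg rD rfl, F₃.reg rD rfl, F₂.reg rD rfl, F₁.reg rD rfl, hσ]
  have hflags : FlagsLe (σ₅.reg rD) σ₅ := by
    intro x
    rw [F₅.arr aFS rfl, F₄.arr aFS rfl, F₃.arr aFS rfl, F₂.arr aFS rfl, F₁.arr aFS rfl,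
      F₅.arr aFE rfl, F₄.arr aFE rfl, F₃.arr aFE rfl, F₂.arr aFE rfl, F₁.arr aFE rfl,
      F₅.arr aFV rfl, F₄.arr aFV rfl, F₃.arr aFV rfl, F₂.arr aFV rfl, F₁.arr aFV rfl, hσ]
    simp
  refine ((Runs.forUp (N := s + 1) (fun χ σ' => FlagsLe (σ'.reg rD) σ' ∧
    σ'.reg rB = 2 * M * χ ∧ (∀ χ' < χ, σ'.arr aRB χ' = 2 * M * χ') ∧
    ∀ χ' < χ, ∀ v, IsStart (σ₅.arr aLB) M v →
      HasList σ' (σ₅.arr aLB) (σ₅.arr aLA) (σ₅.arr aNV) α s M χ' v)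
    (fun _ => letterCost (α.cat (.term s))) rfl ?_ ?_ ?_ ?_).frame).mono ?_
  · intro σ' hF
    have := hF.reg rS rfl
    simp [this, h₅.alphabet]
  · rintro χ σ' x ⟨a₁, a₂, a₃, a₄⟩
    refine ⟨?_, by simpa using a₂, by simpa using a₃, fun χ' hχ v hv => ?_⟩
    · simpa [FlagsLe] using a₁
    · exact (a₄ χ' hχ v hv).congr (by simp) (fun _ _ => by simp) (by simp)
  · rintro χ hχ σ' hF ⟨a₁, a₂, a₃, a₄⟩ hX
    refine (runs_letterLists (h₅.frame hF ⟨rfl, rfl, rfl, rfl, rfl, rfl⟩) (hs₅.frame hF ⟨rfl, rfl⟩)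
      hM.symm (isClass_isTerm (by omega)) hX a₁ (hF.arr aLB rfl) (hF.arr aLA rfl)
      (hF.arr aNV rfl) a₂ a₄).mono ?_
    rintro σ'' t ⟨ht, b₁, b₂, b₃, b₄⟩
    refine ⟨⟨b₁, b₂, fun χ' hχ' => ?_, fun χ' hχ' => b₄ χ' (by omega)⟩, ht⟩
    rw [b₃]
    by_cases he : χ' = χ
    · simp [he]
    · rw [Function.update_of_ne he, a₃ χ' (by omega)]
  · exact ⟨hflags, by simp [hB], by simp, by simp⟩
  · rintro σ₆ t₆ ⟨⟨⟨-, -, a₃, a₄⟩, ht₆⟩, F₆⟩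
    have h₆ := h₅.frame F₆ ⟨rfl, rfl, rfl, rfl, rfl, rfl⟩
    refine ⟨?_, h₆, ?_, ?_, fun χ hχ => a₃ χ (by omega)⟩
    · rw [← hM] at ht₂ ht₄
      simp at ht₆
      rw [prepareCost]
      omega
    · refine ⟨hreg, hdet, fun k j k' ho => (hα _ _ _ _ ho).false, h₆.coded.isLabelling, ?_, ?_⟩
      · rw [F₆.arr aNV rfl]
        exact hT.congr hNV
      · rw [F₆.arr aNV rfl, hNV 1 (by omega), hone]
    · intro χ hχ v hv
      rw [F₆.arr aLB rfl] at hv ⊢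
      rw [F₆.arr aLA rfl, F₆.arr aNV rfl]
      exact a₄ χ (by omega) v hv

end Decider

end DetRegex

/-! ### Targets of list entries, and comparison of values with the input. -/

namespace DetRegex

section Targets

variable {α : Expr ℕ ℕ} {e : ℕ} {lb la nv nc : ℕ → ℕ} {v D n a : ℕ} {fs fe fv : ℕ → ℕ}

/-- The states to which an entry leads are initial states. -/
def TargetOk (α : Expr ℕ ℕ) (e : ℕ) (lb la : ℕ → ℕ) (a : ℕ) : Entry → Prop
  | .done u => (Decider.IsStart lb (α.cat (.term e)).size u ∧ Live (α.cat (.term e)) u) ∧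
    ∃ p L, Residual (α.cat (.term e)) p L ∧ labelOf lb la p = some (.term a) ∧ u = p + 1
  | .copy _ u => Decider.IsStart lb (α.cat (.term e)).size u ∧ Live (α.cat (.term e)) u
  | _ => True

theorem IsSystem.nextState_of_letter (S : IsSystem α e (labelOf lb la) nv)
    (hR : IsRow (isTerm a) α e nc) {L} (hv : Residual (α.cat (.term e)) v L)
    (hn : nextState nv nc v ≠ 0) {b} (hb : labelOf lb la v = some b) (hbr : ¬ b.IsBracket) :
    nextState nv nc v = v + 1 := by
  unfold nextState at hn ⊢
  split_ifs at hn ⊢ with h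
  · cases hv.reach hR.table S.labels hR.one h with
    | letter _ _ _ h => exact h
    | step hs => exact absurd (hs _ hb) hbr
  · cases hv.reach S.varTable S.labels S.varTable_one hn with
    | letter _ _ _ h => exact h
    | step hs => exact absurd (hs _ hb) hbr

theorem IsSystem.isStart_succ (S : IsSystem α e (labelOf lb la) nv) {L}
    (hv : Residual (α.cat (.term e)) v L) (h : lb v = 2 ∨ lb v = 3) :
    Decider.IsStart lb (α.cat (.term e)).size (v + 1) := by
  have hlt := hv.lt
  obtain ⟨j, δ, k, ho, ⟨rfl, -⟩ | ⟨rfl, -⟩⟩ := hv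
  · exact Or.inr ⟨j, by omega, h, rfl⟩
  · have hs := (S.labels _ _ _ _ ho).silent_exit
    rcases h with h | h
    · exact (hs (.term (la (2 * j + 1))) (by simp [labelOf, h])).elim
    · exact (hs (.var (la (2 * j + 1))) (by simp [labelOf, h])).elim

/-- Entries `done` and `copy` are made at a letter, and the only edge from there leads to the state
behind it. So evaluation resumes only in states whose lists have been computed. For `done` the
letter is recorded too, in order to recognise the marker. -/
theorem IsSystem.targetOk (S : IsSystem α e (labelOf lb la) nv)
    (hR : IsRow (isTerm a) α e nc) (hv : Live (α.cat (.term e)) v) :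
    ∀ t ∈ walkList lb la nv nc D n v fs fe fv, TargetOk α e lb la a t := by
  induction n generalizing v fs fe fv with
  | zero => simp [walkList, TargetOk]
  | succ n ih =>
    by_cases hn : nextState nv nc v = 0
    · simp [walkList, hn, TargetOk]
    have hv' := hv.nextState S hR hn
    have hrec := fun fs fe fv => ih (fs := fs) (fe := fe) (fv := fv) hv'
    have hcons : ∀ t l, TargetOk α e lb la a t → (∀ t ∈ l, TargetOk α e lb la a t) →
        ∀ t' ∈ t :: l, TargetOk α e lb la a t' := by
      intro t l h₁ h₂ t' ht'
      rcases List.mem_cons.1 ht' with rfl | h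
      · exact h₁
      · exact h₂ _ h
    obtain ⟨fe', hfe'⟩ : ∃ f, f = Function.update fe (la v) (if fs (la v) = D then D else 0) :=
      ⟨_, rfl⟩
    obtain ⟨L, r, hL, hr⟩ := hv
    simp only [walkList, if_neg hn, ← hfe']
    split_ifs with h2 h7 hfs h8 hfv h3 hfe
    · have hl : labelOf lb la v = some (.term (la v)) := by simp [labelOf, h2]
      have hu := S.nextState_of_letter hR hL hn hl id
      refine hcons _ _ ⟨⟨?_, hv'⟩, v, L, hL, ?_, hu⟩ (hcons _ _ trivial (by simp))
      · rw [hu]; exact S.isStart_succ hL (Or.inl h2)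
      · rw [hl, S.eq_of_term hR ⟨L, r, hL, hr⟩ hn hl]
    · exact hrec _ _ _
    · exact hcons _ _ trivial (hrec _ _ _)
    · exact hrec _ _ _
    · exact hcons _ _ trivial (hrec _ _ _)
    · exact hrec _ _ _
    · have hl : labelOf lb la v = some (.var (la v)) := by simp [labelOf, h3]
      have hu := S.nextState_of_letter hR hL hn hl id
      refine hcons _ _ ⟨?_, hv'⟩ (hrec _ _ _)
      rw [hu]; exact S.isStart_succ hL (Or.inr h3)
    · exact hrec _ _ _

/-- The final `fail` keeps the evaluation from running past the end of a list. -/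
theorem walkList_eq_append :
    ∃ l, walkList lb la nv nc D n v fs fe fv = l ++ [.fail] := by
  induction n generalizing v fs fe fv with
  | zero => exact ⟨[], rfl⟩
  | succ n ih =>
    obtain ⟨fe', hfe'⟩ : ∃ f, f = Function.update fe (la v) (if fs (la v) = D then D else 0) :=
      ⟨_, rfl⟩
    have hcons : ∀ (t : Entry) (fs fe fv), ∃ l, t :: walkList lb la nv nc D n (nextState nv nc v)
        fs fe fv = l ++ [.fail] := by
      intro t fs fe fv
      obtain ⟨l, hl⟩ := ih (v := nextState nv nc v) (fs := fs) (fe := fe) (fv := fv)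
      exact ⟨t :: l, by rw [hl]; rfl⟩
    simp only [walkList, ← hfe']
    split_ifs
    · exact ⟨[], rfl⟩
    · exact ⟨[_], rfl⟩
    all_goals first | exact ih | exact hcons _ _ _ _

end Targets

namespace Decider

open RAM RAM.Exp

variable {inp : ℕ → ℕ} {m s : ℕ} {σ σ' : Store} {α β : Expr ℕ ℕ} {u : List ℕ} {c : Cmd}
  {d : DerefState ℕ ℕ}

/-! ### Evaluation -/

/-- Compare the value of the variable in register `rY` with the word. -/
def compare : Cmd :=
  .loop (rd aVE (var rY) - var rI) <|
    .ite (Exp.ite (var rC) (var rN) 0 (Exp.ite (rd aW (var rI)) (rd aW (var rC)) 1 0))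
      (.block [.asg rI (var rI + 1), .asg rC (var rC + 1)])
      (.block [.asg rOK 0, .asg rC (var rN), .asg rI (rd aVE (var rY))])

theorem take_succ_getD {i : ℕ} (h : i < u.length) : u.take (i + 1) = u.take i ++ [u.getD i 0] := by
  rw [List.take_add_one, List.getElem?_eq_getElem h, List.getD_eq_getElem _ _ h]
  rfl

/-- A mismatch moves `rC` to the end of the word, so in both outcomes the number of comparisons is
bounded by the progress of `rC`, to which the cost can be charged. The value is a factor of the part
already read, so only its two ends are stored. -/
theorem runs_compare {a b p : ℕ} (hN : σ.reg rN = u.length)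
    (hW : ∀ i < u.length, σ.arr aW i = u.getD i 0) (hI : σ.reg rI = a)
    (hE : σ.arr aVE (σ.reg rY) = b) (hC : σ.reg rC = p) (hOK : σ.reg rOK = 1) (hab : a ≤ b)
    (hbp : b ≤ p) (hp : p ≤ u.length) :
    Runs inp m compare σ fun σ' t => t ≤ 4 * (σ'.reg rC - p) + 7 ∧ σ'.reg rC ≤ u.length ∧
      (σ'.reg rOK = 1 ∧ σ'.reg rC = p + (b - a) ∧
        u.take (σ'.reg rC) = u.take p ++ (u.take b).drop a ∨
      σ'.reg rOK = 0 ∧ σ'.reg rC = u.length ∧ ¬ u.take p ++ (u.take b).drop a <+: u) := by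
  refine (Runs.frame <| Runs.loop (fun σ' => σ'.reg rC ≤ u.length ∧ σ'.reg rI ≤ b ∧
      (σ'.reg rOK = 1 ∧ a ≤ σ'.reg rI ∧ σ'.reg rC = p + (σ'.reg rI - a) ∧
        u.take (σ'.reg rC) = u.take p ++ (u.take (σ'.reg rI)).drop a ∨
      σ'.reg rOK = 0 ∧ σ'.reg rI = b ∧ σ'.reg rC = u.length ∧
        ¬ u.take p ++ (u.take b).drop a <+: u))
    (fun σ' => if σ'.reg rOK = 0 then 0 else 4 * min (b - σ'.reg rI) (u.length - σ'.reg rC) + 6)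
    ?_ ?_).mono ?_
  · rintro σ₁ hF ⟨h₁, h₂, h₃⟩ hne
    have hY := hF.reg rY rfl
    have hE₁ := hF.arr aVE rfl
    have hN₁ := (hF.reg rN rfl).trans hN
    have hW₁ := hF.arr aW rfl
    simp [hY, hE₁, hE] at hne
    rcases h₃ with ⟨h₃, h₄, h₅, h₆⟩ | ⟨-, h₃, -⟩
    swap
    · omega
    rw [runs_ite]
    simp only [Exp.eval_ite, Exp.eval_var, Exp.eval_zero, Exp.eval_rd, Exp.eval_one, hN₁, hW₁]
    by_cases hmatch : σ₁.reg rC < u.length ∧ u.getD (σ₁.reg rI) 0 = u.getD (σ₁.reg rC) 0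
    · have hc : (if σ₁.reg rC = u.length then 0 else
          if σ.arr aW (σ₁.reg rI) = σ.arr aW (σ₁.reg rC) then 1 else 0) = 1 := by
        rw [if_neg (by omega), hW _ (by omega), hW _ hmatch.1, if_pos hmatch.2]
      rw [hc, if_neg one_ne_zero]
      simp [h₃]
      refine ⟨⟨by omega, by omega, by omega, by omega, ?_⟩, by omega⟩
      rw [take_succ_getD hmatch.1, h₆, take_succ_getD (by omega : σ₁.reg rI < u.length),
        List.drop_append_of_le_length (by simp; omega), hmatch.2, List.append_assoc]
    · have hc : (if σ₁.reg rC = u.length then 0 else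
          if σ.arr aW (σ₁.reg rI) = σ.arr aW (σ₁.reg rC) then 1 else 0) = 0 := by
        split_ifs with h₇ h₈
        · rfl
        · rw [hW _ (by omega), hW _ (by omega)] at h₈
          exact absurd ⟨by omega, h₈⟩ hmatch
        · rfl
      rw [hc, if_pos rfl]
      simp [h₃, hN₁, hE₁, hE, hY]
      refine fun hpre => hmatch ?_
      have h₇ : u.take p ++ (u.take (σ₁.reg rI + 1)).drop a <+: u.take p ++ (u.take b).drop a := by
        rw [List.prefix_append_right_inj]
        exact (List.take_prefix_take_left (by omega)).drop _
      have h₈ := h₇.trans hpre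
      rw [take_succ_getD (by omega : σ₁.reg rI < u.length),
        List.drop_append_of_le_length (by simp; omega), ← List.append_assoc, ← h₆] at h₈
      have hlen := h₈.length_le
      simp [Nat.min_eq_left h₁] at hlen
      refine ⟨by omega, ?_⟩
      have h₉ := List.prefix_iff_eq_take.1 h₈
      simp only [List.length_append, List.length_take, Nat.min_eq_left h₁, List.length_singleton] at h₉
      rw [take_succ_getD (by omega)] at h₉
      simpa using h₉
  · refine ⟨by omega, by omega, Or.inl ⟨hOK, by omega, by omega, ?_⟩⟩
    rw [hC, hI, List.drop_eq_nil_of_le (by simp), List.append_nil]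
  · rintro σ₁ t ⟨⟨⟨h₁, h₂, h₃⟩, h₄, h₅⟩, hF⟩
    have hY := hF.reg rY rfl
    have hE₁ := hF.arr aVE rfl
    simp [hY, hE₁, hE] at h₄
    simp [hOK, hI, hC] at h₅
    rcases h₃ with ⟨h₆, h₇, h₈, h₉⟩ | ⟨h₆, h₇, h₈, h₉⟩
    · have hb : σ₁.reg rI = b := by omega
      rw [hb] at h₈ h₉
      exact ⟨by omega, h₁, Or.inl ⟨h₆, h₈, h₉⟩⟩
    · exact ⟨by omega, h₁, Or.inr ⟨h₆, h₈, h₉⟩⟩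

end Decider

end DetRegex

/-! ### Evaluation along the input word. -/

namespace DetRegex

namespace Decider

open RAM RAM.Exp

variable {inp : ℕ → ℕ} {m s : ℕ} {σ σ' : Store} {α β : Expr ℕ ℕ} {u : List ℕ} {c : Cmd}
  {d : DerefState ℕ ℕ} {lb la nv : ℕ → ℕ} {P : Prop} {a p : ℕ}

/-- The memory represents the state of the evaluation along the word `u`. -/
structure Follows (σ : Store) (u : List ℕ) (d : DerefState ℕ ℕ) : Prop where
  out : d.out = u.take (σ.reg rC)
  start : ∀ x, d.start x = σ.arr aST x
  value : ∀ x, d.value x = (u.take (σ.arr aVE x)).drop (σ.arr aVS x)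
  le : ∀ x, σ.arr aVE x ≤ σ.reg rC

/-- Between letters, with `P` the statement to be decided. -/
def Between (α : Expr ℕ ℕ) (s : ℕ) (lb : ℕ → ℕ) (u : List ℕ) (P : Prop) (σ : Store) : Prop :=
  σ.reg rC ≤ u.length ∧
    (σ.reg rOK = 1 ∧ IsStart lb (α.cat (.term s)).size (σ.reg rV) ∧
      Live (α.cat (.term s)) (σ.reg rV) ∧
      (∃ d, Follows σ u d ∧ (P ↔ Accepts (α.cat (.term s)) u (σ.reg rV) d)) ∧
      (σ.reg rC = u.length → P) ∨
    σ.reg rOK = 0 ∧ σ.reg rC = u.length ∧ ¬ P)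

/-- Within a list of entries, which ends at `b`. -/
def Within (α : Expr ℕ ℕ) (s : ℕ) (lb la : ℕ → ℕ) (u : List ℕ) (a p b : ℕ) (P : Prop)
    (σ : Store) : Prop :=
  σ.reg rOK = 1 ∧ σ.reg rC = p ∧ ∃ l d, PoolAt σ (σ.reg rE) l ∧ (∃ l', l = l' ++ [.fail]) ∧
    (∀ t ∈ l, TargetOk α s lb la a t) ∧ σ.reg rE + l.length ≤ b ∧ Follows σ u d ∧
    (P ↔ EntriesAccept (α.cat (.term s)) u a l d)

/-- Execution of one entry. -/
def listStep : Cmd := .block [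
  .asg rK (rd aPK (var rE)),
  .asg rY (rd aPX (var rE)),
  .ifEq (var rK) 7 (.block [.st aST (var rY) (var rC), .asg rE (var rE + 1)]) <|
  .ifEq (var rK) 8
    (.block [.st aVS (var rY) (rd aST (var rY)), .st aVE (var rY) (var rC),
      .asg rE (var rE + 1)]) <|
  .ifEq (var rK) 3
    (.ite (rd aVE (var rY) - rd aVS (var rY))
      (.block [.asg rV (rd aPT (var rE)), .asg rI (rd aVS (var rY)), compare, .asg rG 0])
      (.asg rE (var rE + 1))) <|
  .ifEq (var rK) 2
    (.block [.asg rV (rd aPT (var rE)), .asg rC (var rC + 1), .asg rG 0])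
    (.block [.asg rOK 0, .asg rC (var rN), .asg rG 0])]

theorem PoolAt.of_arr {p : ℕ} {l : List Entry} (h : PoolAt σ p l)
    (h₁ : σ'.arr aPK = σ.arr aPK) (h₂ : σ'.arr aPX = σ.arr aPX) (h₃ : σ'.arr aPT = σ.arr aPT) :
    PoolAt σ' p l :=
  h.congr (b := p + l.length) (fun q _ => by rw [h₁, h₂, h₃]; exact ⟨rfl, rfl, rfl⟩) le_rfl

/-- Either the entry is used up at constant cost and the position stays the same, or the list is
left with progress: `done` consumes one letter, a copy consumes a nonempty value, and failure jumps
to the end of the word. -/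
theorem runs_listStep {b : ℕ} (S : IsSystem α s (labelOf lb la) nv) (hN : σ.reg rN = u.length)
    (hW : ∀ i < u.length, σ.arr aW i = u.getD i 0) (hG : σ.reg rG = 1)
    (hlast : ∀ i < u.length, u.getD i 0 = s ↔ i + 1 = u.length) (hp : p < u.length)
    (ha : a = u.getD p 0) (h : Within α s lb la u a p b P σ) :
    Runs inp m listStep σ fun σ' t =>
      (σ'.reg rG = 1 ∧ σ.reg rE < b ∧ σ'.reg rE = σ.reg rE + 1 ∧ t ≤ 11 ∧
        Within α s lb la u a p b P σ') ∨
      (σ'.reg rG = 0 ∧ p < σ'.reg rC ∧ t ≤ 4 * (σ'.reg rC - p) + 20 ∧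
        Between α s lb u P σ') := by
  obtain ⟨hOK, hC, l, d, hl, ⟨l₀, hl₀⟩, hT, hb, hF, hP⟩ := h
  rw [listStep]
  cases l with
  | nil => simp at hl₀
  | cons t l =>
    obtain ⟨⟨hk, hx, ht⟩, hl⟩ := hl
    simp only [List.length_cons] at hb
    have hl₁ : t ≠ .fail → ∃ l', l = l' ++ [.fail] := by
      intro hne
      cases l₀ with
      | nil => simp at hl₀; exact absurd hl₀.1 hne
      | cons _ l₀ => simp at hl₀; exact ⟨l₀, hl₀.2⟩
    have hT₁ : ∀ t ∈ l, TargetOk α s lb la a t := fun t h => hT t (List.mem_cons_of_mem _ h)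
    have hT₀ := hT t List.mem_cons_self
    simp only [runs_block_cons, runs_asg, runs_block_nil, runs_ifEq, runs_ite, runs_st]
    cases t with
    | fail =>
      simp only [Entry.kind, Entry.arg, Entry.target] at hk hx ht
      simp [hk, hN, Between]
      exact ⟨hp, by rw [hP]; simp [EntriesAccept]⟩
    | done v =>
      simp only [Entry.kind, Entry.arg, Entry.target] at hk hx ht
      simp [hk, hC, ht, Between, hOK]
      obtain ⟨⟨h₁, h₂⟩, q, L, hq, hlab, rfl⟩ := hT₀
      have hout : (d.step (.term a)).out = u.take (p + 1) := by
        simp [DerefState.step, hF.out, hC, take_succ_getD hp, ha]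
      refine ⟨by omega, h₁, h₂, ⟨d.step (.term a), ⟨by simpa using hout, ?_, ?_, ?_⟩, ?_⟩, ?_⟩
      · simpa [DerefState.step] using hF.start
      · simpa [DerefState.step] using hF.value
      · intro x
        have := hF.le x
        simp
        omega
      · rw [hP]; rfl
      -- At the end of the word the letter just read is the marker, behind which nothing is left; so
      -- this evaluation accepts.
      · intro hpu
        rw [hP]
        have has : a = s := ha ▸ (hlast p hp).2 hpu
        rw [has] at hlab hout ⊢
        exact ⟨1, [], S.end_residual hq hlab, Language.nil_mem_one,
          hout.trans (List.take_of_length_le (by omega))⟩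
    | opening x =>
      simp only [Entry.kind, Entry.arg, Entry.target] at hk hx ht
      simp [hk, hG, hx, hC]
      refine ⟨by omega, by simp [hOK], by simp [hC], l, d.step (.opening x), ?_, hl₁ (by simp), hT₁,
        by simp; omega, ⟨?_, ?_, ?_, ?_⟩, ?_⟩
      · exact PoolAt.of_arr (by simpa using hl) (by simp) (by simp) (by simp)
      · simpa [DerefState.step] using hF.out
      · intro y
        simp [DerefState.step, hF.out, Function.update_apply, hF.start, hC, hp.le]
      · simpa [DerefState.step] using hF.value
      · simpa using hF.le
      · rw [hP]; rfl
    | closing x =>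
      simp only [Entry.kind, Entry.arg, Entry.target] at hk hx ht
      simp [hk, hG, hx, hC]
      refine ⟨by omega, by simp [hOK], by simp [hC], l, d.step (.closing x), ?_, hl₁ (by simp), hT₁,
        by simp; omega, ⟨?_, ?_, ?_, ?_⟩, ?_⟩
      · exact PoolAt.of_arr (by simpa using hl) (by simp) (by simp) (by simp)
      · simpa [DerefState.step] using hF.out
      · simpa [DerefState.step] using hF.start
      · intro y
        by_cases hy : y = x
        · subst hy
          simp [DerefState.step, hF.out, hF.start, hC]
        · simp [DerefState.step, hy, hF.value]
      · intro y
        have := hF.le y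
        simp [Function.update_apply]
        split_ifs <;> omega
      · rw [hP]; rfl
    | copy x v =>
      simp only [Entry.kind, Entry.arg, Entry.target] at hk hx ht
      have hle := hF.le x
      have hval := hF.value x
      rw [EntriesAccept] at hP
      simp [hk, hG, hx, ht]
      split_ifs with hz
      · have hv : d.value x = [] := by
          rw [hval, List.drop_eq_nil_iff, List.length_take]; omega
        rw [if_pos hv] at hP
        refine ⟨by omega, by simp [hOK], by simp [hC], l, d, ?_, hl₁ (by simp), hT₁,
          by simp; omega, ⟨?_, ?_, ?_, ?_⟩, hP⟩
        · exact PoolAt.of_arr (by simpa using hl) (by simp) (by simp) (by simp)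
        · simpa using hF.out
        · simpa using hF.start
        · simpa using hF.value
        · simpa using hF.le
      · have hv : d.value x ≠ [] := by
          rw [hval, Ne, List.drop_eq_nil_iff, List.length_take]; omega
        rw [if_neg hv] at hP
        refine (runs_compare (u := u) (a := σ.arr aVS x) (b := σ.arr aVE x) (p := p) (by simpa)
          (by simpa) (by simp) (by simp) (by simp [hC]) (by simp [hOK]) (by omega) (by omega)
          hp.le).frame.mono ?_
        rintro σ₁ n ⟨⟨h₁, h₂, h₃⟩, hfr⟩
        have hST : σ₁.arr aST = σ.arr aST := by simpa using hfr.arr aST rfl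
        have hVS : σ₁.arr aVS = σ.arr aVS := by simpa using hfr.arr aVS rfl
        have hVE : σ₁.arr aVE = σ.arr aVE := by simpa using hfr.arr aVE rfl
        have hV : σ₁.reg rV = v := by simpa using hfr.reg rV rfl
        have hout : (d.step (.var x)).out =
            u.take p ++ (u.take (σ.arr aVE x)).drop (σ.arr aVS x) := by
          simp [DerefState.step, hF.out, hC, hval]
        rcases h₃ with ⟨h₃, h₄, h₅⟩ | ⟨h₃, h₄, h₅⟩
        · refine ⟨by omega, by omega, by simpa using h₂, Or.inl ⟨by simpa using h₃, ?_, ?_,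
            ⟨d.step (.var x), ⟨?_, ?_, ?_, ?_⟩, ?_⟩, ?_⟩⟩
          · simpa [hV] using hT₀.1
          · simpa [hV] using hT₀.2
          · simpa [h₅] using hout
          · simpa [DerefState.step, hST] using hF.start
          · simpa [DerefState.step, hVE, hVS] using hF.value
          · intro y
            have := hF.le y
            simp [hVE]
            omega
          · simpa [hV] using hP
          -- This cannot happen: the last letter of the word would be the marker, but the copied
          -- value is a factor of the first `p` letters, which do not contain it.
          · intro hend
            simp at hend
            have h₆ := congrArg (fun l => l.getD (u.length - 1) 0) h₅
            rw [hend, List.take_length, List.getD_append_right _ _ _ _ (by simp; omega)] at h₆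
            simp only [List.getD_eq_getElem?_getD, List.getElem?_drop, List.length_take,
              List.getElem?_take, Nat.min_eq_left hp.le] at h₆
            rw [if_pos (by omega)] at h₆
            have h₇ := (hlast (u.length - 1) (by omega)).2 (by omega)
            rw [List.getD_eq_getElem?_getD, h₆, ← List.getD_eq_getElem?_getD,
              hlast _ (by omega)] at h₇
            omega
        · refine ⟨by omega, by omega, by simpa using h₂, Or.inr ⟨by simpa using h₃,
            by simpa using h₄, ?_⟩⟩
          rw [hP]
          exact fun hA => h₅ (hout ▸ hA.out_prefix)

/-- Decide membership after the preparation. -/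
def evaluate : Cmd := .block [
  .asg rV 0,
  .asg rC 0,
  .asg rOK 1,
  .loop (var rN - var rC) (.block [
    .asg rE (rd aH (rd aRB (rd aW (var rC)) + var rV)),
    .asg rG 1,
    .loop (var rG) listStep])]

theorem getD_eq_last_iff {w : List ℕ} (hw : ∀ c ∈ w, c < s) :
    ∀ i < (w ++ [s]).length, (w ++ [s]).getD i 0 = s ↔ i + 1 = (w ++ [s]).length := by
  intro i hi
  rw [List.length_append, List.length_singleton] at *
  by_cases h : i < w.length
  · rw [List.getD_append _ _ _ _ h, List.getD_eq_getElem _ _ h]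
    have := hw _ (List.getElem_mem h)
    omega
  · obtain rfl : i = w.length := by omega
    simp

/-- Every round of the outer loop consumes a letter and has a budget of `60 * k + 60` for it. A list
has at most `5 * k + 2` entries, each costing at most `12` with its test. At the end of the word
`Between` yields the answer: with `rOK = 1` the marker has been read, and `rOK = 0` means rejection.
-/
theorem runs_evaluate {w : List ℕ} (h : Prepared σ s α (w ++ [s])) (hw : ∀ c ∈ w, c < s)
    (hST : ∀ x, σ.arr aST x = 0) (hVS : ∀ x, σ.arr aVS x = 0) (hVE : ∀ x, σ.arr aVE x = 0) :
    Runs inp m evaluate σ fun σ' t => t ≤ (w.length + 1) * (60 * α.vars.card + 60) + 5 ∧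
      (σ'.reg rOK = 1 ∧
          Accepts (α.cat (.term s)) (w ++ [s]) 0 ⟨[], fun _ => 0, fun _ => []⟩ ∨
        σ'.reg rOK = 0 ∧
          ¬ Accepts (α.cat (.term s)) (w ++ [s]) 0 ⟨[], fun _ => 0, fun _ => []⟩) := by
  set u := w ++ [s] with hu
  set P := Accepts (α.cat (.term s)) u 0 ⟨[], fun _ => 0, fun _ => []⟩ with hPdef
  have hlast := getD_eq_last_iff hw
  rw [← hu] at hlast
  have hul : u.length = w.length + 1 := by simp [hu]
  obtain ⟨lb, hlb⟩ : ∃ f, f = σ.arr aLB := ⟨_, rfl⟩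
  obtain ⟨la, hla⟩ : ∃ f, f = σ.arr aLA := ⟨_, rfl⟩
  obtain ⟨nv, hnv⟩ : ∃ f, f = σ.arr aNV := ⟨_, rfl⟩
  have S := h.system
  rw [← hlb, ← hla, ← hnv] at S
  have hcoded := h.loaded.coded
  rw [← hlb, ← hla] at hcoded
  rw [evaluate]
  simp only [runs_block_cons, runs_asg, runs_block_nil]
  refine (Runs.frame <| Runs.loop (Between α s lb u P)
    (fun σ' => (u.length - σ'.reg rC) * (60 * α.vars.card + 60)) ?_ ?_).mono ?_
  · intro σ₁ F hB hne
    have hN : σ₁.reg rN = u.length := by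
      rw [F.reg rN rfl]; simpa using h.loaded.length
    have hW : σ₁.arr aW = σ.arr aW := by simpa using F.arr aW rfl
    have hRB : σ₁.arr aRB = σ.arr aRB := by simpa using F.arr aRB rfl
    have hH : σ₁.arr aH = σ.arr aH := by simpa using F.arr aH rfl
    have hPK : σ₁.arr aPK = σ.arr aPK := by simpa using F.arr aPK rfl
    have hPX : σ₁.arr aPX = σ.arr aPX := by simpa using F.arr aPX rfl
    have hPT : σ₁.arr aPT = σ.arr aPT := by simpa using F.arr aPT rfl
    simp only [Exp.eval_sub, Exp.eval_var, hN] at hne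
    obtain ⟨hle, ⟨hOK, hst, hlive, ⟨d, hF, hP⟩, -⟩ | ⟨-, hC, -⟩⟩ := hB
    swap
    · omega
    obtain ⟨p, hp⟩ : ∃ p, p = σ₁.reg rC := ⟨_, rfl⟩
    obtain ⟨v, hv⟩ : ∃ v, v = σ₁.reg rV := ⟨_, rfl⟩
    rw [← hp] at hne hle
    rw [← hv] at hst hlive hP
    have hpu : p < u.length := by omega
    obtain ⟨a, ha⟩ : ∃ a, a = u.getD p 0 := ⟨_, rfl⟩
    have has : a ≤ s := by
      have hle : ∀ c ∈ u, c ≤ s := by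
        simpa [hu, or_imp, forall_and] using fun c hc => (hw c hc).le
      rw [ha, List.getD_eq_getElem _ _ hpu]
      exact hle _ (List.getElem_mem hpu)
    have hlist := h.lists a has v
    rw [← hlb, ← hla, ← hnv] at hlist
    obtain ⟨nc, D, fs, fe, fv, hD, hflags, hR, hpool, -⟩ := hlist hst
    have hrow := h.rows a has
    obtain ⟨L, r, hL, -⟩ := id hlive
    have hlen := length_walkList_le_card (n := 6 * (α.cat (.term s)).size + 1) (D := D) (fs := fs)
      (fe := fe) (fv := fv) (nv := nv) (nc := nc) hcoded
      (fun v L hL hn => (hL.nextState S hR hn).imp fun _ h => h.1) hD hL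
    have hvars : (α.cat (.term s)).vars = α.vars := by simp [Expr.vars]
    rw [hvars] at hlen
    have htgt := S.targetOk hR hlive (D := D) (n := 6 * (α.cat (.term s)).size + 1) (fs := fs)
      (fe := fe) (fv := fv)
    obtain ⟨E, hE⟩ : ∃ E, E = σ.arr aH (2 * (α.cat (.term s)).size * a + v) := ⟨_, rfl⟩
    obtain ⟨l, hl⟩ : ∃ l, l = walkList lb la nv nc D (6 * (α.cat (.term s)).size + 1) v fs fe fv :=
      ⟨_, rfl⟩
    have hend := walkList_eq_append (lb := lb) (la := la) (nv := nv) (nc := nc) (D := D)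
      (n := 6 * (α.cat (.term s)).size + 1) (v := v) (fs := fs) (fe := fe) (fv := fv)
    -- No flag equals `D`, so the flags assert nothing about the present state of the evaluation.
    -- This is why a list that was made in advance fits every evaluation that arrives in `v`.
    have hacc := S.entriesAccept_iff hR hlive hD (d := d) (w := u) (rem := u.drop (p + 1))
      (n := 6 * (α.cat (.term s)).size + 1)
      (fs := fs) (fe := fe) (fv := fv) (fun x => by simp [hflags x])
      (by rw [hF.out, ← hp, ha, List.getD_eq_getElem _ _ hpu, List.getElem_cons_drop,
        List.take_append_drop])
      (fun has => by
        rw [ha, hlast p hpu] at has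
        rw [has, List.drop_length])
      (by omega)
    rw [← hl] at hpool hlen htgt hend hacc
    rw [← hE] at hpool
    simp only [runs_block_cons, runs_asg, runs_block_nil]
    have heval : (rd aH (rd aRB (rd aW (var rC)) + var rV)).eval σ₁ = E := by
      simp only [Exp.eval_rd, Exp.eval_add, Exp.eval_var, hH, hRB, hW, ← hp, ← hv,
        h.loaded.word p hpu, ← ha, hrow, hE]
    rw [heval]
    refine (Runs.loop (fun σ' => σ'.reg rG = 1 ∧ Within α s lb la u a p (E + l.length) P σ' ∨
      σ'.reg rG = 0 ∧ p < σ'.reg rC ∧ Between α s lb u P σ')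
      (fun σ' => (if σ'.reg rG = 0 then 0 else 12 * (E + l.length - σ'.reg rE) + 24) +
        4 * (u.length - σ'.reg rC)) ?_ ?_).mono ?_
    · rintro σ₂ F₂ (⟨hG, hI⟩ | ⟨hG, -⟩) hne
      · refine (runs_listStep S (by rw [F₂.reg rN rfl]; simpa using hN)
          (by rw [F₂.arr aW rfl]; simpa [hW] using h.loaded.word) hG hlast hpu ha hI).mono ?_
        have hCp := hI.2.1
        rintro σ₃ t (⟨h₁, h₂, h₃, h₄, h₅⟩ | ⟨h₁, h₂, h₃, h₄⟩)
        · have := h₅.2.1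
          simp only [hG, h₁, h₃, hCp, this]
          exact ⟨Or.inl ⟨trivial, h₅⟩, by simp; omega⟩
        · have := h₄.1
          simp only [hG, h₁, hCp]
          exact ⟨Or.inr ⟨trivial, h₂, h₄⟩, by simp; omega⟩
      · simp [hG] at hne
    · refine Or.inl ⟨by simp, by simpa using hOK, by simp [hp], l, d, ?_, hend, htgt,
        by simp, ⟨?_, ?_, ?_, ?_⟩, hP.trans hacc.symm⟩
      · exact PoolAt.of_arr (by simpa using hpool) (by simp [hPK]) (by simp [hPX]) (by simp [hPT])
      · simpa using hF.out
      · simpa using hF.start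
      · simpa using hF.value
      · simpa using hF.le
    · rintro σ₂ t ⟨h₁ | ⟨h₁, h₂, h₃⟩, h₄, h₅⟩
      · simp [h₁.1] at h₄
      · refine ⟨h₃, ?_⟩
        simp [h₁, ← hp] at h₅
        have h₆ := h₃.1
        -- One consumed letter pays for the list; each further one, consumed by copying a value or
        -- skipped after a failure, pays for its own share of the comparison.
        have hd : u.length - p = (u.length - σ₂.reg rC) + (σ₂.reg rC - p - 1) + 1 := by omega
        rw [← hp, hd, Nat.add_mul, Nat.add_mul, one_mul]
        have h₇ : 4 * (σ₂.reg rC - p - 1) ≤ (σ₂.reg rC - p - 1) * (60 * α.vars.card + 60) := by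
          rw [mul_comm]
          exact Nat.mul_le_mul_left _ (by omega)
        omega
  · refine ⟨by simp, Or.inl ⟨by simp, Or.inl (by simp), by simpa using Live.start _,
      ⟨⟨[], fun _ => 0, fun _ => []⟩, ⟨by simp, by simp [hST], by simp [hVS, hVE], by simp [hVE]⟩,
        by simp [hPdef]⟩, by simp [hul]⟩⟩
  · rintro σ₁ t ⟨⟨⟨h₁, h₂⟩, h₃, h₄⟩, F⟩
    simp [hul] at h₄
    refine ⟨by omega, ?_⟩
    have hN : σ₁.reg rN = u.length := by
      rw [F.reg rN rfl]; simpa using h.loaded.length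
    simp [hN] at h₃
    rcases h₂ with ⟨h₅, -, -, -, h₆⟩ | ⟨h₅, -, h₆⟩
    · exact Or.inl ⟨h₅, h₆ (by omega)⟩
    · exact Or.inr ⟨h₅, h₆⟩

end Decider

end DetRegex

/-! ### The machine program and the total cost. -/

namespace DetRegex

/-! ### From structured programs to machine programs -/

namespace RAM

/-- The first instructions of the machine program: compute the length of the input. -/
def prelude : Program :=
  [.const 3 1, .load 3 3, .const 5 2, .load 5 5, .add 3 3 3, .add 3 3 5, .const 5 3, .add 1 3 5]

/-- The prelude takes eight steps and puts the length of the input, known from cells `1` and `2`,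
into register `1`. The cells beyond the input are `0`, which represents empty arrays. A halted
configuration does not change, so any larger number of steps gives the same result. -/
theorem decidesWithin_of_runs {cmd : Cmd} {input : List ℕ} {p : Prop} {T t : ℕ}
    (hlen : input.length = 3 + 2 * input.getD 1 0 + input.getD 2 0)
    (h : Runs (fun i => input.getD i 0) input.length cmd ⟨fun _ => 0, fun _ _ => 0⟩
      fun σ n => n ≤ T ∧ (p → σ.reg 0 = 1) ∧ (¬ p → σ.reg 0 = 0))
    (ht : 8 + cmd.len * T ≤ t) : DecidesWithin (prelude ++ cmd.code 8) input p t := by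
  obtain ⟨σ, n, hex, hn, h₁, h₂⟩ := h
  set P := prelude ++ cmd.code 8 with hP
  have hcode : CodeAt P 0 P := fun i ins hi => by simpa using hi
  have hcmd := hcode
  nth_rw 2 [hP] at hcode
  rw [codeAt_append] at hcode
  obtain ⟨hpre, hcode⟩ := hcode
  simp only [prelude, codeAt_cons, Nat.zero_add, List.length_cons, List.length_nil,
    Nat.reduceAdd] at hpre hcode
  obtain ⟨i₀, i₁, i₂, i₃, i₄, i₅, i₆, i₇, -⟩ := hpre
  obtain ⟨c, hc, hpc, hmem, hreg, hoff⟩ : ∃ c, Steps P 8 (init input) c ∧ c.pc = 8 ∧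
      c.mem = (init input).mem ∧ (∀ r, c.reg (2 * r) = 0) ∧ c.reg 1 = input.length := by
    refine ⟨_, Steps.cons i₀ (Steps.cons i₁ (Steps.cons i₂ (Steps.cons i₃ (Steps.cons i₄
      (Steps.cons i₅ (Steps.cons i₆ (Steps.one i₇))))))), ?_, ?_, ?_, ?_⟩
    · simp [Instr.exec, init]
    · simp [Instr.exec]
    · intro r
      have h₁ : 2 * r ≠ 1 := by omega
      have h₃ : 2 * r ≠ 3 := by omega
      have h₅ : 2 * r ≠ 5 := by omega
      simp [Instr.exec, init, h₁, h₃, h₅]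
    · simp [Instr.exec, init] at hlen ⊢
      omega
  have hrep : Represents (fun i => input.getD i 0) input.length ⟨fun _ => 0, fun _ _ => 0⟩ c := by
    refine ⟨hreg, hoff, fun a _ => by rw [hmem]; rfl, fun k i => ?_⟩
    rw [hmem]
    exact List.getD_eq_default _ _ (by omega)
  obtain ⟨n', hn', c', hc', hpc', hrep'⟩ := Cmd.run hex c (by rwa [hpc]) hrep
  have hhalt : Halted P c' := by
    rw [Halted, hpc', hpc, hP, List.length_append, Cmd.length_code]
    rfl
  have hfix : step P c' = c' := by
    rw [step, List.getElem?_eq_none hhalt]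
  have hfinal : (step P)^[t] (init input) = c' := by
    have hle : n' + 8 ≤ t := by
      have := Nat.mul_le_mul_left cmd.len hn
      omega
    obtain ⟨k, rfl⟩ := Nat.exists_eq_add_of_le hle
    rw [add_comm _ k, Function.iterate_add_apply]
    have h₃ := hc.trans hc'
    rw [Steps, add_comm] at h₃
    rw [h₃]
    exact Function.iterate_fixed hfix k
  have hr := hrep'.reg 0
  rw [DecidesWithin, hfinal]
  exact ⟨hhalt, fun hp => hr.trans (h₁ hp), fun hp => hr.trans (h₂ hp)⟩

end RAM

/-! ### The decision procedure -/

theorem accepts_cat_term_iff {α : Expr ℕ ℕ} {s : ℕ} {w : List ℕ} :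
    Accepts (α.cat (.term s)) (w ++ [s]) 0 ⟨[], fun _ => 0, fun _ => []⟩ ↔ w ∈ α.language := by
  have h0 : Residual (α.cat (.term s)) 0 ((α.cat (.term s)).posLanguage 0 * 1) :=
    Residual.enter (.here _ _ _)
  rw [mul_one] at h0
  constructor
  · rintro ⟨L, τ, hL, hτ, hout⟩
    rw [hL.unique h0] at hτ
    obtain ⟨ρ, hρ, rfl⟩ := mem_posLanguage_cat_term.1 hτ
    refine ⟨ρ.map Prod.fst, ?_, ?_⟩
    · rw [← α.map_posLanguage_fst 1]
      exact ⟨ρ, hρ, rfl⟩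
    · rw [runWord_append] at hout
      simpa [DerefState.step, deref, runWord] using hout
  · rintro ⟨r, hr, hout⟩
    rw [← α.map_posLanguage_fst 1] at hr
    obtain ⟨ρ, hρ, rfl⟩ := hr
    refine ⟨_, _, h0, mem_posLanguage_cat_term.2 ⟨ρ, hρ, rfl⟩, ?_⟩
    rw [runWord_append]
    simpa [DerefState.step, deref, runWord] using hout

theorem Occ.term_lt {s : ℕ} {β : Expr (Fin s) ℕ} {i j a : ℕ}
    {k k' : Language (RefSym ℕ ℕ × ℕ)}
    (h : Occ (β.mapTerm Fin.val) i k j (.term a) k') : a < s := by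
  induction β generalizing i k with
  | empty | eps | ref => cases h
  | term b => cases h; exact b.isLt
  | cat β γ ih₁ ih₂ =>
    cases h with
    | catL h => exact ih₁ h
    | catR h => exact ih₂ h
  | alt β γ ih₁ ih₂ =>
    cases h with
    | altL h => exact ih₁ h
    | altR h => exact ih₂ h
  | plus β ih =>
    cases h with
    | plus h => exact ih h
  | bind x β ih =>
    cases h with
    | bind h => exact ih h

theorem Expr.card_vars_le_size {A : Type*} (α : Expr A ℕ) : α.vars.card ≤ α.size := by
  induction α with
  | empty | eps | term => simp [vars, size]
  | ref => simp [vars, size]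
  | cat β γ h₁ h₂ | alt β γ h₁ h₂ =>
    have := Finset.card_union_le β.vars γ.vars
    simp only [vars, size]
    omega
  | plus β ih => simp only [vars, size]; omega
  | bind x β ih =>
    have := Finset.card_insert_le x β.vars
    simp only [vars, size]
    omega

namespace Decider

open RAM RAM.Exp

/-- The decision procedure. -/
def decider : Cmd := .seq prepare evaluate

/-- The maxima are at least `1`, and so are `s` and the size, so additive constants, the extra
terminal and the two extra nodes are absorbed by larger factors. The share `60 * k + 60` of the
marker itself is charged to the preparation, by `k ≤ α.size`. -/
theorem cost_le {α : Expr ℕ ℕ} {s L : ℕ} (hs : 1 ≤ s) :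
    prepareCost s L α + ((L + 1) * (60 * α.vars.card + 60) + 5) ≤
      3000 * (s * α.size * max α.occurrences 1 + max α.vars.card 1 * L) := by
  have hk := α.card_vars_le_size
  have hM := α.size_pos
  have hocc : (α.cat (.term s)).occurrences = α.occurrences + 1 := by simp [Expr.occurrences]
  have hsize : (α.cat (.term s)).size = α.size + 2 := by simp [Expr.size]
  rw [prepareCost, letterCost, hocc, hsize]
  generalize α.vars.card = k at *
  generalize α.size = M at *
  generalize hN : max α.occurrences 1 = N
  have hN₁ : 1 ≤ N := by omega
  have hn : α.occurrences ≤ N := by omega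
  generalize hK : max k 1 = K
  have hK₁ : 1 ≤ K := by omega
  have hkK : k ≤ K := by omega
  generalize α.occurrences = n at *
  have hMN : M ≤ M * N := Nat.le_mul_of_pos_right _ hN₁
  have hsMN : M * N ≤ s * M * N := by
    rw [mul_assoc]; exact Nat.le_mul_of_pos_left _ hs
  have hletter : 28 * (M + 2) + (108 * (M + 2) + 40) * (n + 1 + 1) + 10 + 2 ≤ 1190 * (M * N) := by
    have : (108 * (M + 2) + 40) * (n + 1 + 1) ≤ 1092 * (M * N) :=
      (Nat.mul_le_mul (by omega : _ ≤ 364 * M) (by omega : _ ≤ 3 * N)).trans (by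
        rw [Nat.mul_mul_mul_comm])
    generalize (108 * (M + 2) + 40) * (n + 1 + 1) = Z at *
    generalize M * N = Y at *
    omega
  have hprep : (s + 1) * (28 * (M + 2) + (108 * (M + 2) + 40) * (n + 1 + 1) + 10 + 2) ≤
      2380 * (s * M * N) := by
    refine (Nat.mul_le_mul (by omega : s + 1 ≤ 2 * s) hletter).trans (le_of_eq ?_)
    ring
  have heval : (L + 1) * (60 * k + 60) ≤ 120 * (K * L) + 120 * M := by
    have h1 : L * (60 * k + 60) ≤ L * (120 * K) := Nat.mul_le_mul_left _ (by omega)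
    have h2 : L * (120 * K) = 120 * (K * L) := by ring
    rw [Nat.add_mul, one_mul]
    omega
  have hL : L ≤ K * L := Nat.le_mul_of_pos_left _ hK₁
  omega

theorem runs_decider {s m : ℕ} {α : Expr ℕ ℕ} {w : List ℕ} {inp : ℕ → ℕ}
    (hs : 1 ≤ s) (hinp : ∀ i, inp i = ([s, α.size, w.length] ++ α.codes ++ w).getD i 0)
    (hm : m = 3 + 2 * α.size + w.length) (hreg : α.IsRegex) (hdet : IsDetLanguage (α.posLanguage 1))
    (hα : ∀ k j a k', Occ α 1 k j (.term a) k' → a < s) (hw : ∀ c ∈ w, c < s) :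
    Runs inp m decider ⟨fun _ => 0, fun _ _ => 0⟩ fun σ n =>
      n ≤ 3000 * (s * α.size * max α.occurrences 1 + max α.vars.card 1 * w.length) ∧
      (w ∈ α.language → σ.reg 0 = 1) ∧ (w ∉ α.language → σ.reg 0 = 0) := by
  rw [decider, runs_seq]
  refine (runs_prepare rfl hinp hm hreg hdet hα).frame.mono ?_
  rintro σ₁ t₁ ⟨⟨ht₁, h₁⟩, F₁⟩
  refine (runs_evaluate h₁ hw (fun x => congrFun (F₁.arr aST rfl) x)
    (fun x => congrFun (F₁.arr aVS rfl) x) (fun x => congrFun (F₁.arr aVE rfl) x)).mono ?_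
  rintro σ₂ t₂ ⟨ht₂, h₂⟩
  rw [accepts_cat_term_iff] at h₂
  refine ⟨(Nat.add_le_add ht₁ ht₂).trans (cost_le hs), ?_, ?_⟩
  · rcases h₂ with h | h
    · exact fun _ => h.1
    · exact fun hw => absurd hw h.2
  · rcases h₂ with h | h
    · exact fun hw => absurd h.2 hw
    · exact fun _ => h.1

end Decider

end DetRegex

theorem mainTheorem2 :
    ∃ (P : DetRegex.RAM.Program) (C : ℕ),
      ∀ (s : ℕ), 1 ≤ s →
        ∀ (α : DetRegex.Expr (Fin s) ℕ), α.IsRegex → α.IsDeterministic →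
          ∀ (w : List (Fin s)),
            DetRegex.RAM.DecidesWithin P (DetRegex.encodeInput α w) (w ∈ α.language)
              (C * (s * α.size * max α.occurrences 1 + max α.vars.card 1 * w.length)) := by
  refine ⟨DetRegex.RAM.prelude ++ DetRegex.Decider.decider.code 8,
    -- Eight steps for the prelude, and `decider.len` machine steps for each unit of the cost in
    -- `Decider.cost_le`. As the bound is at least `1`, the additive `8` may be made a multiple of
    -- it.
    8 + DetRegex.Decider.decider.len * 3000, fun s hs α hreg hdet w => ?_⟩
  have hsize := DetRegex.Expr.size_mapTerm Fin.val α
  have hcodes := α.codes_mapTerm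
  have hlen := (α.mapTerm Fin.val).length_codes
  rw [hcodes, hsize] at hlen
  have hreg' : (α.mapTerm Fin.val).IsRegex := by
    rcases hreg with rfl | h
    · exact Or.inl rfl
    · exact Or.inr (h.mapTerm _)
  have hdet' : DetRegex.IsDetLanguage ((α.mapTerm Fin.val).posLanguage 1) := by
    rw [DetRegex.Expr.posLanguage_mapTerm]
    exact (hdet.isDetLanguage 1).mapTerm Fin.val_injective
  have hrun := DetRegex.Decider.runs_decider (α := α.mapTerm Fin.val) (w := w.map Fin.val)
    (inp := fun i => (DetRegex.encodeInput α w).getD i 0) (m := (DetRegex.encodeInput α w).length) hs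
    (by intro i; rw [hcodes, hsize, List.length_map]; rfl)
    (by simp [DetRegex.encodeInput, hlen, hsize]; omega) hreg' hdet'
    (fun _ _ _ _ h => h.term_lt) (by simp)
  rw [hsize, DetRegex.Expr.occurrences_mapTerm, DetRegex.Expr.vars_mapTerm, List.length_map,
    DetRegex.Expr.mem_language_mapTerm Fin.val_injective] at hrun
  refine DetRegex.RAM.decidesWithin_of_runs ?_ hrun ?_
  · simp [DetRegex.encodeInput, hlen]
    omega
  · have : 1 ≤ s * α.size * max α.occurrences 1 :=
      Nat.mul_pos (Nat.mul_pos hs α.size_pos) (by omega)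
    rw [Nat.add_mul, ← mul_assoc]
    exact Nat.add_le_add_right (by omega) _
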